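/- Let $X_1,X_2,\dots$ be a real-valued symmetric homogeneous Markov chain: a Markov chain with an arbitrary initial law whose transition kernel from $x$ to $y$ depends only on $y-x$, is invariant under $y-x\mapsto x-y$, and has no atoms (for instance, it has a density $K(x-y)$ with $K(x)=K(-x)$), so that almost surely no two values coincide. Let $T(N)$ be the combinatorial level-set tree of $X_1,\dots,X_N$: the planar binary tree whose root is the lowest internal (non-boundary) local minimum of the series, and whose left and right subtrees are the level-set trees of the parts of the series to the left and to the right of that minimum; a series without internal local minima gives a single leaf. Leaves have Horton--Strahler order $1$; a vertex whose children have orders $p,q$ has order $p+1$ if $p=q$ and $\max(p,q)$ otherwise. A branch of order $r$ is a maximal connected set of vertices of order $r$; its terminal vertex is the one farthest from the root. Write $N_r$ for the number of branches of order $r$ in $T(N)$, $\Omega(N)$ for the order of the root, $N_{ij}$ for the number of branches of order $i$ that join non-terminal vertices of branches of order $j>i$, and $T_{ij}=N_{ij}/N_j$. Local minima of order $1$ of $X_1,\dots,X_N$ are its internal local minima, and those of order $r+1$ are the internal local minima of the series of local minima of order $r$. A branch of order $r$ is called complete if its terminal vertex lies (in time) between two consecutive local minima of order $r$. Then: (1)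 (Strong Horton law.) For every $r\ge 1$, almost surely $N_r/(N\,4^{-r})\to 1$ as $N\to\infty$. (2) (Tokunaga self-similarity with parameters $(a,c)=(1,2)$.) For all $i,k\ge 1$ there are independent identically distributed integrable random variables $\tau^1_{i(i+k)},\tau^2_{i(i+k)},\dots$ with values in $\{0,1,2,\dots\}$ and mean $T_k=a\,c^{k-1}=2^{k-1}$ such that, almost surely, for every $N$ and $b$, if $T(N)$ has at least $b$ complete branches of order $i+k$, then the number of branches of order $i$ that join the non-terminal vertices of the $b$-th of them, counted from left to right, equals $\tau^b_{i(i+k)}$. Almost surely the number of complete branches of order $i+k$ in $T(N)$ tends to infinity as $N\to\infty$. (3) Almost surely $\Omega(N)\to\infty$ as $N\to\infty$. (4) For all $i,k\ge 1$, almost surely $T_{i(i+k)}\to 2^{k-1}$ as $N\to\infty$, where $T_{i(i+k)}$ is computed from all (complete and incomplete) branches of $T(N)$. -/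

import Mathlib

open MeasureTheory ProbabilityTheory Filter Topology

/-- `X 0, X 1, X 2, …` is a (time-homogeneous) Markov chain with transition kernel `κ`:
the conditional law of `X (n + 1)` given `X 0, …, X n` is `κ (X n)`. -/
structure IsMarkovChain {Ω : Type*} [MeasurableSpace Ω] (P : Measure Ω)
    (κ : Kernel ℝ ℝ) (X : ℕ → Ω → ℝ) : Prop where
  measurable : ∀ n, Measurable (X n)
  condExp_next : ∀ (n : ℕ) (B : Set ℝ), MeasurableSet B →
    P[(X (n + 1) ⁻¹' B).indicator (fun _ => (1 : ℝ)) |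
        ⨆ k : ℕ, ⨆ _ : k ≤ n, MeasurableSpace.comap (X k) inferInstance]
      =ᵐ[P] fun ω => (κ (X n ω)).real B

/-- A kernel on `ℝ` is homogeneous if a transition from `x` to `y` depends on `y - x` only. -/
def IsHomogeneousKernel (κ : Kernel ℝ ℝ) : Prop :=
  ∀ x : ℝ, κ x = (κ 0).map (fun y => x + y)

/-- A homogeneous kernel is symmetric if the law of its jump is invariant under `y ↦ -y`. -/
def IsSymmetricJump (κ : Kernel ℝ ℝ) : Prop :=
  (κ 0).map (fun y => -y) = κ 0

/-- Planar binary trees in which every internal vertex carries the time of a local minimum and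
every leaf the time of a local maximum. The labels only serve to locate vertices in time; the
Horton-Strahler order, the branches and the side-branch counts depend on the shape alone. -/
inductive MarkedTree : Type
  | leaf (s : ℕ) : MarkedTree
  | node (t : ℕ) (l r : MarkedTree) : MarkedTree

namespace MarkedTree

/-- The Horton-Strahler order of the root. -/
def order : MarkedTree → ℕ
  | leaf _ => 1
  | node _ l r => if l.order = r.order then l.order + 1 else max l.order r.order

/-- The branches of order `r`, from left to right; a branch is represented by the subtree that
hangs from its initial vertex. Orders do not decrease towards the root, so in a tree whose root
has order `r` all vertices of order `r` are connected and form one branch, starting at the root;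
otherwise the branches of order `r` are those of the left and those of the right subtree. -/
def branches (r : ℕ) : MarkedTree → List MarkedTree
  | leaf s => if 1 = r then [leaf s] else []
  | node t a b =>
      if (node t a b).order = r then [node t a b] else branches r a ++ branches r b

/-- The number `N_r` of branches of order `r`. -/
def numBranches (r : ℕ) (T : MarkedTree) : ℕ := (T.branches r).length

/-- The label of the terminal vertex of the branch whose initial vertex is the root: follow the
child that has the order of its parent, until there is none. -/
def terminal : MarkedTree → ℕ
  | leaf s => s
  | node t l r =>
      if l.order = r.order then t else if r.order < l.order then l.terminal else r.terminal

/-- The number of branches of order `i` that join the non-terminal vertices of the branch whose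
initial vertex is the root. A non-terminal vertex has one child on the branch, and its other
child, of smaller order, is the initial vertex of a side branch. -/
def sideCount (i : ℕ) : MarkedTree → ℕ
  | leaf _ => 0
  | node _ l r =>
      if l.order = r.order then 0
      else if r.order < l.order then (if r.order = i then 1 else 0) + sideCount i l
      else (if l.order = i then 1 else 0) + sideCount i r

/-- The total number `N_{ij}` of branches of order `i` that join the non-terminal vertices of
the branches of order `j`. -/
def numSide (i j : ℕ) (T : MarkedTree) : ℕ := ((T.branches j).map (sideCount i)).sum

/-- The Tokunaga index `T_{ij} = N_{ij} / N_j`. -/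
noncomputable def tokunagaIndex (i j : ℕ) (T : MarkedTree) : ℝ :=
  (T.numSide i j : ℝ) / (T.numBranches j : ℝ)

end MarkedTree

/-- The internal local minima of the time series `x` observed at the times in `S`: the times
`t ∈ S` that have a preceding and a following time in `S`, at both of which `x` is larger. -/
def localMinima (x : ℕ → ℝ) (S : Set ℕ) : Set ℕ :=
  {t | t ∈ S ∧ ∃ p ∈ S, ∃ q ∈ S, p < t ∧ t < q ∧
    (∀ s ∈ S, ¬ (p < s ∧ s < t)) ∧ (∀ s ∈ S, ¬ (t < s ∧ s < q)) ∧ x t < x p ∧ x t < x q}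

open Classical in
/-- The level-set tree of the series `x a, …, x b`. If there are internal local minima, then the
root is the lowest one, at time `t` say: at the level `x t` the set where the (interpolated)
series exceeds the level splits into a part to the left and a part to the right of `t`,
and these give the left and the right subtree. If there is none, the tree
is a single leaf, placed at the only local maximum (boundary maxima count). -/
noncomputable def levelTree (x : ℕ → ℝ) (a b : ℕ) : MarkedTree :=
  match h : ((List.range (b + 1)).filter
      (fun t => decide (t ∈ localMinima x (Set.Icc a b)))).argmin x with
  | none => .leaf (((List.range' a (b + 1 - a)).argmax x).getD a)
  | some t => .node t (levelTree x a t) (levelTree x t b)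
termination_by b - a
decreasing_by
  all_goals
    have hm := List.argmin_mem h
    simp only [List.mem_filter, decide_eq_true_eq] at hm
    obtain ⟨-, -, p, hp, q, hq, hpt, htq, -⟩ := hm
    have h1 := hp.1
    have h2 := hq.2
    omega

/-- The level-set tree of the first `N` values `x 0, …, x (N - 1)`. -/
noncomputable def seriesTree (x : ℕ → ℝ) (N : ℕ) : MarkedTree := levelTree x 0 (N - 1)

/-- The times of the local minima of order `r` of `x 0, …, x (N - 1)`: order `1` are the internal
local minima, and order `r + 1` the internal local minima of the series of those of order `r`. -/
def minimaOfOrder (x : ℕ → ℝ) (N : ℕ) : ℕ → Set ℕ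
  | 0 => {k | k < N}
  | r + 1 => localMinima x (minimaOfOrder x N r)

/-- `L` and `R` bound a complete basin of order `r` of `x 0, …, x (N - 1)`: they are consecutive
local minima of order `r`. -/
def IsCompleteBasin (x : ℕ → ℝ) (N r L R : ℕ) : Prop :=
  L ∈ minimaOfOrder x N r ∧ R ∈ minimaOfOrder x N r ∧ L < R ∧
    ∀ s ∈ minimaOfOrder x N r, ¬ (L < s ∧ s < R)

open Classical in
/-- The complete branches of order `r` of the level-set tree of `x 0, …, x (N - 1)`, from left to
right: those whose terminal vertex lies in a complete basin of order `r`. -/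
noncomputable def completeBranches (x : ℕ → ℝ) (N r : ℕ) : List MarkedTree :=
  ((seriesTree x N).branches r).filter
    (fun s => decide (∃ L R, IsCompleteBasin x N r L R ∧ L < s.terminal ∧ s.terminal < R))

/-!
Tree quantities are read off from the series. That the left child of a vertex has order at least `r`
(`LO`), or the right one (`RO`), is a condition on the series which makes sense at every point;
these orders are called the child orders of the point. A point is a local minimum of order `r` if
and only if both child orders are at least `r` (`mem_iterMin_iff`), and the right child order
depends only on the part of the series that follows the point (`RO_congr_Ioi`). The branches of
order `j` correspond to the intervals into which the local minima of order `j` cut the series, and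
the side branches of order `i` correspond to the points with child orders `i` and `j` in the
interval of the branch (`branches_levelTree`). For a complete branch these are determined by the
series between two consecutive local minima of order `j` (`isSide_iff_Ioo`). So the theorem is about
the local minima of order `r` of the infinite series, enumerated as `minTime x r b`, and about
functionals of the pieces of the series between consecutive ones.

Two probabilistic facts drive the proof. First, the event that `n` is a local minimum of order `k`
is the intersection of an event about the past and one about the future of `n`; as the future is
independent of the past and has the same law at all times, the pieces between consecutive local
minima of order `k` are independent and identically distributed, as far as functionals of the order
of the values and of time differences are concerned (`IsSymmWalk.iIndepFun_block`,
`IsSymmWalk.identDistrib_block`). Second, for the same reason and by reversal of time, the expected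
proportion of the points with child orders `≥ r` and `≥ s` converges to a product `ρ r * ρ s`
(`IsSymmWalk.exists_tendsto_integral_pairSet`).

The strong Horton law follows by induction on the order. If there are asymptotically `4 ^ (-r) * N`
local minima of order `r`, the signs of the increments of their series are independent and
identically distributed. The increments up and down are counted by the points with child orders `≥
(r, r + 1)` and `≥ (r + 1, r)`, whose proportions have the same limit `ρ r * ρ (r + 1)`; so the
signs are symmetric (`IsSymmWalk.integral_isUp`), and a fraction `1 / 4` of the positions are
changes from down to up, which are the local minima of order `r + 1` (`IsSymmWalk.hortonLaw_succ`).
Comparing with the points with child orders `≥ (r, r)` gives `ρ r ^ 2 = 4 ^ (-r)`.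

The numbers of side branches of the complete branches are independent and identically distributed by
the first fact, and integrable since the first `n` of them sum up to at most the time `minTime x j
n`, which is asymptotically `4 ^ j * n`. By the law of large numbers the number of side branches in
the series of length `N` is asymptotically `4 ^ (-j) * N` times their mean, since the pieces before
the first and after the last local minimum of order `j` are negligible (`tendsto_ncard_isSide`). By
inclusion and exclusion the expected proportion of the points with child orders exactly `i` and `j`
converges to `2 * (ρ i - ρ (i + 1)) * (ρ j - ρ (j + 1)) = 2 ^ (-i - j - 1)`. So the mean is `2 ^ (j
- i - 1)` (`IsSymmWalk.integral_basinSide`).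
-/

/-! ### Local minima of higher order -/

section Minima

variable {α β : Type*} [LinearOrder α] [LinearOrder β]

/-- `p < q` are consecutive elements of `S`. -/
def Consec (S : Set α) (p q : α) : Prop := p ∈ S ∧ q ∈ S ∧ p < q ∧ ∀ s ∈ S, ¬ (p < s ∧ s < q)

/-- The internal local minima of `x` along `S`, for an arbitrary linear order of times. The
generality makes it possible to reverse time by passing to the order dual. -/
def locMin (x : α → ℝ) (S : Set α) : Set α :=
  {t | ∃ p q, Consec S p t ∧ Consec S t q ∧ x t < x p ∧ x t < x q}

/-- The local minima of order `k` of `x` along `S`. -/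
def iterMin (x : α → ℝ) : ℕ → Set α → Set α
  | 0, S => S
  | k + 1, S => locMin x (iterMin x k S)

theorem localMinima_eq_locMin (x : ℕ → ℝ) (S : Set ℕ) : localMinima x S = locMin x S := by
  ext t
  constructor
  · rintro ⟨ht, p, hp, q, hq, hpt, htq, h1, h2, h3, h4⟩
    exact ⟨p, q, ⟨hp, ht, hpt, h1⟩, ⟨ht, hq, htq, h2⟩, h3, h4⟩
  · rintro ⟨p, q, ⟨hp, ht, hpt, h1⟩, ⟨-, hq, htq, h2⟩, h3, h4⟩
    exact ⟨ht, p, hp, q, hq, hpt, htq, h1, h2, h3, h4⟩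

theorem minimaOfOrder_eq_iterMin (x : ℕ → ℝ) (N k : ℕ) :
    minimaOfOrder x N k = iterMin x k (Set.Iio N) := by
  induction k with
  | zero => rfl
  | succ k ih => rw [minimaOfOrder, ih, localMinima_eq_locMin, iterMin]

theorem locMin_subset (x : α → ℝ) (S : Set α) : locMin x S ⊆ S :=
  fun _ ⟨_, _, h, _⟩ => h.2.1

theorem iterMin_subset (x : α → ℝ) (k : ℕ) (S : Set α) : iterMin x k S ⊆ S := by
  induction k with
  | zero => exact subset_rfl
  | succ k ih => exact (locMin_subset x _).trans ih

theorem iterMin_succ_subset (x : α → ℝ) (k : ℕ) (S : Set α) :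
    iterMin x (k + 1) S ⊆ iterMin x k S := locMin_subset x _

theorem iterMin_anti (x : α → ℝ) (S : Set α) : Antitone (fun k => iterMin x k S) :=
  antitone_nat_of_succ_le fun k => iterMin_succ_subset x k S

theorem iterMin_add (x : α → ℝ) (k l : ℕ) (S : Set α) :
    iterMin x (k + l) S = iterMin x k (iterMin x l S) := by
  induction k with
  | zero => rw [zero_add]; rfl
  | succ k ih => rw [Nat.add_right_comm, iterMin, ih, iterMin]

/-! ### Time reversal and changes of time -/

theorem consec_dual {S : Set α} {p q : α} : Consec (α := αᵒᵈ) S q p ↔ Consec S p q := by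
  constructor
  · rintro ⟨h1, h2, h3, h4⟩
    exact ⟨h2, h1, h3, fun s hs h => h4 s hs ⟨h.2, h.1⟩⟩
  · rintro ⟨h1, h2, h3, h4⟩
    exact ⟨h2, h1, h3, fun s hs h => h4 s hs ⟨h.2, h.1⟩⟩

theorem locMin_dual (x : α → ℝ) (S : Set α) : locMin (α := αᵒᵈ) x S = locMin x S := by
  ext t
  constructor
  · rintro ⟨p, q, h1, h2, h3, h4⟩
    exact ⟨q, p, consec_dual.1 h2, consec_dual.1 h1, h4, h3⟩
  · rintro ⟨p, q, h1, h2, h3, h4⟩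
    exact ⟨q, p, consec_dual.2 h2, consec_dual.2 h1, h4, h3⟩

theorem iterMin_dual (x : α → ℝ) (k : ℕ) (S : Set α) :
    iterMin (α := αᵒᵈ) x k S = iterMin x k S := by
  induction k with
  | zero => rfl
  | succ k ih =>
    change locMin (α := αᵒᵈ) x (iterMin (α := αᵒᵈ) x k S) = locMin x (iterMin x k S)
    rw [ih]; exact locMin_dual x _

theorem consec_image {φ : α → β} {S T : Set α} (hφ : StrictMonoOn φ S) (hT : T ⊆ S) {p q : α}
    (hp : p ∈ S) (hq : q ∈ S) : Consec (φ '' T) (φ p) (φ q) ↔ Consec T p q := by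
  have hm : ∀ p ∈ S, φ p ∈ φ '' T ↔ p ∈ T := fun p hp =>
    ⟨fun ⟨y, hy, e⟩ => hφ.injOn (hT hy) hp e ▸ hy, fun h => ⟨p, h, rfl⟩⟩
  unfold Consec
  rw [hm p hp, hm q hq, hφ.lt_iff_lt hp hq]
  refine and_congr_right fun h1 => and_congr_right fun h2 => and_congr_right fun h3 => ?_
  constructor
  · intro h s hs hh
    exact h (φ s) ⟨s, hs, rfl⟩
      ⟨(hφ.lt_iff_lt hp (hT hs)).2 hh.1, (hφ.lt_iff_lt (hT hs) hq).2 hh.2⟩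
  · rintro h _ ⟨s, hs, rfl⟩ hh
    exact h s hs ⟨(hφ.lt_iff_lt hp (hT hs)).1 hh.1, (hφ.lt_iff_lt (hT hs) hq).1 hh.2⟩

/-- Local minima only depend on the order of the times and on the order of the values. -/
theorem iterMin_image {φ : α → β} {S : Set α} (hφ : StrictMonoOn φ S) {x : β → ℝ} {y : α → ℝ}
    (hxy : ∀ a ∈ S, ∀ b ∈ S, (x (φ a) < x (φ b) ↔ y a < y b)) (k : ℕ) :
    iterMin x k (φ '' S) = φ '' iterMin y k S := by
  induction k with
  | zero => rfl
  | succ k ih =>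
    have hT := iterMin_subset y k S
    rw [iterMin, ih, iterMin]
    ext t
    constructor
    · rintro ⟨_, _, h1, h2, h3, h4⟩
      obtain ⟨p, hp, rfl⟩ := h1.1
      obtain ⟨t, ht, rfl⟩ := h1.2.1
      obtain ⟨q, hq, rfl⟩ := h2.2.1
      exact ⟨t, ⟨p, q, (consec_image hφ hT (hT hp) (hT ht)).1 h1,
        (consec_image hφ hT (hT ht) (hT hq)).1 h2, (hxy _ (hT ht) _ (hT hp)).1 h3,
        (hxy _ (hT ht) _ (hT hq)).1 h4⟩, rfl⟩
    · rintro ⟨t, ⟨p, q, h1, h2, h3, h4⟩, rfl⟩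
      have hp := hT h1.1
      have ht := hT h1.2.1
      have hq := hT h2.2.1
      exact ⟨φ p, φ q, (consec_image hφ hT hp ht).2 h1, (consec_image hφ hT ht hq).2 h2,
        (hxy _ ht _ hp).2 h3, (hxy _ ht _ hq).2 h4⟩

theorem iterMin_congr {S : Set α} {x y : α → ℝ}
    (hxy : ∀ a ∈ S, ∀ b ∈ S, (x a < x b ↔ y a < y b)) (k : ℕ) :
    iterMin x k S = iterMin y k S := by
  simpa using iterMin_image (φ := id) (S := S) strictMonoOn_id hxy k

/-! ### Restriction to intervals of times -/

/-- Restriction to an interval does not change the local minima if the interval is bordered by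
lower values. -/
theorem locMin_inter {x : α → ℝ} {S I : Set α} (hI : I.OrdConnected)
    (hl : ∀ p q, Consec S p q → p ∉ I → q ∈ I → x p ≤ x q)
    (hr : ∀ p q, Consec S p q → p ∈ I → q ∉ I → x q ≤ x p) :
    locMin x S ∩ I = locMin x (S ∩ I) := by
  ext t
  constructor
  · rintro ⟨⟨p, q, h1, h2, h3, h4⟩, ht⟩
    have hp : p ∈ I := by
      by_contra hp
      exact absurd (hl p t h1 hp ht) (not_le.2 h3)
    have hq : q ∈ I := by
      by_contra hq
      exact absurd (hr t q h2 ht hq) (not_le.2 h4)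
    exact ⟨p, q, ⟨⟨h1.1, hp⟩, ⟨h1.2.1, ht⟩, h1.2.2.1, fun s hs => h1.2.2.2 s hs.1⟩,
      ⟨⟨h2.1, ht⟩, ⟨h2.2.1, hq⟩, h2.2.2.1, fun s hs => h2.2.2.2 s hs.1⟩, h3, h4⟩
  · rintro ⟨p, q, h1, h2, h3, h4⟩
    have hp := h1.1.2
    have ht := h1.2.1.2
    have hq := h2.2.1.2
    exact ⟨⟨p, q, ⟨h1.1.1, h1.2.1.1, h1.2.2.1, fun s hs h => h1.2.2.2 s
        ⟨hs, hI.out hp ht ⟨h.1.le, h.2.le⟩⟩ h⟩,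
      ⟨h2.1.1, h2.2.1.1, h2.2.2.1, fun s hs h => h2.2.2.2 s
        ⟨hs, hI.out ht hq ⟨h.1.le, h.2.le⟩⟩ h⟩, h3, h4⟩, ht⟩

/-- `I` is an interval of times in which `x` exceeds the level `c` along `S`, and which is
bordered by values that do not exceed `c`. -/
structure IsIsland (x : α → ℝ) (S I : Set α) (c : ℝ) : Prop where
  ordConnected : I.OrdConnected
  lt : ∀ q ∈ S, q ∈ I → c < x q
  left_le : ∀ p q, Consec S p q → p ∉ I → q ∈ I → x p ≤ c
  right_le : ∀ p q, Consec S p q → p ∈ I → q ∉ I → x q ≤ c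

theorem IsIsland.dual {x : α → ℝ} {S I : Set α} {c : ℝ} (h : IsIsland x S I c) :
    IsIsland (α := αᵒᵈ) x S I c where
  ordConnected := h.ordConnected.dual
  lt := h.lt
  left_le p q hpq hp hq := h.right_le q p (consec_dual.1 hpq) hq hp
  right_le p q hpq hp hq := h.left_le q p (consec_dual.1 hpq) hq hp

/-- Cutting the series at a local minimum of order `k` does not change the local minima of order
`k` on its right. -/
theorem iterMin_inter_Ioi {x : α → ℝ} {S : Set α} {n : α} {k : ℕ} (hn : n ∈ iterMin x k S) :
    iterMin x k S ∩ Set.Ioi n = iterMin x k (S ∩ Set.Ioi n) := by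
  induction k with
  | zero => rfl
  | succ k ih =>
    have hn' := iterMin_succ_subset x k S hn
    rw [iterMin, iterMin, ← ih hn']
    obtain ⟨p0, q0, h1, h2, h3, h4⟩ := hn
    refine locMin_inter Set.ordConnected_Ioi (fun p q hpq hp hq => ?_) fun p q hpq hp hq => ?_
    · have hpn : p ≤ n := not_lt.1 hp
      have hpn' : p = n := by
        by_contra hne
        exact hpq.2.2.2 n hn' ⟨lt_of_le_of_ne hpn hne, hq⟩
      subst hpn'
      have : q = q0 := by
        rcases lt_trichotomy q q0 with hlt | heq | hlt
        · exact absurd ⟨hpq.2.2.1, hlt⟩ (h2.2.2.2 q hpq.2.1)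
        · exact heq
        · exact absurd ⟨h2.2.2.1, hlt⟩ (hpq.2.2.2 q0 h2.2.1)
      rw [this]
      exact h4.le
    · exact absurd (lt_trans hp hpq.2.2.1) hq

theorem iterMin_inter_Iio {x : α → ℝ} {S : Set α} {n : α} {k : ℕ} (hn : n ∈ iterMin x k S) :
    iterMin x k S ∩ Set.Iio n = iterMin x k (S ∩ Set.Iio n) := by
  have h := iterMin_inter_Ioi (α := αᵒᵈ) (x := x) (S := S) (n := n) (k := k)
    (by rw [iterMin_dual]; exact hn)
  have h1 := iterMin_dual x k S
  have h2 := iterMin_dual x k (S ∩ Set.Iio n)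
  rw [h1] at h
  exact h.trans h2

/-! ### The orders of the two children of a vertex -/

/-- `RO x S r v`: in the level-set tree of `x` along `S`, the right child of `v` has order at
least `r`. The right subtree is that of the points that follow `v` until `x` falls below `x v`,
and its order is at least `k + 1` if it contains a local minimum of order `k`. -/
def RO (x : α → ℝ) (S : Set α) : ℕ → α → Prop
  | 0, _ => True
  | k + 1, v => ∃ m ∈ iterMin x k S, v < m ∧ ∀ w ∈ S, v < w → w ≤ m → x v < x w

/-- `LO x S r v`: in the level-set tree of `x` along `S`, the left child of `v` has order at
least `r`. -/
def LO (x : α → ℝ) (S : Set α) : ℕ → α → Prop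
  | 0, _ => True
  | k + 1, v => ∃ m ∈ iterMin x k S, m < v ∧ ∀ w ∈ S, w < v → m ≤ w → x v < x w

theorem RO_dual {x : α → ℝ} {S : Set α} {r : ℕ} {v : α} :
    RO (α := αᵒᵈ) x S r v ↔ LO x S r v := by
  cases r with
  | zero => exact Iff.rfl
  | succ k =>
    exact exists_congr fun m => and_congr_left fun _ =>
      iff_of_eq (congrArg (fun T : Set α => m ∈ T) (iterMin_dual x k S))

theorem RO_succ_iff {x : α → ℝ} {S : Set α} {k : ℕ} {v : α} : RO x S (k + 1) v ↔
    ∃ m ∈ iterMin x k S, v < m ∧ ∀ w ∈ S, v < w → w ≤ m → x v < x w := Iff.rfl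

variable {x : α → ℝ} {S : Set α} {v : α}

theorem RO_of_succ {r : ℕ} (h : RO x S (r + 1) v) : RO x S r v := by
  cases r with
  | zero => trivial
  | succ k =>
    obtain ⟨m, hm, h⟩ := h
    exact ⟨m, iterMin_succ_subset x k S hm, h⟩

theorem RO_mono {r s : ℕ} (hrs : r ≤ s) (h : RO x S s v) : RO x S r v := by
  induction hrs with
  | refl => exact h
  | step _ ih => exact ih (RO_of_succ h)

theorem LO_mono {r s : ℕ} (hrs : r ≤ s) (h : LO x S s v) : LO x S r v :=
  RO_dual.1 (RO_mono hrs (RO_dual.2 h))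

/-- The times after `v` until `x` falls below `x v` along `S`. -/
def rightOf (x : α → ℝ) (S : Set α) (v : α) : Set α :=
  {m | v < m ∧ ∀ w ∈ S, v < w → w ≤ m → x v < x w}

theorem isIsland_rightOf (hv : v ∈ S) : IsIsland x S (rightOf x S v) (x v) where
  ordConnected := ⟨fun _ ha _ hb _ hc =>
    ⟨ha.1.trans_le hc.1, fun w hw h1 h2 => hb.2 w hw h1 (h2.trans hc.2)⟩⟩
  lt q hq hqI := hqI.2 q hq hqI.1 le_rfl
  left_le p q hpq hp hq := by
    rcases lt_trichotomy p v with h | h | h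
    · exact absurd ⟨h, hq.1⟩ (hpq.2.2.2 v hv)
    · rw [h]
    · exact absurd ⟨h, fun w hw h1 h2 => hq.2 w hw h1 (h2.trans hpq.2.2.1.le)⟩ hp
  right_le p q hpq hp hq := by
    by_contra hlt
    refine hq ⟨hp.1.trans hpq.2.2.1, fun w hw h1 h2 => ?_⟩
    rcases le_or_gt w p with h | h
    · exact hp.2 w hw h1 h
    · rcases h2.eq_or_lt with rfl | h'
      · exact not_le.1 hlt
      · exact absurd ⟨h, h'⟩ (hpq.2.2.2 w hw)

/-- `v` has a child of order `i` and a child of order `j`: for `i < j` it is a non-terminal vertex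
of a branch of order `j`, joined by a branch of order `i`. -/
def IsSide (x : α → ℝ) (S : Set α) (i j : ℕ) (v : α) : Prop :=
  (LO x S i v ∧ ¬ LO x S (i + 1) v ∧ RO x S j v ∧ ¬ RO x S (j + 1) v) ∨
    (LO x S j v ∧ ¬ LO x S (j + 1) v ∧ RO x S i v ∧ ¬ RO x S (i + 1) v)

theorem isSide_dual {i j : ℕ} : IsSide (α := αᵒᵈ) x S i j v ↔ IsSide x S i j v := by
  have h1 : ∀ r, RO (α := αᵒᵈ) x S r v ↔ LO x S r v := fun r => RO_dual
  have h2 : ∀ r, LO (α := αᵒᵈ) x S r v ↔ RO x S r v := fun r =>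
    (RO_dual (α := αᵒᵈ) (x := x) (S := S) (v := v)).symm
  unfold IsSide
  simp only [h1, h2]
  tauto

theorem IsSide.iterMin_nonempty {i j : ℕ} (h : IsSide x S i (j + 1) v) :
    (iterMin x j S).Nonempty := by
  rcases h with ⟨-, -, ⟨m, hm, -⟩, -⟩ | ⟨⟨m, hm, -⟩, -⟩
  · exact ⟨m, hm⟩
  · exact ⟨m, hm⟩

/-! ### Local minima on islands -/

variable [LocallyFiniteOrder α]

theorem exists_next {S : Set α} {v m : α} (hm : m ∈ S) (hvm : v < m) :
    ∃ q ∈ S, v < q ∧ q ≤ m ∧ ∀ s ∈ S, ¬ (v < s ∧ s < q) := by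
  obtain ⟨q, ⟨hq, hq'⟩, hmin⟩ := Set.exists_min_image (S ∩ Set.Ioc v m) id
    ((Set.finite_Ioc v m).subset Set.inter_subset_right) ⟨m, hm, hvm, le_rfl⟩
  exact ⟨q, hq, hq'.1, hq'.2, fun s hs h =>
    absurd (hmin s ⟨hs, h.1, h.2.le.trans hq'.2⟩) (not_le.2 h.2)⟩

theorem exists_prev {S : Set α} {v m : α} (hm : m ∈ S) (hvm : m < v) :
    ∃ q ∈ S, q < v ∧ m ≤ q ∧ ∀ s ∈ S, ¬ (q < s ∧ s < v) := by
  obtain ⟨q, h1, h2, h3, h4⟩ := exists_next (α := αᵒᵈ) (S := S) hm hvm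
  exact ⟨q, h1, h2, h3, fun s hs h => h4 s hs ⟨h.2, h.1⟩⟩

theorem exists_argmin (x : α → ℝ) {S : Set α} {a b c : α} (hc : c ∈ S) (hac : a ≤ c)
    (hcb : c ≤ b) : ∃ w ∈ S, a ≤ w ∧ w ≤ b ∧ ∀ s ∈ S, a ≤ s → s ≤ b → x w ≤ x s := by
  obtain ⟨w, ⟨hw, hw'⟩, hmin⟩ := Set.exists_min_image (S ∩ Set.Icc a b) x
    ((Set.finite_Icc a b).subset Set.inter_subset_right) ⟨c, hc, hac, hcb⟩
  exact ⟨w, hw, hw'.1, hw'.2, fun s hs h1 h2 => hmin s ⟨hs, h1, h2⟩⟩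

/-- A point of `S` that is lower than the points of `S` around it, up to a point on either side,
is an internal local minimum. -/
theorem mem_locMin_of_lt {x : α → ℝ} {S : Set α} {w a b : α} (hw : w ∈ S) (ha : a ∈ S)
    (hb : b ∈ S) (haw : a < w) (hwb : w < b)
    (h : ∀ s ∈ S, a ≤ s → s ≤ b → s ≠ w → x w < x s) : w ∈ locMin x S := by
  obtain ⟨p, hp, h1, h2, h3⟩ := exists_prev ha haw
  obtain ⟨q, hq, h4, h5, h6⟩ := exists_next hb hwb
  exact ⟨p, q, ⟨hp, hw, h1, h3⟩, ⟨hw, hq, h4, h6⟩, h p hp h2 (h1.le.trans hwb.le) h1.ne,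
    h q hq (haw.le.trans h4.le) h5 h4.ne'⟩

theorem mem_iterMin_of_lt {x : α → ℝ} {S : Set α} {w a b : α} {k : ℕ} (hw : w ∈ S)
    (ha : a ∈ iterMin x k S) (hb : b ∈ iterMin x k S) (haw : a < w) (hwb : w < b)
    (h : ∀ s ∈ S, a ≤ s → s ≤ b → s ≠ w → x w < x s) : w ∈ iterMin x k S := by
  induction k with
  | zero => exact hw
  | succ k ih =>
    have ha' := iterMin_succ_subset x k S ha
    have hb' := iterMin_succ_subset x k S hb
    exact mem_locMin_of_lt (ih ha' hb') ha' hb' haw hwb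
      fun s hs => h s (iterMin_subset x k S hs)

/-- An island remains an island when the series is replaced by the series of its local minima: if
the next local minimum to the right of the island were above `c`, then the lowest point before it
outside the island would be another local minimum. -/
theorem IsIsland.right_le_locMin {x : α → ℝ} {S I : Set α} {c : ℝ} (h : IsIsland x S I c)
    (hx : Set.InjOn x S) {p q : α} (hpq : Consec (locMin x S) p q) (hp : p ∈ I) (hq : q ∉ I) :
    x q ≤ c := by
  obtain ⟨hpS, hqS, hlt, hno⟩ := hpq
  have hpS' := locMin_subset x S hpS
  have hqS' := locMin_subset x S hqS
  -- `u` is the first point of `S` to the right of `I`, and `w` the lowest one from `u` to `q`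
  obtain ⟨u, ⟨hu, huI⟩, hpu, huq, hu'⟩ := exists_next (S := S ∩ Iᶜ) ⟨hqS', hq⟩ hlt
  obtain ⟨p', hp', hp'u, hpp', hp'no⟩ := exists_prev hpS' hpu
  have hp'I : p' ∈ I := by
    rcases hpp'.eq_or_lt with rfl | hlt'
    · exact hp
    · by_contra hI
      exact hu' p' ⟨hp', hI⟩ ⟨hlt', hp'u⟩
  have hxu : x u ≤ c := h.right_le p' u ⟨hp', hu, hp'u, hp'no⟩ hp'I huI
  obtain ⟨w, hw, huw, hwq, hmin⟩ := exists_argmin x hu le_rfl huq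
  rcases hwq.eq_or_lt with rfl | hwq'
  · exact (hmin u hu le_rfl huq).trans hxu
  · exfalso
    refine hno w (mem_locMin_of_lt hw hp' hqS' (hp'u.trans_le huw) hwq' ?_)
      ⟨hpu.trans_le huw, hwq'⟩
    intro s hs h1 h2 hne
    rcases lt_or_ge s u with hsu | hsu
    · have : s = p' := by
        by_contra hne'
        exact hp'no s hs ⟨lt_of_le_of_ne h1 (Ne.symm hne'), hsu⟩
      subst this
      exact ((hmin u hu le_rfl huq).trans hxu).trans_lt (h.lt s hs hp'I)
    · exact lt_of_le_of_ne (hmin s hs hsu h2) fun e => hne (hx hs hw e.symm)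

theorem IsIsland.locMin {x : α → ℝ} {S I : Set α} {c : ℝ} (h : IsIsland x S I c)
    (hx : Set.InjOn x S) : IsIsland x (locMin x S) I c where
  ordConnected := h.ordConnected
  lt q hq := h.lt q (locMin_subset x S hq)
  right_le _ _ hpq hp hq := h.right_le_locMin hx hpq hp hq
  left_le p q hpq hp hq := by
    refine h.dual.right_le_locMin (p := q) (q := p) hx ?_ hq hp
    have := locMin_dual x S
    rw [this]
    exact consec_dual.2 hpq

/-- On an island, the local minima of every order are those of the restricted series. -/
theorem IsIsland.iterMin_inter {x : α → ℝ} {S I : Set α} {c : ℝ} (h : IsIsland x S I c)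
    (hx : Set.InjOn x S) (k : ℕ) :
    IsIsland x (iterMin x k S) I c ∧ iterMin x k S ∩ I = iterMin x k (S ∩ I) := by
  induction k with
  | zero => exact ⟨h, rfl⟩
  | succ k ih =>
    obtain ⟨h1, h2⟩ := ih
    refine ⟨h1.locMin (hx.mono (iterMin_subset x k S)), ?_⟩
    rw [iterMin, iterMin, ← h2]
    refine locMin_inter h1.ordConnected (fun p q hpq hp hq => ?_) fun p q hpq hp hq => ?_
    · exact (h1.left_le p q hpq hp hq).trans (h1.lt q hpq.2.1 hq).le
    · exact (h1.right_le p q hpq hp hq).trans (h1.lt p hpq.1 hp).le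

/-! ### Orders of the children and local minima -/

/-- For a local minimum of order `k`, the right child has order greater than `k` if and only if the
next local minimum of order `k` is higher. -/
theorem RO_succ_iff_next (hx : Set.InjOn x S) {k : ℕ} (hv : v ∈ iterMin x k S) :
    RO x S (k + 1) v ↔ ∃ q, Consec (iterMin x k S) v q ∧ x v < x q := by
  have hvS := iterMin_subset x k S hv
  constructor
  · rintro ⟨m, hm, hvm, h⟩
    obtain ⟨q, hq, h1, h2, h3⟩ := exists_next hm hvm
    exact ⟨q, ⟨hv, hq, h1, h3⟩, h q (iterMin_subset x k S hq) h1 h2⟩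
  · rintro ⟨q, ⟨-, hq, h1, h3⟩, h4⟩
    have hqS := iterMin_subset x k S hq
    refine ⟨q, hq, h1, fun w hw h5 h6 => ?_⟩
    -- otherwise the lowest point between `v` and `q` would be a local minimum of order `k`
    by_contra hlt
    obtain ⟨u, hu, hu1, hu2, hmin⟩ := exists_argmin x hw h5.le h6
    have huv : u ≠ v := by
      rintro rfl
      exact h5.ne (hx hvS hw (le_antisymm (hmin w hw h5.le h6) (not_lt.1 hlt)))
    have huq : u ≠ q := by
      rintro rfl
      exact absurd (h4.trans_le (hmin v hvS le_rfl h1.le)) (lt_irrefl _)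
    have hu1' := lt_of_le_of_ne hu1 huv.symm
    have hu2' := lt_of_le_of_ne hu2 huq
    refine h3 u (mem_iterMin_of_lt hu hv hq hu1' hu2' fun s hs h7 h8 h9 => ?_) ⟨hu1', hu2'⟩
    exact lt_of_le_of_ne (hmin s hs h7 h8) fun e => h9 (hx hs hu e.symm)

theorem LO_succ_iff_prev (hx : Set.InjOn x S) {k : ℕ} (hv : v ∈ iterMin x k S) :
    LO x S (k + 1) v ↔ ∃ p, Consec (iterMin x k S) p v ∧ x v < x p := by
  have hT := iterMin_dual x k S
  refine RO_dual.symm.trans ((RO_succ_iff_next (α := αᵒᵈ) hx (hT ▸ hv)).trans ?_)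
  refine exists_congr fun p => and_congr_left fun _ => ?_
  exact (iff_of_eq (congrArg (fun T : Set α => Consec (α := αᵒᵈ) T v p) hT)).trans consec_dual

/-- A point is a local minimum of order `r` if and only if both subtrees that hang from it have
order at least `r`. -/
theorem mem_iterMin_iff (hx : Set.InjOn x S) (hv : v ∈ S) {r : ℕ} :
    v ∈ iterMin x r S ↔ LO x S r v ∧ RO x S r v := by
  induction r with
  | zero => exact iff_of_true hv ⟨trivial, trivial⟩
  | succ k ih =>
    constructor
    · intro h
      have hk := iterMin_succ_subset x k S h
      obtain ⟨p, q, h1, h2, h3, h4⟩ := h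
      exact ⟨(LO_succ_iff_prev hx hk).2 ⟨p, h1, h3⟩, (RO_succ_iff_next hx hk).2 ⟨q, h2, h4⟩⟩
    · rintro ⟨h1, h2⟩
      have hk := ih.2 ⟨LO_mono k.le_succ h1, RO_of_succ h2⟩
      obtain ⟨p, hp, hp'⟩ := (LO_succ_iff_prev hx hk).1 h1
      obtain ⟨q, hq, hq'⟩ := (RO_succ_iff_next hx hk).1 h2
      exact ⟨p, q, hp, hq, hp', hq'⟩

theorem RO_succ_iff_nonempty (hx : Set.InjOn x S) (hv : v ∈ S) {k : ℕ} :
    RO x S (k + 1) v ↔ (iterMin x k (S ∩ rightOf x S v)).Nonempty := by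
  rw [← ((isIsland_rightOf hv).iterMin_inter hx k).2]
  exact Iff.rfl

/-- The order of the right child of `v` depends only on the part of the series that follows `v`
up to the time when the series falls below `x v`. -/
theorem RO_congr_set {S' : Set α} (hx : Set.InjOn x S) (hx' : Set.InjOn x S') (hv : v ∈ S)
    (hv' : v ∈ S') (h : S ∩ rightOf x S v = S' ∩ rightOf x S' v) {r : ℕ} :
    RO x S r v ↔ RO x S' r v := by
  cases r with
  | zero => exact Iff.rfl
  | succ k => rw [RO_succ_iff_nonempty hx hv, RO_succ_iff_nonempty hx' hv', h]

theorem RO_congr_Ioi {S' : Set α} (hx : Set.InjOn x S) (hx' : Set.InjOn x S') (hv : v ∈ S)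
    (hv' : v ∈ S') (h : ∀ w, v < w → (w ∈ S ↔ w ∈ S')) {r : ℕ} :
    RO x S r v ↔ RO x S' r v := by
  refine RO_congr_set hx hx' hv hv' ?_
  ext m
  constructor
  · rintro ⟨hm, h1, h2⟩
    exact ⟨(h m h1).1 hm, h1, fun w hw h3 => h2 w ((h w h3).2 hw) h3⟩
  · rintro ⟨hm, h1, h2⟩
    exact ⟨(h m h1).2 hm, h1, fun w hw h3 => h2 w ((h w h3).1 hw) h3⟩

theorem LO_congr_Iio {S' : Set α} (hx : Set.InjOn x S) (hx' : Set.InjOn x S') (hv : v ∈ S)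
    (hv' : v ∈ S') (h : ∀ w, w < v → (w ∈ S ↔ w ∈ S')) {r : ℕ} :
    LO x S r v ↔ LO x S' r v := by
  rw [← RO_dual, ← RO_dual]
  exact RO_congr_Ioi (α := αᵒᵈ) hx hx' hv hv' h

/-- Points beyond a lower point `R` do not influence the order of the right child of `v`. -/
theorem RO_congr_of_lt {S' : Set α} {R : α} (hx : Set.InjOn x S) (hv : v ∈ S) (hv' : v ∈ S')
    (hR : R ∈ S) (hvR : v < R) (hlt : x R < x v) (hS' : S' ⊆ S) (hle : ∀ w ∈ S', w ≤ R)
    (h : ∀ w ∈ S, v < w → w < R → w ∈ S') {r : ℕ} : RO x S r v ↔ RO x S' r v := by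
  refine RO_congr_set hx (hx.mono hS') hv hv' ?_
  ext m
  constructor
  · rintro ⟨hm, h1, h2⟩
    have hmR : m < R := by
      by_contra hmR
      exact absurd (h2 R hR hvR (not_lt.1 hmR)) (not_lt.2 hlt.le)
    exact ⟨h m hm h1 hmR, h1, fun w hw => h2 w (hS' hw)⟩
  · rintro ⟨hm, h1, h2⟩
    refine ⟨hS' hm, h1, fun w hw h3 h4 => ?_⟩
    rcases (h4.trans (hle m hm)).eq_or_lt with rfl | h5
    · exact h2 w (le_antisymm h4 (hle m hm) ▸ hm) h3 h4
    · exact h2 w (h w hw h3 h5) h3 h4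

theorem RO_inter_Ioo {L R : α} (hx : Set.InjOn x S) (hv : v ∈ S) (hL : L < v) (hR : R ∈ S)
    (hvR : v < R) (hlt : x R < x v) {r : ℕ} :
    RO x S r v ↔ RO x (S ∩ Set.Ioo L R) r v :=
  RO_congr_of_lt (S' := S ∩ Set.Ioo L R) hx hv (Set.mem_inter hv ⟨hL, hvR⟩) hR hvR hlt
    Set.inter_subset_left (fun _ hw => hw.2.2.le)
    fun _ hw h1 h2 => ⟨hw, hL.trans h1, h2⟩

theorem LO_inter_Ioo {L R : α} (hx : Set.InjOn x S) (hv : v ∈ S) (hL : L ∈ S) (hLv : L < v)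
    (hvR : v < R) (hlt : x L < x v) {r : ℕ} :
    LO x S r v ↔ LO x (S ∩ Set.Ioo L R) r v := by
  refine RO_dual.symm.trans ((RO_inter_Ioo (α := αᵒᵈ) (L := R) hx hv hvR hL hLv hlt).trans ?_)
  have h : Set.Ioo (α := αᵒᵈ) R L = Set.Ioo L R := Set.ext fun w => and_comm
  exact (iff_of_eq (congrArg (fun T : Set α => RO (α := αᵒᵈ) x (S ∩ T) r v) h)).trans RO_dual

/-! ### Side branches -/

/-- A vertex with child orders `i < j` between two consecutive local minima of order `j` lies above
the right one, and by symmetry above the left one. -/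
theorem IsSide.lt_of_lt_right {i j : ℕ} (hx : Set.InjOn x S) (hij : i < j) {L R : α}
    (hLR : Consec (iterMin x j S) L R) (hv : v ∈ S) (hL : L < v) (hR : v < R)
    (h : IsSide x S i j v) : x R < x v := by
  obtain ⟨hLm, hRm, -, hno⟩ := hLR
  have hRS := iterMin_subset x j S hRm
  have hRO : ¬ RO x S (j + 1) v := by
    rcases h with h | h
    · exact h.2.2.2
    · exact fun h' => h.2.2.2 (RO_mono (by omega) h')
  by_contra hlt
  have hvR : x v < x R := lt_of_le_of_ne (not_lt.1 hlt) fun e => hR.ne (hx hv hRS e)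
  -- the lowest point `w` from `v` to `R` has a right child of order greater than `j`; if it is
  -- not `v`, then `v` lies in its left subtree, and `w` is a local minimum of order `j`
  obtain ⟨w, hw, hvw, hwR, hmin⟩ := exists_argmin x hv le_rfl hR.le
  have hwR' : w < R := lt_of_le_of_ne hwR fun e =>
    absurd (hmin v hv le_rfl hR.le) (by rw [e]; exact not_le.2 hvR)
  have hmin' : ∀ s ∈ S, v ≤ s → s ≤ R → s ≠ w → x w < x s := fun s hs h1 h2 h3 =>
    lt_of_le_of_ne (hmin s hs h1 h2) fun e => h3 (hx hs hw e.symm)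
  have hROw : RO x S (j + 1) w :=
    ⟨R, hRm, hwR', fun s hs h1 h2 => hmin' s hs (hvw.trans h1.le) h2 h1.ne'⟩
  rcases hvw.eq_or_lt with rfl | hvw'
  · exact hRO hROw
  have hwv : x w < x v := hmin' v hv le_rfl hR.le hvw'.ne
  obtain ⟨k, rfl⟩ : ∃ k, j = k + 1 := ⟨j - 1, by omega⟩
  have hLOw : LO x S (k + 1) w := by
    have : RO x S (k + 1) v ∨ LO x S (k + 1) v := by
      rcases h with h | h
      · exact Or.inl h.2.2.1
      · exact Or.inr h.1
    rcases this with ⟨m, hm, h1, h2⟩ | ⟨m, hm, h1, h2⟩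
    · have hmw : m < w := by
        by_contra hmw
        exact absurd (h2 w hw hvw' (not_lt.1 hmw)) (not_lt.2 hwv.le)
      exact ⟨m, hm, hmw, fun s hs h3 h4 =>
        hmin' s hs (h1.le.trans h4) (h3.le.trans hwR) h3.ne⟩
    · refine ⟨m, hm, h1.trans hvw', fun s hs h3 h4 => ?_⟩
      rcases lt_or_ge s v with h5 | h5
      · exact hwv.trans (h2 s hs h5 h4)
      · exact hmin' s hs h5 (h3.le.trans hwR) h3.ne
  exact hno w ((mem_iterMin_iff hx hw).2 ⟨hLOw, RO_of_succ hROw⟩) ⟨hL.trans hvw', hwR'⟩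

/-- Between two consecutive local minima of order `j`, the vertices of the branch of order `j`
are recognized from the part of the series between these minima. -/
theorem isSide_iff_Ioo {i j : ℕ} (hx : Set.InjOn x S) (hij : i < j) {L R : α}
    (hLR : Consec (iterMin x j S) L R) (hv : v ∈ S) (hL : L < v) (hR : v < R) :
    IsSide x S i j v ↔ x L < x v ∧ x R < x v ∧ IsSide x (S ∩ Set.Ioo L R) i j v := by
  have hLS := iterMin_subset x j S hLR.1
  have hRS := iterMin_subset x j S hLR.2.1
  have key : x L < x v → x R < x v →
      (IsSide x S i j v ↔ IsSide x (S ∩ Set.Ioo L R) i j v) := fun h1 h2 => by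
    unfold IsSide
    simp only [← RO_inter_Ioo hx hv hL hRS hR h2, ← LO_inter_Ioo hx hv hLS hL hR h1]
  constructor
  · intro h
    have h2 := h.lt_of_lt_right hx hij hLR hv hL hR
    have h1 : x L < x v := by
      refine IsSide.lt_of_lt_right (α := αᵒᵈ) (S := S) hx hij (L := R) (R := L) ?_ hv hR hL
        (isSide_dual.2 h)
      rw [iterMin_dual]
      exact consec_dual.2 hLR
    exact ⟨h1, h2, (key h1 h2).1 h⟩
  · rintro ⟨h1, h2, h⟩
    exact (key h1 h2).2 h

/-! ### Splitting at the lowest local minimum -/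

/-- To the right of the root, the local minima are those of the part of the series that starts at
the root. For the order `0` the two sides differ by the root. -/
theorem iterMin_inter_Ioi_of_lowest {t : α} (hx : Set.InjOn x S) (ht : t ∈ locMin x S)
    (hmin : ∀ s ∈ locMin x S, x t ≤ x s) (m : ℕ) :
    iterMin x (m + 1) S ∩ Set.Ioi t = iterMin x (m + 1) (S ∩ Set.Ici t) := by
  have htS := locMin_subset x S ht
  have h1 : locMin x S ∩ Set.Ioi t = locMin x (S ∩ Set.Ioi t) :=
    iterMin_inter_Ioi (k := 1) ht
  have h2 : locMin x (S ∩ Set.Ici t) = locMin x (S ∩ Set.Ioi t) := by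
    have h3 : locMin x (S ∩ Set.Ici t) ∩ Set.Ioi t = locMin x (S ∩ Set.Ici t ∩ Set.Ioi t) := by
      refine locMin_inter Set.ordConnected_Ioi (fun p q hpq hp hq => ?_)
        fun p q hpq hp hq => absurd (lt_trans hp hpq.2.2.1) hq
      obtain ⟨-, q0, -, h2, -, h4⟩ := ht
      have hpt : p = t := le_antisymm (not_lt.1 hp) hpq.1.2
      subst hpt
      have hq0 : q0 = q := by
        rcases lt_trichotomy q q0 with h | h | h
        · exact absurd ⟨hpq.2.2.1, h⟩ (h2.2.2.2 q hpq.2.1.1)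
        · exact h.symm
        · exact absurd ⟨h2.2.2.1, h⟩ (hpq.2.2.2 q0 ⟨h2.2.1, h2.2.2.1.le⟩)
      exact hq0 ▸ h4.le
    have h4 : S ∩ Set.Ici t ∩ Set.Ioi t = S ∩ Set.Ioi t := by
      rw [Set.inter_assoc, Set.inter_eq_right.2 Set.Ioi_subset_Ici_self]
    rw [← h4, ← h3, eq_comm, Set.inter_eq_left]
    rintro v ⟨p, -, h5, -⟩
    exact lt_of_le_of_lt h5.1.2 h5.2.2.1
  have hisl : IsIsland x (locMin x S) (Set.Ioi t) (x t) :=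
    { ordConnected := Set.ordConnected_Ioi
      lt := fun q hq hqt => lt_of_le_of_ne (hmin q hq) fun e =>
        (ne_of_gt hqt) (hx htS (locMin_subset x S hq) e).symm
      left_le := fun p q hpq hp hq => by
        rcases (not_lt.1 hp).eq_or_lt with h | h
        · rw [h]
        · exact absurd ⟨h, hq⟩ (hpq.2.2.2 t ht)
      right_le := fun p q hpq hp hq => absurd (lt_trans hp hpq.2.2.1) hq }
  have h3 := (hisl.iterMin_inter (hx.mono (locMin_subset x S)) m).2
  rw [h1, ← h2] at h3
  rw [iterMin_add, iterMin_add]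
  exact h3

theorem iterMin_inter_Iio_of_lowest {t : α} (hx : Set.InjOn x S) (ht : t ∈ locMin x S)
    (hmin : ∀ s ∈ locMin x S, x t ≤ x s) (m : ℕ) :
    iterMin x (m + 1) S ∩ Set.Iio t = iterMin x (m + 1) (S ∩ Set.Iic t) := by
  have hT := locMin_dual x S
  have h := iterMin_inter_Ioi_of_lowest (α := αᵒᵈ) (x := x) (S := S) (t := t) hx (hT ▸ ht)
    (hT ▸ hmin) m
  have h1 := iterMin_dual x (m + 1) S
  have h2 := iterMin_dual x (m + 1) (S ∩ Set.Iic t)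
  rw [h1] at h
  exact h.trans h2

/-- The right subtree of the root of the tree is the tree of the series to the right of the
root. -/
theorem RO_succ_lowest {t : α} (hx : Set.InjOn x S) (ht : t ∈ locMin x S)
    (hmin : ∀ s ∈ locMin x S, x t ≤ x s) {k : ℕ} :
    RO x S (k + 1) t ↔ (iterMin x k (S ∩ Set.Ici t)).Nonempty := by
  have htS := locMin_subset x S ht
  cases k with
  | zero =>
    refine iff_of_true ?_ ⟨t, htS, le_rfl⟩
    obtain ⟨-, q, -, h2, -, h4⟩ := ht
    refine ⟨q, h2.2.1, h2.2.2.1, fun w hw h5 h6 => ?_⟩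
    rcases h6.eq_or_lt with rfl | h6
    · exact h4
    · exact absurd ⟨h5, h6⟩ (h2.2.2.2 w hw)
  | succ m =>
    rw [← iterMin_inter_Ioi_of_lowest hx ht hmin m]
    constructor
    · rintro ⟨q, hq, h1, -⟩
      exact ⟨q, hq, h1⟩
    · rintro ⟨q, hq, h1⟩
      refine ⟨q, hq, h1, fun w hw h2 h3 => ?_⟩
      by_contra hlt
      have hq1 : q ∈ locMin x S := iterMin_anti x S (Nat.le_add_left 1 m) hq
      have hqS := locMin_subset x S hq1
      obtain ⟨u, hu, hu1, hu2, hu3⟩ := exists_argmin x hw h2.le h3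
      have hut : x u ≤ x t := (hu3 w hw h2.le h3).trans (not_lt.1 hlt)
      have hut' : u ≠ t := by
        rintro rfl
        exact h2.ne (hx htS hw (le_antisymm (hu3 w hw h2.le h3) (not_lt.1 hlt)))
      have huq : u ≠ q := by
        rintro rfl
        exact hut' (hx hqS htS (le_antisymm hut (hmin u hq1)))
      have : u ∈ locMin x S := mem_locMin_of_lt hu htS hqS (lt_of_le_of_ne hu1 hut'.symm)
        (lt_of_le_of_ne hu2 huq) fun s hs h4 h5 h6 =>
          lt_of_le_of_ne (hu3 s hs h4 h5) fun e => h6 (hx hs hu e.symm)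
      exact hut' (hx hu htS (le_antisymm hut (hmin u this)))

theorem LO_succ_lowest {t : α} (hx : Set.InjOn x S) (ht : t ∈ locMin x S)
    (hmin : ∀ s ∈ locMin x S, x t ≤ x s) {k : ℕ} :
    LO x S (k + 1) t ↔ (iterMin x k (S ∩ Set.Iic t)).Nonempty := by
  have hT := locMin_dual x S
  refine RO_dual.symm.trans ((RO_succ_lowest (α := αᵒᵈ) (t := t) hx (hT ▸ ht)
    (hT ▸ hmin)).trans ?_)
  exact iff_of_eq (congrArg Set.Nonempty (iterMin_dual x k (S ∩ Set.Iic t)))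

theorem IsSide.mem_locMin {i j : ℕ} (hx : Set.InjOn x S) (hv : v ∈ S) (hi : 1 ≤ i)
    (hij : i < j) (h : IsSide x S i j v) : v ∈ locMin x S := by
  refine (mem_iterMin_iff (r := 1) hx hv).2 ?_
  rcases h with h | h
  · exact ⟨LO_mono hi h.1, RO_mono (hi.trans hij.le) h.2.2.1⟩
  · exact ⟨LO_mono (hi.trans hij.le) h.1, RO_mono hi h.2.2.1⟩

theorem IsSide.not_mem_iterMin {i j : ℕ} (hx : Set.InjOn x S) (hv : v ∈ S)
    (hij : i < j) (h : IsSide x S i j v) : v ∉ iterMin x j S := by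
  intro hm
  have := (mem_iterMin_iff hx hv).1 hm
  rcases h with h | h
  · exact h.2.1 (LO_mono hij this.1)
  · exact h.2.2.2 (RO_mono hij this.2)

/-- The child orders of a vertex above the cut at `t` do not change when the series is cut. -/
theorem isSide_iff_Iic {t : α} (hx : Set.InjOn x S) (ht : t ∈ S) (hv : v ∈ S) (hvt : v < t)
    (hlt : x t < x v) {i j : ℕ} : IsSide x S i j v ↔ IsSide x (S ∩ Set.Iic t) i j v := by
  have h1 : ∀ r, RO x S r v ↔ RO x (S ∩ Set.Iic t) r v := fun r =>
    RO_congr_of_lt (S' := S ∩ Set.Iic t) hx hv (Set.mem_inter hv hvt.le) ht hvt hlt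
      Set.inter_subset_left (fun _ hw => hw.2) fun _ hw _ h => ⟨hw, h.le⟩
  have h2 : ∀ r, LO x S r v ↔ LO x (S ∩ Set.Iic t) r v := fun r =>
    LO_congr_Iio (S' := S ∩ Set.Iic t) hx (hx.mono Set.inter_subset_left) hv
      (Set.mem_inter hv hvt.le)
      fun w hw => ⟨fun h => ⟨h, (hw.trans hvt).le⟩, fun h => h.1⟩
  unfold IsSide
  simp only [h1, h2]

theorem isSide_iff_Ici {t : α} (hx : Set.InjOn x S) (ht : t ∈ S) (hv : v ∈ S) (hvt : t < v)
    (hlt : x t < x v) {i j : ℕ} : IsSide x S i j v ↔ IsSide x (S ∩ Set.Ici t) i j v :=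
  isSide_dual.symm.trans
    ((isSide_iff_Iic (α := αᵒᵈ) (S := S) hx ht hv hvt hlt).trans isSide_dual)

end Minima

/-! ### Transport of child orders -/

section Transport

variable {α β : Type*} [LinearOrder α] [LinearOrder β]

theorem RO_image {φ : α → β} {S : Set α} (hφ : StrictMonoOn φ S) {x : β → ℝ} {y : α → ℝ}
    (hxy : ∀ a ∈ S, ∀ b ∈ S, (x (φ a) < x (φ b) ↔ y a < y b)) {r : ℕ} {v : α} (hv : v ∈ S) :
    RO x (φ '' S) r (φ v) ↔ RO y S r v := by
  cases r with
  | zero => exact Iff.rfl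
  | succ k =>
    rw [RO_succ_iff, RO_succ_iff, iterMin_image hφ hxy]
    constructor
    · rintro ⟨_, ⟨m, hm, rfl⟩, h1, h2⟩
      have hmS := iterMin_subset y k S hm
      refine ⟨m, hm, (hφ.lt_iff_lt hv hmS).1 h1, fun w hw h3 h4 => ?_⟩
      exact (hxy v hv w hw).1 (h2 (φ w) ⟨w, hw, rfl⟩ ((hφ.lt_iff_lt hv hw).2 h3)
        ((hφ.le_iff_le hw hmS).2 h4))
    · rintro ⟨m, hm, h1, h2⟩
      have hmS := iterMin_subset y k S hm
      refine ⟨φ m, ⟨m, hm, rfl⟩, (hφ.lt_iff_lt hv hmS).2 h1, ?_⟩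
      rintro _ ⟨w, hw, rfl⟩ h3 h4
      exact (hxy v hv w hw).2 (h2 w hw ((hφ.lt_iff_lt hv hw).1 h3) ((hφ.le_iff_le hw hmS).1 h4))

theorem LO_image {φ : α → β} {S : Set α} (hφ : StrictMonoOn φ S) {x : β → ℝ} {y : α → ℝ}
    (hxy : ∀ a ∈ S, ∀ b ∈ S, (x (φ a) < x (φ b) ↔ y a < y b)) {r : ℕ} {v : α} (hv : v ∈ S) :
    LO x (φ '' S) r (φ v) ↔ LO y S r v := by
  rw [← RO_dual, ← RO_dual]
  exact RO_image (α := αᵒᵈ) (β := βᵒᵈ) (φ := φ) (fun a ha b hb h => hφ hb ha h) hxy hv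

/-- Time reversal exchanges left and right. -/
theorem LO_image_anti {φ : α → β} {S : Set α} (hφ : StrictAntiOn φ S) {x : β → ℝ} {y : α → ℝ}
    (hxy : ∀ a ∈ S, ∀ b ∈ S, (x (φ a) < x (φ b) ↔ y a < y b)) {r : ℕ} {v : α} (hv : v ∈ S) :
    LO x (φ '' S) r (φ v) ↔ RO y S r v := by
  rw [← RO_dual]
  exact RO_image (α := α) (β := βᵒᵈ) (φ := φ) (fun a ha b hb h => hφ ha hb h) hxy hv

theorem RO_congr {S : Set α} {x y : α → ℝ}
    (hxy : ∀ a ∈ S, ∀ b ∈ S, (x a < x b ↔ y a < y b)) {r : ℕ} {v : α} (hv : v ∈ S) :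
    RO x S r v ↔ RO y S r v := by
  simpa using RO_image (φ := id) (S := S) strictMonoOn_id hxy (r := r) hv

theorem LO_congr {S : Set α} {x y : α → ℝ}
    (hxy : ∀ a ∈ S, ∀ b ∈ S, (x a < x b ↔ y a < y b)) {r : ℕ} {v : α} (hv : v ∈ S) :
    LO x S r v ↔ LO y S r v := by
  simpa using LO_image (φ := id) (S := S) strictMonoOn_id hxy (r := r) hv

end Transport

/-! ### The level-set tree and the local minima -/

theorem levelTree_cases (x : ℕ → ℝ) {a b : ℕ} (hab : a ≤ b) :
    (locMin x (Set.Icc a b) = ∅ ∧ ∃ s ∈ Set.Icc a b, levelTree x a b = .leaf s ∧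
      ∀ u ∈ Set.Icc a b, x u ≤ x s) ∨
    ∃ t ∈ locMin x (Set.Icc a b), (∀ s ∈ locMin x (Set.Icc a b), x t ≤ x s) ∧
      levelTree x a b = .node t (levelTree x a t) (levelTree x t b) := by
  classical
  rw [levelTree, ← localMinima_eq_locMin]
  split
  · rename_i h
    left
    rw [List.argmin_eq_none] at h
    refine ⟨?_, ?_⟩
    · refine Set.eq_empty_of_forall_notMem fun t ht => ?_
      have : t ∈ (List.range (b + 1)).filter
          (fun t => decide (t ∈ localMinima x (Set.Icc a b))) := by
        rw [List.mem_filter, List.mem_range]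
        exact ⟨Nat.lt_succ_of_le ht.1.2, decide_eq_true ht⟩
      rw [List.filter_eq_nil_iff] at h
      exact h t (List.mem_range.2 (Nat.lt_succ_of_le ht.1.2)) (decide_eq_true ht)
    · cases hs : (List.range' a (b + 1 - a)).argmax x with
      | none =>
        rw [List.argmax_eq_none] at hs
        have := congrArg List.length hs
        rw [List.length_range', List.length_nil] at this
        omega
      | some s =>
        have hmem : s ∈ (List.range' a (b + 1 - a)).argmax x := hs
        have h1 := List.argmax_mem hmem
        refine ⟨s, ?_, rfl, fun u hu => List.le_of_mem_argmax ?_ hmem⟩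
        · rw [List.mem_range'_1] at h1
          exact ⟨h1.1, by omega⟩
        · rw [List.mem_range'_1]
          exact ⟨hu.1, by have := hu.2; omega⟩
  · rename_i t h
    right
    have hmem : t ∈ ((List.range (b + 1)).filter
      (fun t => decide (t ∈ localMinima x (Set.Icc a b)))).argmin x := h
    have h1 := List.argmin_mem hmem
    rw [List.mem_filter] at h1
    refine ⟨t, of_decide_eq_true h1.2, fun s hs => List.le_of_mem_argmin ?_ hmem, rfl⟩
    rw [List.mem_filter, List.mem_range]
    exact ⟨Nat.lt_succ_of_le hs.1.2, decide_eq_true hs⟩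

/-- Induction along the level-set tree: to the right and to the left of the root, the series is
cut at its lowest internal local minimum. -/
theorem levelTree_induction (x : ℕ → ℝ) {C : ℕ → ℕ → MarkedTree → Prop}
    (leaf : ∀ a b s, a ≤ b → locMin x (Set.Icc a b) = ∅ → s ∈ Set.Icc a b →
      (∀ u ∈ Set.Icc a b, x u ≤ x s) → C a b (.leaf s))
    (node : ∀ a b t, a < t → t < b → t ∈ locMin x (Set.Icc a b) →
      (∀ s ∈ locMin x (Set.Icc a b), x t ≤ x s) → C a t (levelTree x a t) →
      C t b (levelTree x t b) → C a b (.node t (levelTree x a t) (levelTree x t b)))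
    {a b : ℕ} (hab : a ≤ b) : C a b (levelTree x a b) := by
  induction h : b - a using Nat.strong_induction_on generalizing a b with
  | _ n ih =>
    rcases levelTree_cases x hab with ⟨h1, s, hs, h2, h3⟩ | ⟨t, ht, hmin, h2⟩
    · rw [h2]
      exact leaf a b s hab h1 hs h3
    · rw [h2]
      have ht' := ht
      obtain ⟨p, q, h3, h4, -⟩ := ht'
      have hat : a < t := lt_of_le_of_lt h3.1.1 h3.2.2.1
      have htb : t < b := lt_of_lt_of_le h4.2.2.1 h4.2.1.2
      exact node a b t hat htb ht hmin (ih (t - a) (by omega) hat.le rfl)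
        (ih (b - t) (by omega) htb.le rfl)

theorem Icc_inter_Ici_of_le {a t b : ℕ} (h : a ≤ t) :
    Set.Icc a b ∩ Set.Ici t = Set.Icc t b := by
  ext w; simp only [Set.mem_inter_iff, Set.mem_Icc, Set.mem_Ici]; omega

theorem Icc_inter_Iic_of_le {a t b : ℕ} (h : t ≤ b) :
    Set.Icc a b ∩ Set.Iic t = Set.Icc a t := by
  ext w; simp only [Set.mem_inter_iff, Set.mem_Icc, Set.mem_Iic]; omega

namespace MarkedTree

theorem one_le_order (T : MarkedTree) : 1 ≤ T.order := by
  induction T with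
  | leaf => exact le_rfl
  | node t l r ihl ihr => rw [order]; split <;> omega

theorem branches_of_order_eq {T : MarkedTree} {j : ℕ} (h : T.order = j) : T.branches j = [T] := by
  cases T with
  | leaf s => exact if_pos h
  | node t l r => exact if_pos h

theorem branches_of_order_lt {T : MarkedTree} {j : ℕ} (h : T.order < j) : T.branches j = [] := by
  induction T with
  | leaf s => exact if_neg h.ne
  | node t l r ihl ihr =>
    rw [branches, if_neg h.ne]
    rw [order] at h
    rw [ihl (by split at h <;> omega), ihr (by split at h <;> omega), List.append_nil]

end MarkedTree

open MarkedTree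

/-- The order of the level-set tree exceeds `k` if and only if there are local minima of order
`k`. -/
theorem lt_order_levelTree_iff {x : ℕ → ℝ} (hx : Function.Injective x) (k : ℕ) {a b : ℕ}
    (hab : a ≤ b) :
    k < (levelTree x a b).order ↔ (iterMin x k (Set.Icc a b)).Nonempty := by
  refine levelTree_induction x
    (C := fun a b T => ∀ k, k < T.order ↔ (iterMin x k (Set.Icc a b)).Nonempty) ?_ ?_ hab k
  · intro a b s hab h0 _ _ k
    rw [MarkedTree.order]
    cases k with
    | zero => exact iff_of_true one_pos ⟨a, le_rfl, hab⟩
    | succ m =>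
      refine iff_of_false (by omega) ?_
      rintro ⟨w, hw⟩
      have : w ∈ locMin x (Set.Icc a b) := iterMin_anti x _ (Nat.le_add_left 1 m) hw
      rw [h0] at this
      exact this
  · intro a b t hat htb ht hmin ihl ihr k
    have hxW := hx.injOn (s := Set.Icc a b)
    cases k with
    | zero => exact iff_of_true (one_le_order _) ⟨a, le_rfl, (hat.trans htb).le⟩
    | succ m =>
      have hR := iterMin_inter_Ioi_of_lowest hxW ht hmin m
      have hL := iterMin_inter_Iio_of_lowest hxW ht hmin m
      rw [Icc_inter_Ici_of_le hat.le] at hR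
      rw [Icc_inter_Iic_of_le htb.le] at hL
      have ht' : t ∈ iterMin x (m + 1) (Set.Icc a b) ↔
          m < (levelTree x a t).order ∧ m < (levelTree x t b).order := by
        rw [mem_iterMin_iff hxW ⟨hat.le, htb.le⟩, LO_succ_lowest hxW ht hmin,
          RO_succ_lowest hxW ht hmin, Icc_inter_Ici_of_le hat.le, Icc_inter_Iic_of_le htb.le,
          ihl, ihr]
      -- the recursion of the Horton-Strahler order, in terms of the local minima on the left and on
      -- the right of `t` and of `t` itself
      have key : (iterMin x (m + 1) (Set.Icc a b)).Nonempty ↔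
          m + 1 < (levelTree x a t).order ∨ m + 1 < (levelTree x t b).order ∨
          (m < (levelTree x a t).order ∧ m < (levelTree x t b).order) := by
        rw [← ht', ihl, ihr, ← hR, ← hL]
        constructor
        · rintro ⟨w, hw⟩
          rcases lt_trichotomy w t with h | h | h
          · exact Or.inl ⟨w, hw, h⟩
          · exact Or.inr (Or.inr (h ▸ hw))
          · exact Or.inr (Or.inl ⟨w, hw, h⟩)
        · rintro (⟨w, hw, -⟩ | ⟨w, hw, -⟩ | h)
          · exact ⟨w, hw⟩
          · exact ⟨w, hw⟩
          · exact ⟨t, h⟩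
      rw [key, MarkedTree.order]
      split <;> omega

/-- The side vertices of the level-set tree of `x a, …, x b`. -/
def sideSet (x : ℕ → ℝ) (i j a b : ℕ) : Set ℕ := {v ∈ Set.Icc a b | IsSide x (Set.Icc a b) i j v}

/-- The number of elements of `M` before `v`. -/
noncomputable def rankIn (M : Set ℕ) (v : ℕ) : ℕ := (M ∩ Set.Iio v).ncard

/-- `t` is the lowest internal local minimum of `x a, …, x b`, that is, the root of the tree. The
values of `x` are required to be distinct, so that this minimum is unique. -/
structure IsRoot (x : ℕ → ℝ) (a b t : ℕ) : Prop where
  inj : Function.Injective x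
  left_lt : a < t
  lt_right : t < b
  mem : t ∈ locMin x (Set.Icc a b)
  le : ∀ s ∈ locMin x (Set.Icc a b), x t ≤ x s

namespace IsRoot

variable {x : ℕ → ℝ} {a b t : ℕ}

theorem mem_Icc (h : IsRoot x a b t) : t ∈ Set.Icc a b := ⟨h.left_lt.le, h.lt_right.le⟩

theorem iterMin_right (h : IsRoot x a b t) {j : ℕ} (hj : 1 ≤ j) :
    iterMin x j (Set.Icc a b) ∩ Set.Ioi t = iterMin x j (Set.Icc t b) := by
  obtain ⟨m, rfl⟩ : ∃ m, j = m + 1 := ⟨j - 1, by omega⟩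
  rw [iterMin_inter_Ioi_of_lowest h.inj.injOn h.mem h.le m, Icc_inter_Ici_of_le h.left_lt.le]

theorem iterMin_left (h : IsRoot x a b t) {j : ℕ} (hj : 1 ≤ j) :
    iterMin x j (Set.Icc a b) ∩ Set.Iio t = iterMin x j (Set.Icc a t) := by
  obtain ⟨m, rfl⟩ : ∃ m, j = m + 1 := ⟨j - 1, by omega⟩
  rw [iterMin_inter_Iio_of_lowest h.inj.injOn h.mem h.le m, Icc_inter_Iic_of_le h.lt_right.le]

theorem LO_iff (h : IsRoot x a b t) {r : ℕ} :
    LO x (Set.Icc a b) r t ↔ r ≤ (levelTree x a t).order := by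
  cases r with
  | zero => exact iff_of_true trivial (Nat.zero_le _)
  | succ k =>
    rw [LO_succ_lowest h.inj.injOn h.mem h.le, Icc_inter_Iic_of_le h.lt_right.le,
      ← lt_order_levelTree_iff h.inj k h.left_lt.le]
    exact Iff.rfl

theorem RO_iff (h : IsRoot x a b t) {r : ℕ} :
    RO x (Set.Icc a b) r t ↔ r ≤ (levelTree x t b).order := by
  cases r with
  | zero => exact iff_of_true trivial (Nat.zero_le _)
  | succ k =>
    rw [RO_succ_lowest h.inj.injOn h.mem h.le, Icc_inter_Ici_of_le h.left_lt.le,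
      ← lt_order_levelTree_iff h.inj k h.lt_right.le]
    exact Iff.rfl

theorem mem_iterMin (h : IsRoot x a b t) {r : ℕ} :
    t ∈ iterMin x r (Set.Icc a b) ↔
      r ≤ (levelTree x a t).order ∧ r ≤ (levelTree x t b).order := by
  rw [mem_iterMin_iff h.inj.injOn h.mem_Icc, h.LO_iff, h.RO_iff]

theorem mem_sideSet (h : IsRoot x a b t) {i j : ℕ} : t ∈ sideSet x i j a b ↔
    ((levelTree x a t).order = i ∧ (levelTree x t b).order = j) ∨
      ((levelTree x a t).order = j ∧ (levelTree x t b).order = i) := by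
  unfold sideSet IsSide
  rw [Set.mem_ofPred_eq, and_iff_right h.mem_Icc]
  simp only [h.LO_iff, h.RO_iff]
  omega

theorem sideSet_left (h : IsRoot x a b t) {i j : ℕ} (hi : 1 ≤ i) (hij : i < j) :
    sideSet x i j a b ∩ Set.Iio t = sideSet x i j a t := by
  have hxW := h.inj.injOn (s := Set.Icc a b)
  have h1 := h.iterMin_left le_rfl
  ext v
  constructor
  · rintro ⟨⟨hv, hs⟩, hvt⟩
    have hv1 := hs.mem_locMin hxW hv hi hij
    have hlt : x t < x v := lt_of_le_of_ne (h.le v hv1) fun e => (ne_of_lt hvt) (h.inj e).symm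
    rw [isSide_iff_Iic hxW h.mem_Icc hv hvt hlt, Icc_inter_Iic_of_le h.lt_right.le] at hs
    exact ⟨⟨hv.1, le_of_lt hvt⟩, hs⟩
  · rintro ⟨hv, hs⟩
    have hv1 : v ∈ iterMin x 1 (Set.Icc a t) := hs.mem_locMin h.inj.injOn hv hi hij
    rw [← h1] at hv1
    have hvt := hv1.2
    have hvW : v ∈ Set.Icc a b := ⟨hv.1, hv.2.trans h.lt_right.le⟩
    have hlt : x t < x v := lt_of_le_of_ne (h.le v hv1.1) fun e => (ne_of_lt hvt) (h.inj e).symm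
    refine ⟨⟨hvW, ?_⟩, hvt⟩
    rw [isSide_iff_Iic hxW h.mem_Icc hvW hvt hlt, Icc_inter_Iic_of_le h.lt_right.le]
    exact hs

theorem sideSet_right (h : IsRoot x a b t) {i j : ℕ} (hi : 1 ≤ i) (hij : i < j) :
    sideSet x i j a b ∩ Set.Ioi t = sideSet x i j t b := by
  have hxW := h.inj.injOn (s := Set.Icc a b)
  have h1 := h.iterMin_right le_rfl
  ext v
  constructor
  · rintro ⟨⟨hv, hs⟩, hvt⟩
    have hv1 := hs.mem_locMin hxW hv hi hij
    have hlt : x t < x v := lt_of_le_of_ne (h.le v hv1) fun e => (ne_of_lt hvt) (h.inj e)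
    rw [isSide_iff_Ici hxW h.mem_Icc hv hvt hlt, Icc_inter_Ici_of_le h.left_lt.le] at hs
    exact ⟨⟨le_of_lt hvt, hv.2⟩, hs⟩
  · rintro ⟨hv, hs⟩
    have hv1 : v ∈ iterMin x 1 (Set.Icc t b) := hs.mem_locMin h.inj.injOn hv hi hij
    rw [← h1] at hv1
    have hvt := hv1.2
    have hvW : v ∈ Set.Icc a b := ⟨h.left_lt.le.trans hv.1, hv.2⟩
    have hlt : x t < x v := lt_of_le_of_ne (h.le v hv1.1) fun e => (ne_of_lt hvt) (h.inj e)
    refine ⟨⟨hvW, ?_⟩, hvt⟩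
    rw [isSide_iff_Ici hxW h.mem_Icc hvW hvt hlt, Icc_inter_Ici_of_le h.left_lt.le]
    exact hs

end IsRoot

theorem sideSet_finite (x : ℕ → ℝ) (i j a b : ℕ) : (sideSet x i j a b).Finite :=
  (Set.finite_Icc a b).subset (Set.sep_subset _ _)

theorem ncard_split {M : Set ℕ} (hM : M.Finite) (t : ℕ) :
    M.ncard = (M ∩ Set.Iio t).ncard + (M ∩ {t}).ncard + (M ∩ Set.Ioi t).ncard := by
  rw [← Set.ncard_union_eq _ (hM.subset Set.inter_subset_left)
    (hM.subset Set.inter_subset_left), ← Set.ncard_union_eq _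
    ((hM.subset Set.inter_subset_left).union (hM.subset Set.inter_subset_left))
    (hM.subset Set.inter_subset_left), ← Set.inter_union_distrib_left,
    ← Set.inter_union_distrib_left]
  · congr 1
    ext w
    simp only [Set.mem_inter_iff, Set.mem_union, Set.mem_Iio, Set.mem_singleton_iff, Set.mem_Ioi]
    have := lt_trichotomy w t
    tauto
  · rw [← Set.inter_union_distrib_left]
    refine Set.disjoint_left.2 fun w hw hw' => ?_
    rcases hw.2 with h | h
    · exact lt_asymm (Set.mem_Iio.1 h) (Set.mem_Ioi.1 hw'.2)
    · have h1 : t < w := hw'.2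
      exact h1.ne (Set.mem_singleton_iff.1 h).symm
  · refine Set.disjoint_left.2 fun w hw hw' => ?_
    have h1 : w < t := hw.2
    exact h1.ne (Set.mem_singleton_iff.1 hw'.2)

theorem IsRoot.ncard_sideSet {x : ℕ → ℝ} {a b t : ℕ} (h : IsRoot x a b t) {i j : ℕ}
    (hi : 1 ≤ i) (hij : i < j) :
    (sideSet x i j a b).ncard = (sideSet x i j a t).ncard +
      (if ((levelTree x a t).order = i ∧ (levelTree x t b).order = j) ∨
      ((levelTree x a t).order = j ∧ (levelTree x t b).order = i) then 1 else 0) +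
      (sideSet x i j t b).ncard := by
  rw [ncard_split (sideSet_finite x i j a b) t, h.sideSet_left hi hij, h.sideSet_right hi hij]
  congr 2
  split_ifs with h1
  · rw [Set.inter_eq_right.2 (Set.singleton_subset_iff.2 (h.mem_sideSet.2 h1)),
      Set.ncard_singleton]
  · rw [Set.inter_singleton_eq_empty.2 fun h2 => h1 (h.mem_sideSet.1 h2), Set.ncard_empty]

theorem sideSet_eq_empty {x : ℕ → ℝ} (hx : Function.Injective x) {a b : ℕ} (hab : a ≤ b)
    {i j : ℕ} (hj : 1 ≤ j) (h : (levelTree x a b).order < j) : sideSet x i j a b = ∅ := by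
  refine Set.eq_empty_of_forall_notMem fun v hv => ?_
  obtain ⟨m, rfl⟩ : ∃ m, j = m + 1 := ⟨j - 1, by omega⟩
  have := (lt_order_levelTree_iff hx m hab).2 hv.2.iterMin_nonempty
  omega

/-- All side vertices of type `(i, j)` of a tree of order `j` are on the branch of the root. -/
theorem sideCount_levelTree {x : ℕ → ℝ} (hx : Function.Injective x) {a b : ℕ} (hab : a ≤ b)
    {i j : ℕ} (hi : 1 ≤ i) (hij : i < j) (h : (levelTree x a b).order = j) :
    (levelTree x a b).sideCount i = (sideSet x i j a b).ncard := by
  refine levelTree_induction x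
    (C := fun a b T => T.order = j → T.sideCount i = (sideSet x i j a b).ncard) ?_ ?_ hab h
  · intro a b s _ _ _ _ h
    rw [MarkedTree.order] at h
    omega
  · intro a b t hat htb ht hmin ihl ihr h
    have hr : IsRoot x a b t := ⟨hx, hat, htb, ht, hmin⟩
    rw [hr.ncard_sideSet hi hij, MarkedTree.sideCount]
    rw [MarkedTree.order] at h
    have hl := sideSet_eq_empty hx hat.le (i := i) (j := j) (by omega)
    have hr := sideSet_eq_empty hx htb.le (i := i) (j := j) (by omega)
    split_ifs at h with h1
    · rw [if_pos h1, hl (by omega), hr (by omega), if_neg (by omega), Set.ncard_empty]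
    · rw [if_neg h1]
      rcases lt_or_ge (levelTree x t b).order (levelTree x a t).order with h2 | h2
      · rw [if_pos h2, hr (by omega), ihl (by omega), Set.ncard_empty]
        split_ifs <;> omega
      · rw [if_neg (not_lt.2 h2), hl (by omega), ihr (by omega), Set.ncard_empty]
        split_ifs <;> omega

/-- If the order of the root differs from `j`, then the root is not a side vertex of type `(i, j)`,
so that the side vertices are those of the two subtrees. -/
theorem numSide_levelTree {x : ℕ → ℝ} (hx : Function.Injective x) {a b : ℕ} (hab : a ≤ b)
    {i j : ℕ} (hi : 1 ≤ i) (hij : i < j) :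
    (levelTree x a b).numSide i j = (sideSet x i j a b).ncard := by
  induction h : b - a using Nat.strong_induction_on generalizing a b with
  | _ n ih =>
    rcases eq_or_ne (levelTree x a b).order j with h1 | h1
    · rw [numSide, branches_of_order_eq h1, List.map_singleton, List.sum_singleton,
        sideCount_levelTree hx hab hi hij h1]
    rcases levelTree_cases x hab with ⟨h2, s, hs, h3, h4⟩ | ⟨t, ht, hmin, h3⟩
    · have h5 : (levelTree x a b).order < j := by rw [h3, MarkedTree.order]; omega
      rw [numSide, branches_of_order_lt h5, sideSet_eq_empty hx hab (by omega) h5,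
        Set.ncard_empty, List.map_nil, List.sum_nil]
    · obtain ⟨p, q, h4, h5, -⟩ := id ht
      have hat : a < t := lt_of_le_of_lt h4.1.1 h4.2.2.1
      have htb : t < b := lt_of_lt_of_le h5.2.2.1 h5.2.1.2
      have hr : IsRoot x a b t := ⟨hx, hat, htb, ht, hmin⟩
      have ihl := ih (t - a) (by omega) hat.le rfl
      have ihr := ih (b - t) (by omega) htb.le rfl
      rw [hr.ncard_sideSet hi hij, ← ihl, ← ihr]
      rw [h3] at h1 ⊢
      rw [numSide, branches, if_neg h1, List.map_append, List.sum_append, if_neg]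
      · rfl
      · rw [MarkedTree.order] at h1
        split_ifs at h1 <;> omega

/-! ### The branches of a given order, from left to right -/

/-- The terminal vertex is a local maximum or an internal local minimum, so it is not
an end of the series from which the series increases. -/
theorem terminal_levelTree (x : ℕ → ℝ) {a b : ℕ} (hab : a ≤ b) :
    (levelTree x a b).terminal ∈ Set.Icc a b ∧
      (a < b → x a < x (a + 1) → a < (levelTree x a b).terminal) ∧
      (a < b → x b < x (b - 1) → (levelTree x a b).terminal < b) := by
  refine levelTree_induction x (C := fun a b T => T.terminal ∈ Set.Icc a b ∧
      (a < b → x a < x (a + 1) → a < T.terminal) ∧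
      (a < b → x b < x (b - 1) → T.terminal < b)) ?_ ?_ hab
  · intro a b s hab _ hs hmax
    refine ⟨hs, fun h1 h2 => lt_of_le_of_ne hs.1 ?_, fun h1 h2 => lt_of_le_of_ne hs.2 ?_⟩
    · rintro rfl
      exact absurd (hmax (a + 1) ⟨a.le_succ, h1⟩) (not_le.2 h2)
    · intro e
      rw [MarkedTree.terminal] at e
      subst e
      exact absurd (hmax (s - 1) ⟨by omega, by omega⟩) (not_le.2 h2)
  · intro a b t hat htb ht hmin ⟨⟨l1, l2⟩, l3, l4⟩ ⟨⟨r1, r2⟩, r3, r4⟩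
    rw [MarkedTree.terminal]
    split_ifs
    · exact ⟨⟨hat.le, htb.le⟩, fun _ _ => hat, fun _ _ => htb⟩
    · exact ⟨⟨l1, l2.trans htb.le⟩, fun _ h => l3 hat h, fun _ _ => l2.trans_lt htb⟩
    · exact ⟨⟨hat.le.trans r1, r2⟩, fun _ _ => hat.trans_le r1, fun _ h => r4 htb h⟩

/-- The terminal vertex of a branch is not an end of the series from which the series increases, and
in particular not a time at which a larger series was cut. -/
theorem terminal_mem_branches (x : ℕ → ℝ) {a b j : ℕ} (hab : a ≤ b) :
    ∀ s ∈ (levelTree x a b).branches j, s.terminal ∈ Set.Icc a b ∧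
      (a < b → x a < x (a + 1) → a < s.terminal) ∧
      (a < b → x b < x (b - 1) → s.terminal < b) := by
  induction h : b - a using Nat.strong_induction_on generalizing a b with
  | _ n ih =>
    rcases eq_or_ne (levelTree x a b).order j with h1 | h1
    · rw [branches_of_order_eq h1]
      intro s hs
      rw [List.mem_singleton.1 hs]
      exact terminal_levelTree x hab
    rcases levelTree_cases x hab with ⟨h2, s, hs, h3, h4⟩ | ⟨t, ht, hmin, h3⟩
    · rw [h3, MarkedTree.order] at h1
      rw [h3, branches, if_neg h1]
      simp
    · obtain ⟨p, q, h4, h5, -⟩ := id ht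
      have hat : a < t := lt_of_le_of_lt h4.1.1 h4.2.2.1
      have htb : t < b := lt_of_lt_of_le h5.2.2.1 h5.2.1.2
      rw [h3] at h1 ⊢
      rw [branches, if_neg h1]
      intro s hs
      rcases List.mem_append.1 hs with hs | hs
      · obtain ⟨⟨l1, l2⟩, l3, l4⟩ := ih (t - a) (by omega) hat.le rfl s hs
        exact ⟨⟨l1, l2.trans htb.le⟩, fun _ h => l3 hat h, fun _ _ => l2.trans_lt htb⟩
      · obtain ⟨⟨r1, r2⟩, r3, r4⟩ := ih (b - t) (by omega) htb.le rfl s hs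
        exact ⟨⟨hat.le.trans r1, r2⟩, fun _ _ => hat.trans_le r1, fun _ h => r4 htb h⟩

theorem IsRoot.lt_prev_next {x : ℕ → ℝ} {a b t : ℕ} (h : IsRoot x a b t) :
    x t < x (t - 1) ∧ x t < x (t + 1) := by
  have h1 := h.left_lt
  have h2 := h.lt_right
  obtain ⟨p, q, h3, h4, h5, h6⟩ := h.mem
  have hp : p = t - 1 := by
    by_contra hne
    have := h3.2.2.1
    exact h3.2.2.2 (t - 1) ⟨by omega, by omega⟩ ⟨by omega, by omega⟩
  have hq : q = t + 1 := by
    by_contra hne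
    have := h4.2.2.1
    exact h4.2.2.2 (t + 1) ⟨by omega, by omega⟩ ⟨by omega, by omega⟩
  exact ⟨hp ▸ h5, hq ▸ h6⟩

theorem iterMin_eq_empty_of_order_le {x : ℕ → ℝ} (hx : Function.Injective x) {a b j : ℕ}
    (hab : a ≤ b) (h : (levelTree x a b).order ≤ j) : iterMin x j (Set.Icc a b) = ∅ := by
  rw [← Set.not_nonempty_iff_eq_empty, ← lt_order_levelTree_iff hx j hab]
  omega

theorem rankIn_of_le {M M' : Set ℕ} {t v : ℕ} (h : M ∩ Set.Iio t = M') (hv : v ≤ t) :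
    rankIn M v = rankIn M' v := by
  rw [rankIn, rankIn, ← h, Set.inter_assoc, Set.inter_eq_right.2 (Set.Iio_subset_Iio hv)]

theorem rankIn_of_gt {M M' : Set ℕ} (hM : M.Finite) {t v : ℕ} (h : M ∩ Set.Ioi t = M')
    (hv : t < v) : rankIn M v = (M ∩ Set.Iic t).ncard + rankIn M' v := by
  rw [rankIn, rankIn, ← h, ← Set.ncard_union_eq _ (hM.subset Set.inter_subset_left)
    ((hM.subset Set.inter_subset_left).subset Set.inter_subset_left)]
  · congr 1
    ext w
    simp only [Set.mem_inter_iff, Set.mem_union, Set.mem_Iio, Set.mem_Iic, Set.mem_Ioi]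
    have := le_or_gt w t
    constructor
    · rintro ⟨h1, h2⟩
      rcases this with h3 | h3
      · exact Or.inl ⟨h1, h3⟩
      · exact Or.inr ⟨⟨h1, h3⟩, h2⟩
    · rintro (⟨h1, h2⟩ | ⟨⟨h1, h2⟩, h3⟩)
      · exact ⟨h1, h2.trans_lt hv⟩
      · exact ⟨h1, h3⟩
  · refine Set.disjoint_left.2 fun w hw hw' => ?_
    exact absurd (Set.mem_Iic.1 hw.2) (not_le.2 hw'.1.2)

/-- The branches of order `j` correspond, from left to right, to the intervals into which the
local minima of order `j` cut the series: the terminal vertex and the side vertices of a branch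
lie in the interval of the branch. -/
theorem branches_levelTree {x : ℕ → ℝ} (hx : Function.Injective x) {a b j : ℕ} (hj : 1 ≤ j)
    (hab : a ≤ b) :
    ((levelTree x a b).branches j).length =
      (if j ≤ (levelTree x a b).order then (iterMin x j (Set.Icc a b)).ncard + 1 else 0) ∧
    ∀ n s, ((levelTree x a b).branches j)[n]? = some s →
      rankIn (iterMin x j (Set.Icc a b)) s.terminal = n ∧
      s.terminal ∉ iterMin x j (Set.Icc a b) ∧
      ∀ i, 1 ≤ i → i < j → s.sideCount i =
        {v ∈ sideSet x i j a b | rankIn (iterMin x j (Set.Icc a b)) v = n}.ncard := by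
  induction h : b - a using Nat.strong_induction_on generalizing a b with
  | _ n ih =>
    rcases eq_or_ne (levelTree x a b).order j with h1 | h1
    · rw [branches_of_order_eq h1, iterMin_eq_empty_of_order_le hx hab h1.le, if_pos h1.ge]
      refine ⟨by simp, fun n s hs => ?_⟩
      cases n with
      | succ n => simp at hs
      | zero =>
        obtain rfl : levelTree x a b = s := by simpa using hs
        refine ⟨by simp [rankIn], Set.notMem_empty _, fun i hi hij => ?_⟩
        rw [sideCount_levelTree hx hab hi hij h1]
        simp [rankIn]
    rcases levelTree_cases x hab with ⟨h2, s, hs, h3, h4⟩ | ⟨t, ht, hmin, h3⟩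
    · have h5 : (levelTree x a b).order < j := by
        rw [h3, MarkedTree.order] at h1 ⊢
        omega
      rw [branches_of_order_lt h5, if_neg (not_le.2 h5)]
      simp
    · obtain ⟨p, q, h4, h5, -⟩ := id ht
      have hat : a < t := lt_of_le_of_lt h4.1.1 h4.2.2.1
      have htb : t < b := lt_of_lt_of_le h5.2.2.1 h5.2.1.2
      have hr : IsRoot x a b t := ⟨hx, hat, htb, ht, hmin⟩
      obtain ⟨ihl1, ihl2⟩ := ih (t - a) (by omega) hat.le rfl
      obtain ⟨ihr1, ihr2⟩ := ih (b - t) (by omega) htb.le rfl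
      have hML := hr.iterMin_left hj
      have hMR := hr.iterMin_right hj
      have htM := hr.mem_iterMin (r := j)
      have hfin : (iterMin x j (Set.Icc a b)).Finite :=
        (Set.finite_Icc a b).subset (iterMin_subset x j _)
      have hMl0 := iterMin_eq_empty_of_order_le hx (j := j) hat.le
      have hMr0 := iterMin_eq_empty_of_order_le hx (j := j) htb.le
      have hbr : (levelTree x a b).branches j =
          (levelTree x a t).branches j ++ (levelTree x t b).branches j := by
        rw [h3] at h1 ⊢
        rw [branches, if_neg h1]
      have hsl := fun i => sideSet_eq_empty hx hat.le (i := i) hj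
      have hsr := fun i => sideSet_eq_empty hx htb.le (i := i) hj
      have hord : (levelTree x a b).order = if (levelTree x a t).order = (levelTree x t b).order
          then (levelTree x a t).order + 1
          else max (levelTree x a t).order (levelTree x t b).order := by
        conv_lhs => rw [h3]
        rw [MarkedTree.order]
      have hside : ∀ i, i < j → t ∉ sideSet x i j a b := fun i hij hmem => by
        rw [hr.mem_sideSet] at hmem
        rw [hord] at h1
        split_ifs at h1 <;> omega
      have hcard := ncard_split hfin t
      rw [hML, hMR] at hcard
      have hIic : (iterMin x j (Set.Icc a b) ∩ Set.Iic t).ncard =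
          (iterMin x j (Set.Icc a t)).ncard + (iterMin x j (Set.Icc a b) ∩ {t}).ncard := by
        rw [← hML, ← Set.ncard_union_eq _ (hfin.subset Set.inter_subset_left)
          (hfin.subset Set.inter_subset_left), ← Set.inter_union_distrib_left,
          Set.Iio_union_right]
        exact Set.disjoint_left.2 fun w hw hw' =>
          (ne_of_lt (Set.mem_Iio.1 hw.2)) (Set.mem_singleton_iff.1 hw'.2)
      have ht1 : (iterMin x j (Set.Icc a b) ∩ {t}).ncard =
          if j ≤ (levelTree x a t).order ∧ j ≤ (levelTree x t b).order then 1 else 0 := by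
        split_ifs with hc
        · rw [Set.inter_eq_right.2 (Set.singleton_subset_iff.2 (htM.2 hc)), Set.ncard_singleton]
        · rw [Set.inter_singleton_eq_empty.2 fun h2 => hc (htM.1 h2), Set.ncard_empty]
      have hle : ∀ M : Set ℕ, M.Finite → ∀ v, rankIn M v ≤ M.ncard := fun M hM v =>
        Set.ncard_le_ncard Set.inter_subset_left hM
      have hfl : (iterMin x j (Set.Icc a t)).Finite :=
        (Set.finite_Icc a t).subset (iterMin_subset x j _)
      rw [ht1] at hcard hIic
      refine ⟨?_, fun n s hs => ?_⟩
      · rw [hbr, List.length_append, ihl1, ihr1, hcard, hord]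
        have e1 : (levelTree x a t).order ≤ j → (iterMin x j (Set.Icc a t)).ncard = 0 :=
          fun h => by rw [hMl0 h, Set.ncard_empty]
        have e2 : (levelTree x t b).order ≤ j → (iterMin x j (Set.Icc t b)).ncard = 0 :=
          fun h => by rw [hMr0 h, Set.ncard_empty]
        rw [hord] at h1
        split_ifs at h1 ⊢ <;> omega
      · rw [hbr, List.getElem?_append] at hs
        split_ifs at hs with hn
        · have hsm := List.mem_of_getElem? hs
          obtain ⟨-, -, hlt⟩ := terminal_mem_branches x hat.le s hsm
          have hlt := hlt hat hr.lt_prev_next.1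
          obtain ⟨i1, i2, i3⟩ := ihl2 n s hs
          have hlen : j ≤ (levelTree x a t).order ∧ n < (iterMin x j (Set.Icc a t)).ncard + 1 := by
            rw [ihl1] at hn
            split_ifs at hn with hc
            · exact ⟨hc, hn⟩
            · omega
          refine ⟨by rw [rankIn_of_le hML hlt.le, i1], fun hmem => i2 (hML ▸ ⟨hmem, hlt⟩),
            fun i hi hij => ?_⟩
          rw [i3 i hi hij]
          congr 1
          ext v
          constructor
          · rintro ⟨hv, hv'⟩
            rw [← hr.sideSet_left hi hij] at hv
            exact ⟨hv.1, by rw [rankIn_of_le hML (le_of_lt hv.2), hv']⟩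
          · rintro ⟨hv, hv'⟩
            rcases lt_trichotomy v t with h6 | h6 | h6
            · exact ⟨by rw [← hr.sideSet_left hi hij]; exact ⟨hv, h6⟩,
                by rw [← rankIn_of_le hML h6.le, hv']⟩
            · exact absurd (h6 ▸ hv) (hside i hij)
            · have hvr : v ∈ sideSet x i j t b := by
                rw [← hr.sideSet_right hi hij]; exact ⟨hv, h6⟩
              have hor : j ≤ (levelTree x t b).order := by
                by_contra hlt'
                rw [hsr i (not_le.1 hlt')] at hvr
                exact hvr
              rw [rankIn_of_gt hfin hMR h6, hIic, if_pos ⟨hlen.1, hor⟩] at hv'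
              omega
        · have hsm := List.mem_of_getElem? hs
          obtain ⟨-, hlt, -⟩ := terminal_mem_branches x htb.le s hsm
          have hlt := hlt htb hr.lt_prev_next.2
          obtain ⟨i1, i2, i3⟩ := ihr2 _ s hs
          have hor : j ≤ (levelTree x t b).order := by
            by_contra hlt'
            rw [branches_of_order_lt (not_le.1 hlt')] at hsm
            simp at hsm
          have hlen : (iterMin x j (Set.Icc a b) ∩ Set.Iic t).ncard =
              ((levelTree x a t).branches j).length := by
            rw [hIic, ihl1]
            by_cases hc : j ≤ (levelTree x a t).order
            · rw [if_pos ⟨hc, hor⟩, if_pos hc]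
            · rw [if_neg fun h => hc h.1, if_neg hc, hMl0 (not_le.1 hc).le, Set.ncard_empty]
          refine ⟨by rw [rankIn_of_gt hfin hMR hlt, i1, hlen]; omega,
            fun hmem => i2 (hMR ▸ ⟨hmem, hlt⟩), fun i hi hij => ?_⟩
          rw [i3 i hi hij]
          congr 1
          ext v
          constructor
          · rintro ⟨hv, hv'⟩
            rw [← hr.sideSet_right hi hij] at hv
            exact ⟨hv.1, by rw [rankIn_of_gt hfin hMR hv.2, hv', hlen]; omega⟩
          · rintro ⟨hv, hv'⟩
            rcases lt_trichotomy v t with h6 | h6 | h6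
            · have hvl : v ∈ sideSet x i j a t := by
                rw [← hr.sideSet_left hi hij]; exact ⟨hv, h6⟩
              have hol : j ≤ (levelTree x a t).order := by
                by_contra hlt'
                rw [hsl i (not_le.1 hlt')] at hvl
                exact hvl
              rw [ihl1, if_pos hol] at hn
              rw [rankIn_of_le hML h6.le] at hv'
              have := hle _ hfl v
              omega
            · exact absurd (h6 ▸ hv) (hside i hij)
            · refine ⟨by rw [← hr.sideSet_right hi hij]; exact ⟨hv, h6⟩, ?_⟩
              rw [rankIn_of_gt hfin hMR h6, hlen] at hv'
              omega

/-! ### Complete branches -/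

/-- Filtering by a property that holds exactly for the first positions. -/
theorem filter_eq_take {α : Type*} {p : α → Bool} {l : List α} {m : ℕ}
    (h : ∀ n s, l[n]? = some s → (p s = true ↔ n < m)) : l.filter p = l.take m := by
  induction l generalizing m with
  | nil => simp
  | cons a l ih =>
    have h0 := h 0 a rfl
    cases m with
    | zero =>
      rw [List.take_zero, List.filter_eq_nil_iff]
      intro s hs
      obtain ⟨n, hn⟩ := List.mem_iff_getElem?.1 hs
      rw [h n s hn]
      omega
    | succ m =>
      rw [List.filter_cons_of_pos (h0.2 m.succ_pos), List.take_succ_cons,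
        ih (m := m) fun n s hs => (h (n + 1) s hs).trans (by omega)]

theorem filter_eq_take_tail {α : Type*} {p : α → Bool} {l : List α} {m : ℕ}
    (h : ∀ n s, l[n]? = some s → (p s = true ↔ 1 ≤ n ∧ n < m)) :
    l.filter p = l.tail.take (m - 1) := by
  cases l with
  | nil => simp
  | cons a l =>
    have h0 : ¬ p a = true := fun h1 => by have := (h 0 a rfl).1 h1; omega
    rw [List.filter_cons_of_neg h0, List.tail_cons]
    exact filter_eq_take fun n s hs => (h (n + 1) s hs).trans (by omega)

theorem rankIn_of_consec {M : Set ℕ} {L R : ℕ} (h : Consec M L R) :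
    rankIn M R = rankIn M L + 1 := by
  have : M ∩ Set.Iio R = insert L (M ∩ Set.Iio L) := by
    ext w
    simp only [Set.mem_inter_iff, Set.mem_Iio, Set.mem_insert_iff]
    constructor
    · rintro ⟨h1, h2⟩
      have := h.2.2.2 w h1
      rcases lt_trichotomy w L with h3 | h3 | h3
      · exact Or.inr ⟨h1, h3⟩
      · exact Or.inl h3
      · exact absurd ⟨h3, h2⟩ this
    · rintro (rfl | ⟨h1, h2⟩)
      · exact ⟨h.1, h.2.2.1⟩
      · exact ⟨h1, h2.trans h.2.2.1⟩
  rw [rankIn, this, Set.ncard_insert_of_notMem (fun h => lt_irrefl _ (Set.mem_Iio.1 h.2))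
    ((Set.finite_Iio L).subset Set.inter_subset_right), rankIn]

theorem rankIn_mono {M : Set ℕ} {v w : ℕ} (h : v ≤ w) :
    rankIn M v ≤ rankIn M w :=
  Set.ncard_le_ncard (Set.inter_subset_inter_right _ (Set.Iio_subset_Iio h))
    ((Set.finite_Iio w).subset Set.inter_subset_right)

theorem rankIn_lt {M : Set ℕ} {v w : ℕ} (hv : v ∈ M) (h : v < w) :
    rankIn M v < rankIn M w := by
  refine Set.ncard_lt_ncard ?_ ((Set.finite_Iio w).subset Set.inter_subset_right)
  refine Set.ssubset_iff_exists.2 ⟨Set.inter_subset_inter_right _ (Set.Iio_subset_Iio h.le),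
    v, ⟨hv, h⟩, fun h' => lt_irrefl _ (Set.mem_Iio.1 h'.2)⟩

/-- A point off `M` lies between two consecutive elements of `M` if and only if elements of `M`
precede it and follow it; the preceding ones are then counted by the rank of the right end. -/
theorem exists_consec_iff {M : Set ℕ} (hM : M.Finite) {v : ℕ} (hv : v ∉ M) :
    (∃ L R, Consec M L R ∧ L < v ∧ v < R) ↔ 1 ≤ rankIn M v ∧ rankIn M v < M.ncard := by
  constructor
  · rintro ⟨L, R, h, h1, h2⟩
    refine ⟨Nat.one_le_of_lt (rankIn_lt h.1 h1), ?_⟩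
    refine Set.ncard_lt_ncard (Set.ssubset_iff_exists.2 ⟨Set.inter_subset_left, R, h.2.1,
      fun h' => ?_⟩) hM
    exact lt_asymm h2 (Set.mem_Iio.1 h'.2)
  · rintro ⟨h1, h2⟩
    have h3 : (M ∩ Set.Iio v).Nonempty := by
      rw [← Set.ncard_pos (hM.subset Set.inter_subset_left)]
      exact h1
    have h4 : ∃ m ∈ M, v < m := by
      by_contra! hno
      refine h2.not_ge (Set.ncard_le_ncard (fun w hw => ⟨hw, lt_of_le_of_ne (hno w hw) ?_⟩)
        (hM.subset Set.inter_subset_left))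
      rintro rfl
      exact hv hw
    obtain ⟨l, hl, hlv⟩ := h3
    obtain ⟨m, hm, hvm⟩ := h4
    obtain ⟨L, hL, h5, -, h6⟩ := exists_prev hl hlv
    obtain ⟨R, hR, h7, -, h8⟩ := exists_next hm hvm
    refine ⟨L, R, ⟨hL, hR, h5.trans h7, fun s hs h => ?_⟩, h5, h7⟩
    rcases lt_trichotomy s v with h9 | h9 | h9
    · exact h6 s hs ⟨h.1, h9⟩
    · exact hv (h9 ▸ hs)
    · exact h8 s hs ⟨h9, h.2⟩

theorem rankIn_eq_iff_of_consec {M : Set ℕ} {L R v : ℕ} (h : Consec M L R)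
    (hv : v ∉ M) : rankIn M v = rankIn M R ↔ L < v ∧ v < R := by
  have hLR := rankIn_of_consec h
  constructor
  · intro h1
    constructor
    · by_contra h2
      have := rankIn_mono (M := M) (not_lt.1 h2)
      omega
    · by_contra h2
      have h3 : R < v := lt_of_le_of_ne (not_lt.1 h2) fun e => hv (e ▸ h.2.1)
      have := rankIn_lt h.2.1 h3
      omega
  · rintro ⟨h1, h2⟩
    have := rankIn_lt h.1 h1
    have := rankIn_mono (M := M) h2.le
    omega

section Series

variable {x : ℕ → ℝ} {N j : ℕ}

theorem Icc_zero_eq_Iio (hN : 1 ≤ N) : Set.Icc 0 (N - 1) = Set.Iio N := by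
  ext w; simp only [Set.mem_Icc, Set.mem_Iio]; omega

theorem isCompleteBasin_iff {L R : ℕ} :
    IsCompleteBasin x N j L R ↔ Consec (iterMin x j (Set.Iio N)) L R := by
  rw [IsCompleteBasin, minimaOfOrder_eq_iterMin]
  exact Iff.rfl

theorem finite_iterMin_Iio (x : ℕ → ℝ) (j N : ℕ) : (iterMin x j (Set.Iio N)).Finite :=
  (Set.finite_Iio N).subset (iterMin_subset x j _)

theorem lt_order_seriesTree_iff (hx : Function.Injective x) (hN : 1 ≤ N) :
    j < (seriesTree x N).order ↔ (iterMin x j (Set.Iio N)).Nonempty := by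
  rw [seriesTree, lt_order_levelTree_iff hx j (Nat.zero_le _), Icc_zero_eq_Iio hN]

theorem numBranches_seriesTree (hx : Function.Injective x) (hj : 1 ≤ j) (hN : 1 ≤ N) :
    (seriesTree x N).numBranches j = if j ≤ (seriesTree x N).order then
      (iterMin x j (Set.Iio N)).ncard + 1 else 0 := by
  rw [numBranches, seriesTree, (branches_levelTree hx hj (Nat.zero_le _)).1,
    Icc_zero_eq_Iio hN]

theorem numSide_seriesTree (hx : Function.Injective x) {i : ℕ} (hi : 1 ≤ i) (hij : i < j)
    (hN : 1 ≤ N) : (seriesTree x N).numSide i j =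
      {v ∈ Set.Iio N | IsSide x (Set.Iio N) i j v}.ncard := by
  rw [seriesTree, numSide_levelTree hx (Nat.zero_le _) hi hij, sideSet, Icc_zero_eq_Iio hN]

/-- The complete branches are all branches but the first and the last one. The length of the `take`
is one less than the number of local minima, which is one less than the number of branches. -/
theorem completeBranches_eq (hx : Function.Injective x) (hj : 1 ≤ j) (hN : 1 ≤ N) :
    completeBranches x N j = (((seriesTree x N).branches j).tail).take
      ((iterMin x j (Set.Iio N)).ncard - 1) := by
  classical
  refine filter_eq_take_tail fun n s hs => ?_
  obtain ⟨h1, h2, -⟩ := (branches_levelTree hx hj (Nat.zero_le (N - 1))).2 n s hs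
  rw [Icc_zero_eq_Iio hN] at h1 h2
  rw [decide_eq_true_iff, ← h1, ← exists_consec_iff (finite_iterMin_Iio x j N) h2]
  simp only [isCompleteBasin_iff]

theorem length_completeBranches (hx : Function.Injective x) (hj : 1 ≤ j) (hN : 1 ≤ N) :
    (completeBranches x N j).length = (iterMin x j (Set.Iio N)).ncard - 1 := by
  rw [completeBranches_eq hx hj hN, List.length_take, List.length_tail]
  have := numBranches_seriesTree hx hj hN
  rw [numBranches] at this
  rw [this]
  split_ifs with h
  · omega
  · have h0 : iterMin x j (Set.Iio N) = ∅ := by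
      rw [← Set.not_nonempty_iff_eq_empty, ← lt_order_seriesTree_iff hx hN]
      omega
    rw [h0, Set.ncard_empty, Nat.min_self]

/-- The `b`-th complete branch belongs to the `b`-th pair of consecutive local minima, and its
side vertices are those between these minima. -/
theorem sideCount_completeBranches (hx : Function.Injective x) {i b : ℕ} {s : MarkedTree}
    (hi : 1 ≤ i) (hij : i < j) (hN : 1 ≤ N) (h : (completeBranches x N j)[b]? = some s) :
    ∃ L R, Consec (iterMin x j (Set.Iio N)) L R ∧ rankIn (iterMin x j (Set.Iio N)) L = b ∧
      s.sideCount i =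
        {v ∈ Set.Iio N | IsSide x (Set.Iio N) i j v ∧ L < v ∧ v < R}.ncard := by
  have hj : 1 ≤ j := by omega
  rw [completeBranches_eq hx hj hN, List.getElem?_take] at h
  split_ifs at h with hb
  rw [List.getElem?_tail] at h
  obtain ⟨h1, h2, h3⟩ := (branches_levelTree hx hj (Nat.zero_le (N - 1))).2 _ s h
  rw [Icc_zero_eq_Iio hN] at h1 h2
  have hfin := finite_iterMin_Iio x j N
  obtain ⟨L, R, hLR, h4, h5⟩ := (exists_consec_iff hfin h2).2 (by omega)
  have h6 := rankIn_of_consec hLR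
  have h7 := (rankIn_eq_iff_of_consec hLR h2).2 ⟨h4, h5⟩
  refine ⟨L, R, hLR, by omega, ?_⟩
  rw [h3 i hi hij, sideSet, Icc_zero_eq_Iio hN]
  congr 1
  ext v
  constructor
  · rintro ⟨⟨hv, hs⟩, hr⟩
    refine ⟨hv, hs, (rankIn_eq_iff_of_consec hLR
      (hs.not_mem_iterMin hx.injOn hv hij)).1 (by rw [hr]; omega)⟩
  · rintro ⟨hv, hs, hr⟩
    refine ⟨⟨hv, hs⟩, ?_⟩
    have := (rankIn_eq_iff_of_consec hLR (hs.not_mem_iterMin hx.injOn hv hij)).2 hr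
    rw [this]; omega

end Series

/-! ### Enumeration of the local minima -/

/-- The `b`-th element of `S` in increasing order, counted from `0`. -/
noncomputable def enum (S : Set ℕ) (b : ℕ) : ℕ := Nat.nth (· ∈ S) b

theorem rankIn_eq_count (S : Set ℕ) [DecidablePred (· ∈ S)] (v : ℕ) :
    rankIn S v = Nat.count (· ∈ S) v := by
  rw [Nat.count_eq_card_filter_range, rankIn, ← Set.ncard_coe_finset]
  congr 1
  ext w
  simp [and_comm]

theorem enum_rankIn {S : Set ℕ} {v : ℕ} (hv : v ∈ S) : enum S (rankIn S v) = v := by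
  classical
  rw [rankIn_eq_count]
  exact Nat.nth_count (p := (· ∈ S)) hv

theorem enum_strictMono {S : Set ℕ} (hS : S.Infinite) : StrictMono (enum S) :=
  Nat.nth_strictMono hS

theorem enum_mem {S : Set ℕ} (hS : S.Infinite) (b : ℕ) : enum S b ∈ S :=
  Nat.nth_mem_of_infinite hS b

theorem rankIn_enum {S : Set ℕ} (hS : S.Infinite) (b : ℕ) : rankIn S (enum S b) = b := by
  classical
  rw [rankIn_eq_count]
  exact Nat.count_nth_of_infinite (p := (· ∈ S)) hS b

theorem enum_lt_iff {S : Set ℕ} (hS : S.Infinite) {b N : ℕ} : enum S b < N ↔ b < rankIn S N := by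
  classical
  rw [rankIn_eq_count]
  exact (Nat.lt_nth_iff_count_lt (p := (· ∈ S)) hS).symm

theorem image_enum {S : Set ℕ} (hS : S.Infinite) (N : ℕ) :
    enum S '' Set.Iio (rankIn S N) = S ∩ Set.Iio N := by
  ext v
  constructor
  · rintro ⟨b, hb, rfl⟩
    exact ⟨enum_mem hS b, (enum_lt_iff hS).2 hb⟩
  · rintro ⟨hv, hvN⟩
    refine ⟨rankIn S v, ?_, enum_rankIn hv⟩
    rw [Set.mem_Iio, ← enum_lt_iff hS, enum_rankIn hv]
    exact hvN

theorem image_enum_univ {S : Set ℕ} (hS : S.Infinite) : enum S '' Set.univ = S := by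
  ext v
  constructor
  · rintro ⟨b, -, rfl⟩
    exact enum_mem hS b
  · exact fun hv => ⟨rankIn S v, trivial, enum_rankIn hv⟩

/-- The local minima of an initial part of the series are an initial part of the local minima. -/
theorem iterMin_inter_Iio_eq (x : ℕ → ℝ) (S : Set ℕ) (k N : ℕ) :
    ∃ N' ≤ N, iterMin x k (S ∩ Set.Iio N) = iterMin x k S ∩ Set.Iio N' := by
  induction k with
  | zero => exact ⟨N, le_rfl, rfl⟩
  | succ k ih =>
    obtain ⟨N', hN', h⟩ := ih
    have hfin := ((Set.finite_Iio N).inter_of_right S).subset (iterMin_subset x k _)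
    rcases (iterMin x k (S ∩ Set.Iio N)).eq_empty_or_nonempty with h0 | h0
    · refine ⟨0, Nat.zero_le _, ?_⟩
      have h1 : iterMin x (k + 1) (S ∩ Set.Iio N) = ∅ :=
        Set.subset_eq_empty (iterMin_succ_subset x k _) h0
      rw [h1]; simp
    · obtain ⟨M, hM, hmax⟩ := Set.exists_max_image _ id hfin h0
      have hM' : M ∈ iterMin x k S ∩ Set.Iio N' := h ▸ hM
      refine ⟨M, (le_of_lt hM'.2).trans hN', ?_⟩
      rw [iterMin, iterMin, h]
      ext t
      constructor
      · rintro ⟨p, q, h1, h2, h3, h4⟩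
        have hqM : q ≤ M := hmax q (h ▸ h2.2.1)
        refine ⟨⟨p, q, ⟨h1.1.1, h1.2.1.1, h1.2.2.1, fun s hs hh => h1.2.2.2 s
          ⟨hs, hh.2.trans h1.2.1.2⟩ hh⟩, ⟨h2.1.1, h2.2.1.1, h2.2.2.1, fun s hs hh => h2.2.2.2 s
          ⟨hs, hh.2.trans h2.2.1.2⟩ hh⟩, h3, h4⟩, lt_of_lt_of_le h2.2.2.1 hqM⟩
      · rintro ⟨⟨p, q, h1, h2, h3, h4⟩, htM⟩
        have hqM : q ≤ M := by
          by_contra hq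
          exact h2.2.2.2 M hM'.1 ⟨htM, not_le.1 hq⟩
        have hqN : q < N' := lt_of_le_of_lt hqM hM'.2
        have htN : t < N' := lt_trans h2.2.2.1 hqN
        exact ⟨p, q, ⟨⟨h1.1, h1.2.2.1.trans htN⟩, ⟨h1.2.1, htN⟩, h1.2.2.1,
          fun s hs => h1.2.2.2 s hs.1⟩, ⟨⟨h2.1, htN⟩, ⟨h2.2.1, hqN⟩, h2.2.2.1,
          fun s hs => h2.2.2.2 s hs.1⟩, h3, h4⟩

theorem iterMin_Iio_eq (x : ℕ → ℝ) (k N : ℕ) :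
    ∃ N' ≤ N, iterMin x k (Set.Iio N) = iterMin x k Set.univ ∩ Set.Iio N' := by
  simpa using iterMin_inter_Iio_eq x Set.univ k N

theorem iterMin_Iio_mono (x : ℕ → ℝ) (k : ℕ) : Monotone fun N => iterMin x k (Set.Iio N) := by
  intro N M h
  obtain ⟨N', -, h'⟩ := iterMin_inter_Iio_eq x (Set.Iio M) k N
  rw [Set.inter_eq_right.2 (Set.Iio_subset_Iio h)] at h'
  simp only [h']
  exact Set.inter_subset_left

/-- The time of the `b`-th local minimum of order `k` of the infinite series, counted from `0`. It
has a junk value if there are only finitely many. -/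
noncomputable def minTime (x : ℕ → ℝ) (k b : ℕ) : ℕ := enum (iterMin x k Set.univ) b

/-- The number of local minima of order `k` of `x 0, …, x (N - 1)`. -/
noncomputable def minCount (x : ℕ → ℝ) (k N : ℕ) : ℕ := (iterMin x k (Set.Iio N)).ncard

/-- The number of the local minima of order `k` of the infinite series that precede the time
`N`. It can exceed `minCount x k N`, since the future after `N` contributes to it. -/
noncomputable def minRank (x : ℕ → ℝ) (k N : ℕ) : ℕ := rankIn (iterMin x k Set.univ) N

theorem iterMin_Iio_eq_image {x : ℕ → ℝ} {k : ℕ} (hS : (iterMin x k Set.univ).Infinite) (N : ℕ) :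
    iterMin x k (Set.Iio N) = minTime x k '' Set.Iio (minCount x k N) := by
  obtain ⟨N', -, h⟩ := iterMin_Iio_eq x k N
  unfold minTime minCount
  rw [h]
  have h1 := image_enum hS N'
  rw [← h1, Set.ncard_image_of_injective _ (enum_strictMono hS).injective, Set.ncard_Iio_nat]

/-- The number of `a < n` such that `a + 1` is the time of an internal local minimum of `y`. -/
noncomputable def valleys (y : ℕ → ℝ) (n : ℕ) : ℕ :=
  {a ∈ Set.Iio n | y (a + 1) < y a ∧ y (a + 1) < y (a + 2)}.ncard

/-- The first internal time is `1`: hence the shift by `Nat.succ`, and `c - 2` internal times. -/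
theorem locMin_Iio (y : ℕ → ℝ) (c : ℕ) : locMin y (Set.Iio c) =
    Nat.succ '' {a ∈ Set.Iio (c - 2) | y (a + 1) < y a ∧ y (a + 1) < y (a + 2)} := by
  ext t
  constructor
  · rintro ⟨p, q, h1, h2, h3, h4⟩
    obtain ⟨hp, ht, hpt, hpno⟩ := h1
    obtain ⟨-, hq, htq, hqno⟩ := h2
    rw [Set.mem_Iio] at hp ht hq
    have e1 : t = p + 1 := by
      by_contra hne
      exact hpno (p + 1) (by rw [Set.mem_Iio]; omega) ⟨by omega, by omega⟩
    have e2 : q = t + 1 := by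
      by_contra hne
      exact hqno (t + 1) (by rw [Set.mem_Iio]; omega) ⟨by omega, by omega⟩
    subst e1 e2
    exact ⟨p, ⟨by rw [Set.mem_Iio]; omega, h3, h4⟩, rfl⟩
  · rintro ⟨a, ⟨ha, h1, h2⟩, rfl⟩
    rw [Set.mem_Iio] at ha
    refine ⟨a, a + 2, ⟨?_, ?_, by omega, fun s _ => by omega⟩,
      ⟨?_, ?_, by omega, fun s _ => by omega⟩, h1, h2⟩ <;> rw [Set.mem_Iio] <;> omega

theorem locMin_univ (y : ℕ → ℝ) : locMin y Set.univ =
    Nat.succ '' {a | y (a + 1) < y a ∧ y (a + 1) < y (a + 2)} := by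
  ext t
  constructor
  · rintro ⟨p, q, ⟨-, -, hpt, hpno⟩, ⟨-, -, htq, hqno⟩, h3, h4⟩
    have e1 : t = p + 1 := by
      by_contra hne
      exact hpno (p + 1) trivial ⟨by omega, by omega⟩
    have e2 : q = t + 1 := by
      by_contra hne
      exact hqno (t + 1) trivial ⟨by omega, by omega⟩
    subst e1 e2
    exact ⟨p, ⟨h3, h4⟩, rfl⟩
  · rintro ⟨a, ⟨h1, h2⟩, rfl⟩
    exact ⟨a, a + 2, ⟨trivial, trivial, by omega, fun s _ => by omega⟩,
      ⟨trivial, trivial, by omega, fun s _ => by omega⟩, h1, h2⟩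

theorem minTime_strictMono {x : ℕ → ℝ} {k : ℕ} (hS : (iterMin x k Set.univ).Infinite) :
    StrictMono (minTime x k) := enum_strictMono hS

/-- The local minima of order `k + 1` are the valleys of the series of those of order `k`. -/
theorem minCount_succ {x : ℕ → ℝ} {k : ℕ} (hS : (iterMin x k Set.univ).Infinite) (N : ℕ) :
    minCount x (k + 1) N = valleys (x ∘ minTime x k) (minCount x k N - 2) := by
  have hm := minTime_strictMono hS
  have h1 : iterMin x (k + 1) (Set.Iio N) = minTime x k ''
      locMin (x ∘ minTime x k) (Set.Iio (minCount x k N)) := by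
    rw [iterMin, iterMin_Iio_eq_image hS]
    exact iterMin_image (k := 1) (hm.strictMonoOn _) fun a _ b _ => Iff.rfl
  rw [minCount, h1, Set.ncard_image_of_injective _ hm.injective, locMin_Iio,
    Set.ncard_image_of_injective _ Nat.succ_injective]
  rfl

theorem minRank_succ {x : ℕ → ℝ} {k : ℕ} (hS : (iterMin x k Set.univ).Infinite) (N : ℕ) :
    minRank x (k + 1) N = valleys (x ∘ minTime x k) (minRank x k N - 1) := by
  have hm := minTime_strictMono hS
  have h1 : iterMin x (k + 1) Set.univ = minTime x k ''
      locMin (x ∘ minTime x k) Set.univ := by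
    rw [iterMin]
    conv_lhs => rw [← image_enum_univ hS]
    exact iterMin_image (k := 1) (hm.strictMonoOn _) fun a _ b _ => Iff.rfl
  have h2 : iterMin x (k + 1) Set.univ ∩ Set.Iio N = minTime x k '' (Nat.succ ''
      {a ∈ Set.Iio (minRank x k N - 1) | (x ∘ minTime x k) (a + 1) < (x ∘ minTime x k) a ∧
        (x ∘ minTime x k) (a + 1) < (x ∘ minTime x k) (a + 2)}) := by
    rw [h1, locMin_univ]
    ext v
    constructor
    · rintro ⟨⟨_, ⟨a, ha, rfl⟩, rfl⟩, hv⟩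
      have : a.succ < minRank x k N := (enum_lt_iff hS).1 hv
      exact ⟨_, ⟨a, ⟨by rw [Set.mem_Iio]; omega, ha⟩, rfl⟩, rfl⟩
    · rintro ⟨_, ⟨a, ⟨ha, ha'⟩, rfl⟩, rfl⟩
      rw [Set.mem_Iio] at ha
      exact ⟨⟨_, ⟨a, ha', rfl⟩, rfl⟩, (enum_lt_iff hS).2 (by rw [← minRank]; omega)⟩
  rw [minRank, rankIn, h2, Set.ncard_image_of_injective _ hm.injective,
    Set.ncard_image_of_injective _ Nat.succ_injective]
  rfl

theorem consec_image_Iio {t : ℕ → ℕ} (ht : StrictMono t) {c p q : ℕ} :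
    Consec (t '' Set.Iio c) p q ↔ ∃ b, b + 1 < c ∧ t b = p ∧ t (b + 1) = q := by
  constructor
  · intro h
    obtain ⟨b, hb, rfl⟩ := h.1
    obtain ⟨d, hd, rfl⟩ := h.2.1
    have hbd := ht.lt_iff_lt.1 h.2.2.1
    rw [Set.mem_Iio] at hd
    have : d = b + 1 := by
      by_contra hne
      exact h.2.2.2 (t (b + 1)) ⟨b + 1, by rw [Set.mem_Iio]; omega, rfl⟩
        ⟨ht (by omega), ht (by omega)⟩
    subst this
    exact ⟨b, hd, rfl, rfl⟩
  · rintro ⟨b, hb, rfl, rfl⟩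
    refine ⟨⟨b, by rw [Set.mem_Iio]; omega, rfl⟩, ⟨b + 1, hb, rfl⟩, ht (by omega), ?_⟩
    rintro _ ⟨s, -, rfl⟩ ⟨h1, h2⟩
    have h1 := ht.lt_iff_lt.1 h1
    have h2 := ht.lt_iff_lt.1 h2
    omega

/-! ### Counting vertices by the orders of their children -/

/-- The vertices with children of order at least `r` on the left and `s` on the right. -/
def pairSet (x : ℕ → ℝ) (N r s : ℕ) : Set ℕ :=
  {v ∈ Set.Iio N | LO x (Set.Iio N) r v ∧ RO x (Set.Iio N) s v}

theorem pairSet_self {x : ℕ → ℝ} (hx : Function.Injective x) (N r : ℕ) :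
    pairSet x N r r = iterMin x r (Set.Iio N) := by
  ext v
  constructor
  · rintro ⟨hv, h⟩
    exact (mem_iterMin_iff hx.injOn hv).2 h
  · intro h
    have hv := iterMin_subset x r _ h
    exact ⟨hv, (mem_iterMin_iff hx.injOn hv).1 h⟩

/-- The vertices with child orders at least `r` and `r + 1` are the local minima of order `r` that
are followed by a higher one. -/
theorem ncard_pairSet_succ_right {x : ℕ → ℝ} (hx : Function.Injective x) {r : ℕ}
    (hS : (iterMin x r Set.univ).Infinite) (N : ℕ) : (pairSet x N r (r + 1)).ncard =
      {b ∈ Set.Iio (minCount x r N - 1) | x (minTime x r b) < x (minTime x r (b + 1))}.ncard := by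
  have hm := minTime_strictMono hS
  refine Eq.trans ?_ (Set.ncard_image_of_injective _ hm.injective)
  congr 1
  ext v
  constructor
  · rintro ⟨hv, h1, h2⟩
    have h3 := (mem_iterMin_iff hx.injOn hv).2 ⟨h1, RO_of_succ h2⟩
    obtain ⟨q, h4, h5⟩ := (RO_succ_iff_next hx.injOn h3).1 h2
    rw [iterMin_Iio_eq_image hS, consec_image_Iio hm] at h4
    obtain ⟨b, hb, rfl, rfl⟩ := h4
    exact ⟨b, ⟨by rw [Set.mem_Iio]; omega, h5⟩, rfl⟩
  · rintro ⟨b, ⟨hb, h⟩, rfl⟩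
    rw [Set.mem_Iio] at hb
    have h3 : minTime x r b ∈ iterMin x r (Set.Iio N) := by
      rw [iterMin_Iio_eq_image hS]
      exact ⟨b, by rw [Set.mem_Iio]; omega, rfl⟩
    have hv := iterMin_subset x r _ h3
    refine ⟨hv, ((mem_iterMin_iff hx.injOn hv).1 h3).1, (RO_succ_iff_next hx.injOn h3).2
      ⟨minTime x r (b + 1), ?_, h⟩⟩
    rw [iterMin_Iio_eq_image hS, consec_image_Iio hm]
    exact ⟨b, by omega, rfl, rfl⟩

theorem ncard_pairSet_succ_left {x : ℕ → ℝ} (hx : Function.Injective x) {r : ℕ}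
    (hS : (iterMin x r Set.univ).Infinite) (N : ℕ) : (pairSet x N (r + 1) r).ncard =
      {b ∈ Set.Iio (minCount x r N - 1) | x (minTime x r (b + 1)) < x (minTime x r b)}.ncard := by
  have hm := minTime_strictMono hS
  refine Eq.trans ?_ (Set.ncard_image_of_injective (f := fun b => minTime x r (b + 1)) _
    fun a b h => Nat.succ_injective (hm.injective h))
  congr 1
  ext v
  constructor
  · rintro ⟨hv, h1, h2⟩
    have h3 := (mem_iterMin_iff hx.injOn hv).2 ⟨LO_mono r.le_succ h1, h2⟩
    obtain ⟨q, h4, h5⟩ := (LO_succ_iff_prev hx.injOn h3).1 h1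
    rw [iterMin_Iio_eq_image hS, consec_image_Iio hm] at h4
    obtain ⟨b, hb, rfl, rfl⟩ := h4
    exact ⟨b, ⟨by rw [Set.mem_Iio]; omega, h5⟩, rfl⟩
  · rintro ⟨b, ⟨hb, h⟩, rfl⟩
    rw [Set.mem_Iio] at hb
    have h3 : minTime x r (b + 1) ∈ iterMin x r (Set.Iio N) := by
      rw [iterMin_Iio_eq_image hS]
      exact ⟨b + 1, by rw [Set.mem_Iio]; omega, rfl⟩
    have hv := iterMin_subset x r _ h3
    refine ⟨hv, (LO_succ_iff_prev hx.injOn h3).2 ⟨minTime x r b, ?_, h⟩,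
      ((mem_iterMin_iff hx.injOn hv).1 h3).2⟩
    rw [iterMin_Iio_eq_image hS, consec_image_Iio hm]
    exact ⟨b, by omega, rfl, rfl⟩

/-! ### Side vertices between consecutive local minima -/

/-- The number of side vertices of type `(i, j)` between the times `L` and `R`, computed from the
part of the series between these times. -/
noncomputable def basinSide (i j L R : ℕ) (x : ℕ → ℝ) : ℕ :=
  {v ∈ Set.Ioo L R | x L < x v ∧ x R < x v ∧ IsSide x (Set.Ioo L R) i j v}.ncard

theorem basinSide_le (i j L R : ℕ) (x : ℕ → ℝ) : basinSide i j L R x ≤ R - L := by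
  refine (Set.ncard_le_ncard (Set.sep_subset _ _) (Set.finite_Ioo L R)).trans ?_
  rw [← Finset.coe_Ioo, Set.ncard_coe_finset, Nat.card_Ioo]
  omega

theorem ncard_isSide_between {x : ℕ → ℝ} (hx : Function.Injective x) {i j N L R : ℕ}
    (hij : i < j) (h : Consec (iterMin x j (Set.Iio N)) L R) :
    {v ∈ Set.Iio N | IsSide x (Set.Iio N) i j v ∧ L < v ∧ v < R}.ncard =
      basinSide i j L R x := by
  have hR : R < N := Set.mem_Iio.1 (iterMin_subset x j _ h.2.1)
  have hIoo : Set.Iio N ∩ Set.Ioo L R = Set.Ioo L R :=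
    Set.inter_eq_right.2 fun w hw => lt_trans hw.2 hR
  have key : ∀ v, L < v → v < R → (IsSide x (Set.Iio N) i j v ↔
      x L < x v ∧ x R < x v ∧ IsSide x (Set.Ioo L R) i j v) := fun v h1 h2 => by
    rw [isSide_iff_Ioo hx.injOn hij h (Set.mem_Iio.2 (h2.trans hR)) h1 h2, hIoo]
  unfold basinSide
  congr 1
  ext v
  constructor
  · rintro ⟨-, h1, h2, h3⟩
    exact ⟨⟨h2, h3⟩, (key v h2 h3).1 h1⟩
  · rintro ⟨⟨h2, h3⟩, h1⟩
    exact ⟨h3.trans hR, (key v h2 h3).2 h1, h2, h3⟩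

/-- The side vertices are those between consecutive local minima of order `j`, up to those
before the first and those after the last of these minima. -/
theorem ncard_isSide_bounds {x : ℕ → ℝ} (hx : Function.Injective x) {i j N : ℕ} (hij : i < j)
    (hS : (iterMin x j Set.univ).Infinite) {c : ℕ} (hc : minCount x j N = c + 1) :
    (∑ b ∈ Finset.range c, basinSide i j (minTime x j b) (minTime x j (b + 1)) x) ≤
      {v ∈ Set.Iio N | IsSide x (Set.Iio N) i j v}.ncard ∧
    {v ∈ Set.Iio N | IsSide x (Set.Iio N) i j v}.ncard ≤ minTime x j 0 +
      (∑ b ∈ Finset.range c, basinSide i j (minTime x j b) (minTime x j (b + 1)) x) +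
      (N - minTime x j c) := by
  have hm := minTime_strictMono hS
  have himg := iterMin_Iio_eq_image hS N
  set A := {v ∈ Set.Iio N | IsSide x (Set.Iio N) i j v} with hA
  have hAfin : A.Finite := (Set.finite_Iio N).subset (Set.sep_subset _ _)
  have hnot : ∀ b < c + 1, minTime x j b ∉ A := fun b hb hmem =>
    hmem.2.not_mem_iterMin hx.injOn hmem.1 hij (himg ▸ ⟨b, by rw [hc]; exact hb, rfl⟩)
  have hsing : ∀ b < c + 1, (A ∩ {minTime x j b}).ncard = 0 := fun b hb => by
    rw [Set.inter_singleton_eq_empty.2 (hnot b hb), Set.ncard_empty]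
  have hstep : ∀ n ≤ c, (A ∩ Set.Iio (minTime x j n)).ncard =
      (A ∩ Set.Iio (minTime x j 0)).ncard +
      ∑ b ∈ Finset.range n, basinSide i j (minTime x j b) (minTime x j (b + 1)) x := by
    intro n hn
    induction n with
    | zero => simp
    | succ n ih =>
      rw [Finset.sum_range_succ, ← add_assoc, ← ih (by omega),
        ncard_split (hAfin.subset Set.inter_subset_left) (minTime x j n)]
      have hlt : minTime x j n < minTime x j (n + 1) := hm (Nat.lt_add_one n)
      have h1 : A ∩ Set.Iio (minTime x j (n + 1)) ∩ Set.Iio (minTime x j n) =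
          A ∩ Set.Iio (minTime x j n) := by
        rw [Set.inter_assoc, Set.inter_eq_right.2 (Set.Iio_subset_Iio hlt.le)]
      have h2 : A ∩ Set.Iio (minTime x j (n + 1)) ∩ {minTime x j n} = ∅ :=
        Set.inter_singleton_eq_empty.2 fun h => hnot n (by omega) h.1
      have h3 : A ∩ Set.Iio (minTime x j (n + 1)) ∩ Set.Ioi (minTime x j n) =
          {v ∈ Set.Iio N | IsSide x (Set.Iio N) i j v ∧ minTime x j n < v ∧
            v < minTime x j (n + 1)} := by
        ext v
        constructor
        · rintro ⟨⟨⟨h4, h5⟩, h6⟩, h7⟩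
          exact ⟨h4, h5, h7, h6⟩
        · rintro ⟨h4, h5, h7, h6⟩
          exact ⟨⟨⟨h4, h5⟩, h6⟩, h7⟩
      rw [h1, h2, Set.ncard_empty, add_zero, h3, ncard_isSide_between hx hij]
      rw [himg, consec_image_Iio hm]
      exact ⟨n, by omega, rfl, rfl⟩
  have htot := ncard_split hAfin (minTime x j c)
  rw [hsing c (by omega), hstep c le_rfl] at htot
  have hfirst : (A ∩ Set.Iio (minTime x j 0)).ncard ≤ minTime x j 0 := by
    refine (Set.ncard_le_ncard Set.inter_subset_right (Set.finite_Iio _)).trans ?_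
    rw [Set.ncard_Iio_nat]
  have hlast : (A ∩ Set.Ioi (minTime x j c)).ncard ≤ N - minTime x j c := by
    refine (Set.ncard_le_ncard (t := Set.Ioo (minTime x j c) N) (fun w hw => ⟨hw.2, hw.1.1⟩)
      (Set.finite_Ioo _ _)).trans ?_
    rw [← Finset.coe_Ioo, Set.ncard_coe_finset, Nat.card_Ioo]
    omega
  omega

/-- The basins are disjoint parts of the series, so that they contain at most as many side vertices
as times. -/
theorem sum_basinSide_le {x : ℕ → ℝ} {i j : ℕ} (hS : (iterMin x j Set.univ).Infinite) (n : ℕ) :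
    ∑ b ∈ Finset.range n, basinSide i j (minTime x j b) (minTime x j (b + 1)) x ≤
      minTime x j n := by
  have hm := minTime_strictMono hS
  induction n with
  | zero => simp
  | succ n ih =>
    rw [Finset.sum_range_succ]
    have h1 := basinSide_le i j (minTime x j n) (minTime x j (n + 1)) x
    have h2 := hm (Nat.lt_add_one n)
    omega

/-- The complete branches in terms of the enumeration of the local minima of the infinite
series. -/
theorem sideCount_completeBranches_eq {x : ℕ → ℝ} (hx : Function.Injective x) {i j N b : ℕ}
    {s : MarkedTree} (hi : 1 ≤ i) (hij : i < j) (hS : (iterMin x j Set.univ).Infinite)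
    (h : (completeBranches x N j)[b]? = some s) :
    s.sideCount i = basinSide i j (minTime x j b) (minTime x j (b + 1)) x := by
  rcases Nat.eq_zero_or_pos N with rfl | hN
  · -- without values there are no basins
    exfalso
    have hs := List.mem_of_getElem? h
    classical
    obtain ⟨-, h2⟩ := List.mem_filter.1 hs
    obtain ⟨L, R, hLR, -⟩ := of_decide_eq_true h2
    exact absurd (iterMin_subset x j _ (isCompleteBasin_iff.1 hLR).1) (Nat.not_lt_zero L)
  obtain ⟨L, R, hLR, hr, hs⟩ := sideCount_completeBranches hx hi hij hN h
  have hm := minTime_strictMono hS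
  rw [hs, ncard_isSide_between hx hij hLR]
  have himg := iterMin_Iio_eq_image hS N
  obtain ⟨d, hd, rfl, rfl⟩ := (consec_image_Iio hm).1 (himg ▸ hLR)
  have : d = b := by
    obtain ⟨N', -, h'⟩ := iterMin_Iio_eq x j N
    have h1 : minTime x j d < N' := by
      have := hLR.1
      rw [h'] at this
      exact this.2
    rw [h', rankIn_of_le (M := iterMin x j Set.univ ∩ Set.Iio N') (t := N')
      (M' := iterMin x j Set.univ ∩ Set.Iio N')
      (by rw [Set.inter_assoc, Set.inter_self]) h1.le,
      ← rankIn_of_le (M := iterMin x j Set.univ) rfl h1.le] at hr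
    rw [← hr]
    exact (rankIn_enum hS d).symm
  rw [this]

/-! ### Symmetric random walks -/

section Walk

variable {Ω : Type*}

/-- The path up to the time `n`. -/
def past (X : ℕ → Ω → ℝ) (n : ℕ) (ω : Ω) : ℕ → ℝ := fun k => X (min k n) ω

/-- The path from the time `n` on, relative to its position at that time. -/
def future (X : ℕ → Ω → ℝ) (n : ℕ) (ω : Ω) : ℕ → ℝ := fun k => X (n + k) ω - X n ω

/-- The initial value, followed by the increments. -/
def steps (X : ℕ → Ω → ℝ) : ℕ → Ω → ℝ
  | 0 => X 0
  | n + 1 => fun ω => X (n + 1) ω - X n ω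

theorem sum_steps (X : ℕ → Ω → ℝ) (n k : ℕ) (ω : Ω) :
    ∑ l ∈ Finset.range k, steps X (n + l + 1) ω = future X n ω k := by
  induction k with
  | zero => simp [future]
  | succ k ih =>
    rw [Finset.sum_range_succ, ih, steps, future, future, add_assoc]
    ring

variable [MeasurableSpace Ω]

/-- The σ-algebra generated by the path up to the time `n`. -/
abbrev pastAlgebra (X : ℕ → Ω → ℝ) (n : ℕ) : MeasurableSpace Ω :=
  ⨆ k : ℕ, ⨆ _ : k ≤ n, MeasurableSpace.comap (X k) inferInstance

/-- The properties of a homogeneous symmetric Markov chain that the proof uses: the future is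
independent of the past and has the same law at all times, the reversed path has the law of the
path, and no two values coincide. -/
structure IsSymmWalk (P : Measure Ω) (X : ℕ → Ω → ℝ) : Prop where
  measurable : ∀ n, Measurable (X n)
  map_future : ∀ n, P.map (future X n) = P.map (future X 0)
  indep : ∀ n, IndepFun (past X n) (future X n) P
  reversal : ∀ n, P.map (fun ω k => X (n - min k n) ω - X n ω) =
    P.map (fun ω k => X (min k n) ω - X 0 ω)
  inj : ∀ᵐ ω ∂P, Function.Injective (fun n => X n ω)

theorem measurable_past {X : ℕ → Ω → ℝ} (hX : ∀ n, Measurable (X n)) (n : ℕ) :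
    Measurable (past X n) := measurable_pi_iff.2 fun k => hX (min k n)

theorem measurable_future {X : ℕ → Ω → ℝ} (hX : ∀ n, Measurable (X n)) (n : ℕ) :
    Measurable (future X n) := measurable_pi_iff.2 fun k => (hX (n + k)).sub (hX n)

/-- It suffices to test independence of a sequence on its initial segments. -/
theorem iIndepFun_of_range {β : Type*} [MeasurableSpace β] {P : Measure Ω} [IsProbabilityMeasure P]
    {Y : ℕ → Ω → β} (h : ∀ (m : ℕ) (A : ℕ → Set β), (∀ k, MeasurableSet (A k)) →
      P (⋂ k ∈ Finset.range m, Y k ⁻¹' A k) = ∏ k ∈ Finset.range m, P (Y k ⁻¹' A k)) :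
    iIndepFun Y P := by
  classical
  rw [iIndepFun_iff_measure_inter_preimage_eq_mul]
  intro S A hA
  obtain ⟨m, hm⟩ : ∃ m, S ⊆ Finset.range m := S.exists_nat_subset_range
  have h1 := h m (fun k => if k ∈ S then A k else Set.univ) fun k => by
    split_ifs with hk
    · exact hA k hk
    · exact MeasurableSet.univ
  have h2 : (⋂ k ∈ Finset.range m, Y k ⁻¹' (if k ∈ S then A k else Set.univ)) =
      ⋂ k ∈ S, Y k ⁻¹' A k := by
    ext ω
    simp only [Set.mem_iInter, Set.mem_preimage]
    constructor
    · intro h k hk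
      have := h k (hm hk)
      rwa [if_pos hk] at this
    · intro h k _
      split_ifs with hk
      · exact h k hk
      · trivial
  rw [h2] at h1
  rw [h1, ← Finset.prod_subset hm]
  · exact Finset.prod_congr rfl fun k hk => by rw [if_pos hk]
  · intro k _ hk
    rw [if_neg hk, Set.preimage_univ, measure_univ]

variable {P : Measure Ω} [IsProbabilityMeasure P] {κ : Kernel ℝ ℝ} [IsMarkovKernel κ]
  {X : ℕ → Ω → ℝ}

/-- The Markov property for the whole past, as a disintegration of a joint law. -/
theorem IsMarkovChain.map_past_next (hX : IsMarkovChain P κ X) (n : ℕ) :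
    P.map (fun ω => (past X n ω, X (n + 1) ω)) =
      (P.map (past X n)) ⊗ₘ (κ.comap (fun y : ℕ → ℝ => y n) (measurable_pi_apply n)) := by
  have hp := measurable_past hX.measurable n
  have hm : Measurable (fun ω => (past X n ω, X (n + 1) ω)) := hp.prodMk (hX.measurable _)
  have hmle : pastAlgebra X n ≤ ‹MeasurableSpace Ω› :=
    iSup_le fun k => iSup_le fun _ => (hX.measurable k).comap_le
  have : IsProbabilityMeasure (P.map (fun ω => (past X n ω, X (n + 1) ω))) :=
    Measure.isProbabilityMeasure_map hm.aemeasurable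
  have hpm : Measurable[pastAlgebra X n] (past X n) := by
    refine @measurable_pi_lambda Ω ℕ _ (pastAlgebra X n) _ _ fun k => ?_
    refine (comap_measurable (X (min k n))).mono ?_ le_rfl
    exact le_iSup_of_le (min k n) (le_iSup_of_le (min_le_right k n) le_rfl)
  refine Measure.ext_prod fun {A B} hA hB => ?_
  rw [Measure.map_apply hm (hA.prod hB), Measure.compProd_apply_prod hA hB,
    setLIntegral_map hA (Kernel.measurable_coe _ hB) hp]
  have hs : MeasurableSet[pastAlgebra X n] (past X n ⁻¹' A) := hpm hA
  have hs' : MeasurableSet (past X n ⁻¹' A) := hmle _ hs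
  have hB' : MeasurableSet (X (n + 1) ⁻¹' B) := hX.measurable (n + 1) hB
  have h1 : ∫ ω in past X n ⁻¹' A, (X (n + 1) ⁻¹' B).indicator (fun _ => (1 : ℝ)) ω ∂P =
      ∫ ω in past X n ⁻¹' A, (κ (X n ω)).real B ∂P := by
    rw [← setIntegral_condExp hmle ((integrable_const (1 : ℝ)).indicator hB') hs]
    exact integral_congr_ae (ae_restrict_of_ae (hX.condExp_next n B hB))
  rw [integral_indicator_const (1 : ℝ) hB', smul_eq_mul, mul_one,
    measureReal_restrict_apply hB'] at h1
  have h2 : (∫⁻ ω in past X n ⁻¹' A, (κ (X n ω)) B ∂P) =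
      ENNReal.ofReal (∫ ω in past X n ⁻¹' A, (κ (X n ω)).real B ∂P) := by
    have hmk : Measurable fun ω => (κ (X n ω)).real B :=
      ((Kernel.measurable_coe κ hB).comp (hX.measurable n)).ennreal_toReal
    rw [ofReal_integral_eq_lintegral_ofReal]
    · exact lintegral_congr fun ω => by rw [ofReal_measureReal]
    · exact Integrable.of_bound hmk.aestronglyMeasurable 1 (Eventually.of_forall fun ω => by
        rw [Real.norm_of_nonneg measureReal_nonneg]; exact measureReal_le_one)
    · exact Eventually.of_forall fun ω => measureReal_nonneg
  have h3 : (fun ω => (past X n ω, X (n + 1) ω)) ⁻¹' A ×ˢ B =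
      X (n + 1) ⁻¹' B ∩ past X n ⁻¹' A := by
    ext ω; exact and_comm
  rw [h3, ← ofReal_measureReal, h1, ← h2]
  refine lintegral_congr fun ω => ?_
  rw [Kernel.comap_apply, past, min_self]

/-- The increments of a homogeneous chain are independent of the past. -/
theorem IsMarkovChain.map_past_increment (hX : IsMarkovChain P κ X)
    (hhom : IsHomogeneousKernel κ) (n : ℕ) :
    P.map (fun ω => (past X n ω, X (n + 1) ω - X n ω)) = (P.map (past X n)).prod (κ 0) := by
  have hp := measurable_past hX.measurable n
  have hf : Measurable (fun q : (ℕ → ℝ) × ℝ => (q.1, q.2 - q.1 n)) :=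
    measurable_fst.prodMk (measurable_snd.sub ((measurable_pi_apply n).comp measurable_fst))
  have h1 : (fun ω => (past X n ω, X (n + 1) ω - X n ω)) =
      (fun q : (ℕ → ℝ) × ℝ => (q.1, q.2 - q.1 n)) ∘ fun ω => (past X n ω, X (n + 1) ω) := by
    ext ω
    · rfl
    · simp [past]
  have : IsProbabilityMeasure (P.map (past X n)) := Measure.isProbabilityMeasure_map hp.aemeasurable
  rw [h1, ← Measure.map_map hf (hp.prodMk (hX.measurable _)), hX.map_past_next n]
  have : IsProbabilityMeasure (((P.map (past X n)) ⊗ₘ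
      (κ.comap (fun y : ℕ → ℝ => y n) (measurable_pi_apply n))).map
      (fun q : (ℕ → ℝ) × ℝ => (q.1, q.2 - q.1 n))) :=
    Measure.isProbabilityMeasure_map hf.aemeasurable
  refine Measure.ext_prod fun {A B} hA hB => ?_
  rw [Measure.map_apply hf (hA.prod hB), Measure.compProd_apply (hf (hA.prod hB)),
    Measure.prod_prod]
  have h2 : ∀ y : ℕ → ℝ, (κ.comap (fun y : ℕ → ℝ => y n) (measurable_pi_apply n)) y
      (Prod.mk y ⁻¹' ((fun q : (ℕ → ℝ) × ℝ => (q.1, q.2 - q.1 n)) ⁻¹' A ×ˢ B)) =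
      A.indicator (fun _ => κ 0 B) y := by
    intro y
    rw [Kernel.comap_apply, hhom (y n), Measure.map_apply (measurable_const_add _)
      (measurable_prodMk_left (hf (hA.prod hB)))]
    by_cases hy : y ∈ A
    · rw [Set.indicator_of_mem hy]
      congr 1
      ext z
      simp [hy]
    · rw [Set.indicator_of_notMem hy]
      convert measure_empty (μ := κ 0)
      ext z
      simp [hy]
  rw [lintegral_congr h2, lintegral_indicator_const hA, mul_comm]

theorem measurable_steps {X : ℕ → Ω → ℝ} (hX : ∀ n, Measurable (X n)) (n : ℕ) :
    Measurable (steps X n) := by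
  cases n with
  | zero => exact hX 0
  | succ n => exact (hX (n + 1)).sub (hX n)

theorem IsMarkovChain.map_steps (hX : IsMarkovChain P κ X) (hhom : IsHomogeneousKernel κ)
    (n : ℕ) : P.map (steps X (n + 1)) = κ 0 := by
  have hp := measurable_past hX.measurable n
  have : IsProbabilityMeasure (P.map (past X n)) := Measure.isProbabilityMeasure_map hp.aemeasurable
  have h := congrArg (Measure.map Prod.snd) (hX.map_past_increment hhom n)
  have hm : Measurable (fun ω => (past X n ω, X (n + 1) ω - X n ω)) :=
    hp.prodMk ((hX.measurable (n + 1)).sub (hX.measurable n))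
  rw [Measure.map_map measurable_snd hm, Measure.map_snd_prod, measure_univ, one_smul] at h
  exact h

theorem IsMarkovChain.iIndepFun_steps (hX : IsMarkovChain P κ X)
    (hhom : IsHomogeneousKernel κ) : iIndepFun (steps X) P := by
  refine iIndepFun_of_range fun m A hA => ?_
  induction m with
  | zero => simp
  | succ m ih =>
    rw [Finset.prod_range_succ, ← ih, Finset.range_add_one, Finset.set_biInter_insert,
      Set.inter_comm]
    cases m with
    | zero => simp
    | succ n =>
      have hp := measurable_past hX.measurable n
      -- the event that concerns the first increments, as an event about the past
      let D : (ℕ → ℝ) → ℕ → ℝ := fun y k => steps (fun l (z : ℕ → ℝ) => z l) k y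
      have hD : ∀ k, Measurable fun y => D y k :=
        fun k => measurable_steps (fun k => measurable_pi_apply k) k
      have hset : (⋂ k ∈ Finset.range (n + 1), steps X k ⁻¹' A k) =
          past X n ⁻¹' (⋂ k ∈ Finset.range (n + 1), (fun y => D y k) ⁻¹' A k) := by
        ext ω
        simp only [Set.mem_iInter, Set.mem_preimage, Finset.mem_range]
        refine forall₂_congr fun k hk => ?_
        have : D (past X n ω) k = steps X k ω := by
          cases k with
          | zero => simp [D, steps, past]
          | succ k =>
            simp only [D, steps, past]
            rw [min_eq_left (by omega), min_eq_left (by omega)]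
        rw [this]
      have hmeas : MeasurableSet (⋂ k ∈ Finset.range (n + 1), (fun y => D y k) ⁻¹' A k) :=
        Finset.measurableSet_biInter _ fun k _ => hD k (hA k)
      have : IsProbabilityMeasure (P.map (past X n)) :=
        Measure.isProbabilityMeasure_map hp.aemeasurable
      have h := congrArg (fun ν => ν ((⋂ k ∈ Finset.range (n + 1), (fun y => D y k) ⁻¹' A k) ×ˢ
        A (n + 1))) (hX.map_past_increment hhom n)
      have hm : Measurable (fun ω => (past X n ω, X (n + 1) ω - X n ω)) :=
        hp.prodMk ((hX.measurable (n + 1)).sub (hX.measurable n))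
      rw [Measure.map_apply hm (hmeas.prod (hA _)), Measure.prod_prod,
        Measure.map_apply hp hmeas] at h
      rw [hset, ← Measure.map_apply (measurable_steps hX.measurable (n + 1)) (hA _),
        hX.map_steps hhom n, ← h]
      rfl

/-- The path with given increments. -/
def pathOf (u : ℕ → ℝ) : ℕ → ℝ := fun k => ∑ l ∈ Finset.range k, u l

theorem measurable_pathOf : Measurable pathOf :=
  measurable_pi_iff.2 fun _ => Finset.measurable_fun_sum _ fun l _ => measurable_pi_apply l

theorem IsMarkovChain.map_steps_seq (hX : IsMarkovChain P κ X) (hhom : IsHomogeneousKernel κ)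
    (n : ℕ) : P.map (fun ω l => steps X (n + l + 1) ω) = Measure.infinitePi fun _ : ℕ => κ 0 := by
  have h := (hX.iIndepFun_steps hhom).precomp (g := fun l => n + l + 1)
    (fun a b h => by simpa using h)
  rw [iIndepFun_iff_map_fun_eq_infinitePi_map
    fun l => measurable_steps hX.measurable (n + l + 1)] at h
  rw [h]
  congr 1
  ext1 l
  exact hX.map_steps hhom (n + l)

theorem IsMarkovChain.map_future (hX : IsMarkovChain P κ X) (hhom : IsHomogeneousKernel κ)
    (n : ℕ) : P.map (future X n) = (Measure.infinitePi fun _ : ℕ => κ 0).map pathOf := by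
  rw [← hX.map_steps_seq hhom n, Measure.map_map measurable_pathOf
    (measurable_pi_iff.2 fun l => measurable_steps hX.measurable (n + l + 1))]
  congr 1
  ext ω k
  exact (sum_steps X n k ω).symm

theorem IsMarkovChain.indep_past_future (hX : IsMarkovChain P κ X)
    (hhom : IsHomogeneousKernel κ) (n : ℕ) : IndepFun (past X n) (future X n) P := by
  have hm := measurable_steps hX.measurable
  have h := indep_iSup_of_disjoint (fun i => (hm i).comap_le) (hX.iIndepFun_steps hhom).iIndep
    (S := Set.Iic n) (T := Set.Ioi n)
    (Set.disjoint_left.2 fun w hw hw' => absurd (Set.mem_Iic.1 hw) (not_le.2 hw'))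
  rw [IndepFun_iff_Indep]
  refine indep_of_indep_of_le_left (indep_of_indep_of_le_right h ?_) ?_
  · rw [← measurable_iff_comap_le]
    refine @measurable_pi_lambda Ω ℕ (fun _ => ℝ) (⨆ i ∈ Set.Ioi n, MeasurableSpace.comap
      (steps X i) inferInstance) _ _ fun k => ?_
    have : (fun ω => future X n ω k) = fun ω => ∑ l ∈ Finset.range k, steps X (n + l + 1) ω := by
      ext ω; exact (sum_steps X n k ω).symm
    rw [this]
    refine Finset.measurable_fun_sum _ fun l _ => ?_
    refine (comap_measurable (steps X (n + l + 1))).mono ?_ le_rfl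
    exact le_iSup₂_of_le (n + l + 1) (by rw [Set.mem_Ioi]; omega) le_rfl
  · rw [← measurable_iff_comap_le]
    refine @measurable_pi_lambda Ω ℕ (fun _ => ℝ) (⨆ i ∈ Set.Iic n, MeasurableSpace.comap
      (steps X i) inferInstance) _ _ fun k => ?_
    have : (fun ω => past X n ω k) =
        fun ω => steps X 0 ω + ∑ l ∈ Finset.range (min k n), steps X (0 + l + 1) ω := by
      ext ω
      rw [sum_steps, future, past, steps, zero_add]
      ring
    rw [this]
    have hmono : ∀ l ≤ n, Measurable[⨆ i ∈ Set.Iic n, MeasurableSpace.comap (steps X i)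
        inferInstance] (steps X l) := fun l hl =>
      (comap_measurable (steps X l)).mono (le_iSup₂_of_le l hl le_rfl) le_rfl
    refine (hmono 0 (Nat.zero_le n)).add (Finset.measurable_fun_sum _ fun l hl => ?_)
    rw [Finset.mem_range] at hl
    exact hmono _ (by have := min_le_right k n; omega)

/-- Reversing the first `n` increments and changing their signs does not change the law. -/
theorem IsMarkovChain.map_reversal (hX : IsMarkovChain P κ X) (hhom : IsHomogeneousKernel κ)
    (hsymm : IsSymmetricJump κ) (n : ℕ) :
    P.map (fun ω k => X (n - min k n) ω - X n ω) =
      P.map (fun ω k => X (min k n) ω - X 0 ω) := by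
  let σ : ℕ → ℕ := fun l => if l < n then n - 1 - l else l
  have hσ : Function.Injective σ := by
    intro a b h
    simp only [σ] at h
    split_ifs at h <;> omega
  let g : ℕ → ℝ → ℝ := fun l y => if l < n then -y else y
  have hg : ∀ l, Measurable (g l) := fun l => by
    by_cases hl : l < n
    · simp only [g, hl, if_true]; exact measurable_neg
    · simp only [g, hl, if_false]; exact measurable_id
  have hst : ∀ l, Measurable (steps X (σ l + 1)) := fun l => measurable_steps hX.measurable _
  have h1 := ((hX.iIndepFun_steps hhom).precomp (g := fun l => σ l + 1)
    (fun a b h => hσ (Nat.succ_injective h))).comp g hg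
  rw [iIndepFun_iff_map_fun_eq_infinitePi_map fun l => (hg l).comp (hst l)] at h1
  have h2 : (fun l => P.map (g l ∘ steps X (σ l + 1))) = fun _ => κ 0 := by
    ext1 l
    rw [← Measure.map_map (hg l) (hst l), hX.map_steps hhom]
    by_cases hl : l < n
    · simp only [g, hl, if_true]; exact hsymm
    · simp only [g, hl, if_false]; exact Measure.map_id
  rw [h2, ← hX.map_steps_seq hhom 0] at h1
  have hcut : Measurable (fun (u : ℕ → ℝ) (k : ℕ) => pathOf u (min k n)) :=
    measurable_pi_iff.2 fun k => (measurable_pi_apply (min k n)).comp measurable_pathOf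
  have h3 := congrArg (Measure.map fun (u : ℕ → ℝ) (k : ℕ) => pathOf u (min k n)) h1
  rw [Measure.map_map hcut (measurable_pi_iff.2 fun l => (hg l).comp (hst l)),
    Measure.map_map hcut (measurable_pi_iff.2 fun l => measurable_steps hX.measurable _)] at h3
  have e1 : (fun (u : ℕ → ℝ) (k : ℕ) => pathOf u (min k n)) ∘
      (fun ω l => (g l ∘ steps X (σ l + 1)) ω) = fun ω k => X (n - min k n) ω - X n ω := by
    ext ω k
    have : ∀ m ≤ n, pathOf (fun l => (g l ∘ steps X (σ l + 1)) ω) m = X (n - m) ω - X n ω := by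
      intro m
      induction m with
      | zero => intro _; simp [pathOf]
      | succ m ih =>
        intro hm
        have ih := ih (by omega)
        rw [pathOf] at ih ⊢
        rw [Finset.sum_range_succ, ih]
        have hmn : m < n := by omega
        have e2 : n - m = n - 1 - m + 1 := by omega
        have e3 : n - (m + 1) = n - 1 - m := by omega
        simp only [Function.comp, g, σ, hmn, if_true, steps]
        rw [e2, e3]
        ring
    exact this (min k n) (min_le_right k n)
  have e2 : (fun (u : ℕ → ℝ) (k : ℕ) => pathOf u (min k n)) ∘
      (fun ω l => steps X (0 + l + 1) ω) = fun ω k => X (min k n) ω - X 0 ω := by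
    ext ω k
    exact (sum_steps X 0 (min k n) ω).trans (by rw [future, zero_add])
  rw [e1, e2] at h3
  exact h3

/-- Without atoms, the next value almost surely avoids the finitely many previous ones. -/
theorem IsMarkovChain.ae_injective (hX : IsMarkovChain P κ X) (hhom : IsHomogeneousKernel κ)
    (hatom : ∀ y : ℝ, κ 0 {y} = 0) : ∀ᵐ ω ∂P, Function.Injective (fun n => X n ω) := by
  have hne : ∀ m n, m ≤ n → ∀ᵐ ω ∂P, X m ω ≠ X (n + 1) ω := by
    intro m n hmn
    have hp := measurable_past hX.measurable n
    have : IsProbabilityMeasure (P.map (past X n)) :=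
      Measure.isProbabilityMeasure_map hp.aemeasurable
    have hE : MeasurableSet {q : (ℕ → ℝ) × ℝ | q.1 m - q.1 n = q.2} :=
      measurableSet_eq_fun (((measurable_pi_apply m).comp measurable_fst).sub
        ((measurable_pi_apply n).comp measurable_fst)) measurable_snd
    have h := congrArg (fun ν => ν {q : (ℕ → ℝ) × ℝ | q.1 m - q.1 n = q.2})
      (hX.map_past_increment hhom n)
    have hm : Measurable (fun ω => (past X n ω, X (n + 1) ω - X n ω)) :=
      hp.prodMk ((hX.measurable (n + 1)).sub (hX.measurable n))
    rw [Measure.map_apply hm hE,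
      Measure.prod_apply hE] at h
    have h0 : ∀ y : ℕ → ℝ, κ 0 (Prod.mk y ⁻¹' {q : (ℕ → ℝ) × ℝ | q.1 m - q.1 n = q.2}) = 0 := by
      intro y
      convert hatom (y m - y n) using 2
      ext z
      exact eq_comm
    rw [lintegral_congr h0, lintegral_zero] at h
    rw [ae_iff]
    convert h using 2
    ext ω
    simp only [not_not, Set.mem_ofPred_eq, Set.mem_preimage, past]
    rw [min_eq_left hmn, min_self, sub_left_inj]
  have hall : ∀ᵐ ω ∂P, ∀ m n, m ≤ n → X m ω ≠ X (n + 1) ω := by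
    rw [ae_all_iff]; intro m
    rw [ae_all_iff]; intro n
    by_cases hmn : m ≤ n
    · filter_upwards [hne m n hmn] with ω hω _ using hω
    · exact Eventually.of_forall fun ω h => absurd h hmn
  filter_upwards [hall] with ω hω a b hab
  by_contra hne
  rcases lt_or_gt_of_ne hne with h | h
  · obtain ⟨c, rfl⟩ : ∃ c, b = c + 1 := ⟨b - 1, by omega⟩
    exact hω a c (by omega) hab
  · obtain ⟨c, rfl⟩ : ∃ c, a = c + 1 := ⟨a - 1, by omega⟩
    exact hω b c (by omega) hab.symm

theorem IsMarkovChain.isSymmWalk (hX : IsMarkovChain P κ X) (hhom : IsHomogeneousKernel κ)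
    (hsymm : IsSymmetricJump κ) (hatom : ∀ y : ℝ, κ 0 {y} = 0) : IsSymmWalk P X where
  measurable := hX.measurable
  map_future n := by rw [hX.map_future hhom n, hX.map_future hhom 0]
  indep n := hX.indep_past_future hhom n
  reversal n := hX.map_reversal hhom hsymm n
  inj := hX.ae_injective hhom hatom

end Walk

/-! ### Measurability -/

/-- A function that depends only on the order of the first values is measurable. -/
theorem measurable_of_order {E : Type*} [MeasurableSpace E] {f : (ℕ → ℝ) → E} (n : ℕ)
    (h : ∀ x y : ℕ → ℝ, (∀ a ≤ n, ∀ b ≤ n, (x a < x b ↔ y a < y b)) → f x = f y) :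
    Measurable f := by
  let c : (ℕ → ℝ) → (Fin (n + 1) × Fin (n + 1) → Prop) := fun x p => x p.1 < x p.2
  have hc : Measurable c := measurable_pi_iff.2 fun p =>
    measurableSet_setOfPred.1 (measurableSet_lt (measurable_pi_apply _) (measurable_pi_apply _))
  have hf : f.FactorsThrough c := by
    intro x y hxy
    refine h x y fun a ha b hb => ?_
    exact iff_of_eq (congrFun hxy (⟨a, Nat.lt_succ_of_le ha⟩, ⟨b, Nat.lt_succ_of_le hb⟩))
  have he : f = (Function.extend c f fun _ => f 0) ∘ c := by
    ext1 x
    exact (hf.extend_apply _ x).symm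
  rw [he]
  exact (measurable_of_finite _).comp hc

theorem measurable_iterMin (k : ℕ) (S : Set ℕ) (t : ℕ) :
    Measurable fun x : ℕ → ℝ => t ∈ iterMin x k S := by
  induction k generalizing t with
  | zero => exact measurable_const
  | succ k ih =>
    have hcons : ∀ p q, Measurable fun x : ℕ → ℝ => Consec (iterMin x k S) p q := fun p q =>
      (ih p).and ((ih q).and (measurable_const.and
        (Measurable.forall fun s => (ih s).imp measurable_const)))
    have hlt : ∀ a b, Measurable fun x : ℕ → ℝ => x a < x b := fun a b =>
      measurableSet_setOfPred.1 (measurableSet_lt (measurable_pi_apply a) (measurable_pi_apply b))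
    exact Measurable.exists fun p => Measurable.exists fun q =>
      (hcons p t).and ((hcons t q).and ((hlt t p).and (hlt t q)))

theorem measurable_RO (k : ℕ) (S : Set ℕ) (v : ℕ) :
    Measurable fun x : ℕ → ℝ => RO x S k v := by
  cases k with
  | zero => exact measurable_const
  | succ k =>
    have hlt : ∀ a b, Measurable fun x : ℕ → ℝ => x a < x b := fun a b =>
      measurableSet_setOfPred.1 (measurableSet_lt (measurable_pi_apply a) (measurable_pi_apply b))
    exact Measurable.exists fun m => (measurable_iterMin k S m).and (measurable_const.and
      (Measurable.forall fun w => measurable_const.imp (measurable_const.imp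
        (measurable_const.imp (hlt v w)))))

/-- Evaluation of a countable family at a random index is measurable. -/
theorem measurable_eval_nat {Z E : Type*} [MeasurableSpace Z] [MeasurableSpace E] {f : Z → ℕ}
    {h : ℕ → Z → E} (hf : Measurable f) (hh : ∀ l, Measurable (h l)) :
    Measurable fun z => h (f z) z := by
  have : Measurable fun q : ℕ × Z => h q.1 q.2 := measurable_from_prod_countable_right hh
  exact this.comp (hf.prodMk measurable_id)

theorem measurable_nat_of_prop {Z : Type*} [MeasurableSpace Z] {f : Z → ℕ}
    (h : ∀ l, Measurable fun z => f z = l) : Measurable f :=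
  measurable_to_countable' fun l => measurableSet_setOfPred.2 (h l)

theorem measurable_rankIn {Z : Type*} [MeasurableSpace Z] {S : Z → Set ℕ}
    (hS : ∀ t, Measurable fun z => t ∈ S z) (v : ℕ) : Measurable fun z => rankIn (S z) v := by
  classical
  have h1 : Measurable fun z => (fun w : Fin v => (w : ℕ) ∈ S z) :=
    measurable_pi_iff.2 fun w => hS w
  have h2 : (fun z => rankIn (S z) v) = (fun p : Fin v → Prop =>
      rankIn {w | ∃ h : w < v, p ⟨w, h⟩} v) ∘ fun z => (fun w : Fin v => (w : ℕ) ∈ S z) := by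
    ext1 z
    simp only [rankIn, Function.comp]
    congr 1
    ext w
    constructor
    · rintro ⟨h3, h4⟩
      exact ⟨⟨h4, h3⟩, h4⟩
    · rintro ⟨⟨_, h3⟩, h4⟩
      exact ⟨h3, h4⟩
  rw [h2]
  exact (measurable_of_finite _).comp h1

/-- The second case is the default value of `Nat.nth`. -/
theorem enum_eq_iff {S : Set ℕ} {b l : ℕ} : enum S b = l ↔
    (l ∈ S ∧ rankIn S l = b) ∨ (l = 0 ∧ ∀ w, ¬ (w ∈ S ∧ rankIn S w = b)) := by
  classical
  by_cases h : ∃ w, w ∈ S ∧ rankIn S w = b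
  · obtain ⟨w, hw, rfl⟩ := h
    rw [enum_rankIn hw]
    constructor
    · rintro rfl
      exact Or.inl ⟨hw, rfl⟩
    · rintro (⟨h1, h2⟩ | ⟨-, h2⟩)
      · rw [← enum_rankIn h1, h2, enum_rankIn hw]
      · exact absurd ⟨hw, rfl⟩ (h2 w)
  · have h0 : enum S b = 0 := by
      by_contra h0
      have h1 : enum S b ∈ S := Nat.nth_mem_of_ne_zero (p := (· ∈ S)) h0
      refine h ⟨enum S b, h1, ?_⟩
      rw [rankIn_eq_count]
      exact Nat.count_nth (p := (· ∈ S)) fun hf =>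
        Nat.lt_card_toFinset_of_nth_ne_zero (p := (· ∈ S)) h0 hf
    rw [h0]
    push Not at h
    constructor
    · rintro rfl
      exact Or.inr ⟨rfl, fun w hw => h w hw.1 hw.2⟩
    · rintro (⟨h1, h2⟩ | ⟨h1, -⟩)
      · exact absurd h2 (h l h1)
      · exact h1.symm

theorem enum_le {S : Set ℕ} {n : ℕ} (hS : ∀ w ∈ S, w ≤ n) (b : ℕ) : enum S b ≤ n := by
  rcases (enum_eq_iff (S := S) (b := b)).1 rfl with h | h
  · exact hS _ h.1
  · rw [h.1]; exact Nat.zero_le n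

theorem measurable_enum {Z : Type*} [MeasurableSpace Z] {S : Z → Set ℕ}
    (hS : ∀ t, Measurable fun z => t ∈ S z) (b : ℕ) : Measurable fun z => enum (S z) b := by
  have h1 : ∀ l, Measurable fun z => l ∈ S z ∧ rankIn (S z) l = b := fun l =>
    (hS l).and (measurableSet_setOfPred.1 (measurable_rankIn hS l (measurableSet_singleton b)))
  refine measurable_nat_of_prop fun l => ?_
  simp only [enum_eq_iff]
  exact (h1 l).or (measurable_const.and (Measurable.forall fun w => (h1 w).not))

theorem measurable_minTime (k b : ℕ) : Measurable fun x : ℕ → ℝ => minTime x k b :=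
  measurable_enum (measurable_iterMin k Set.univ) b

/-! ### Renewal at the local minima -/

/-- A functional `g l u x` of the part of `x` between the times `l` and `u` that depends only on
the order of the values and does not change under translations of time. -/
structure IsLocal (g : ℕ → ℕ → (ℕ → ℝ) → ℕ) : Prop where
  congr : ∀ l u x y, (∀ a ∈ Set.Icc l u, ∀ b ∈ Set.Icc l u, (x a < x b ↔ y a < y b)) →
    g l u x = g l u y
  shift : ∀ n l u x, g (n + l) (n + u) x = g l u fun k => x (n + k)

/-- The value of the functional `g` between the `b`-th and the next local minimum of order `k`. -/
noncomputable def block (g : ℕ → ℕ → (ℕ → ℝ) → ℕ) (k b : ℕ) (x : ℕ → ℝ) : ℕ :=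
  g (minTime x k b) (minTime x k (b + 1)) x

theorem IsLocal.measurable {g : ℕ → ℕ → (ℕ → ℝ) → ℕ} (hg : IsLocal g) (l u : ℕ) :
    Measurable (g l u) :=
  measurable_of_order u fun x y h => hg.congr l u x y fun a ha b hb => h a ha.2 b hb.2

theorem IsLocal.measurable_block {g : ℕ → ℕ → (ℕ → ℝ) → ℕ} (hg : IsLocal g) (k b : ℕ) :
    Measurable (block g k b) :=
  measurable_eval_nat (h := fun l x => g l (minTime x k (b + 1)) x) (measurable_minTime k b)
    fun l => measurable_eval_nat (h := fun u x => g l u x) (measurable_minTime k (b + 1))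
      fun u => hg.measurable l u

/-- The event about the past of `n` that makes `n` the `b`-th local minimum of order `k`,
provided that the future allows it, and puts the values of `g` on the previous blocks into the
sets `A i`. -/
def preEvent (g : ℕ → ℕ → (ℕ → ℝ) → ℕ) (k n b : ℕ) (A : ℕ → Set ℕ) : Set (ℕ → ℝ) :=
  -- adjoining `n` to the previous local minima supplies the right end of the last block
  {y | LO y (Set.Iic n) k n ∧ rankIn (iterMin y k (Set.Iio n)) n = b ∧
    ∀ i < b, g (enum (insert n (iterMin y k (Set.Iio n))) i)
      (enum (insert n (iterMin y k (Set.Iio n))) (i + 1)) y ∈ A i}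

/-- The value of `g` on the block that starts at a local minimum of order `k`, as a functional of
the future of this minimum. -/
noncomputable def nextBlock (g : ℕ → ℕ → (ℕ → ℝ) → ℕ) (k : ℕ) (z : ℕ → ℝ) : ℕ :=
  g 0 (sInf (iterMin z k (Set.Ioi 0))) z

theorem IsLocal.measurable_nextBlock {g : ℕ → ℕ → (ℕ → ℝ) → ℕ} (hg : IsLocal g) (k : ℕ) :
    Measurable (nextBlock g k) := by
  refine measurable_eval_nat (h := fun u x => g 0 u x) ?_ fun u => hg.measurable 0 u
  have hz : (fun z : ℕ → ℝ => sInf (iterMin z k (Set.Ioi 0))) =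
      fun z => enum (iterMin z k (Set.Ioi 0)) 0 := by
    ext1 z
    exact Nat.nth_zero.symm
  rw [hz]
  exact measurable_enum (measurable_iterMin k _) 0

theorem IsLocal.measurableSet_preEvent {g : ℕ → ℕ → (ℕ → ℝ) → ℕ} (hg : IsLocal g) (k n b : ℕ)
    (A : ℕ → Set ℕ) : MeasurableSet (preEvent g k n b A) := by
  refine measurableSet_setOfPred.2 (measurable_of_order n fun x y h => ?_)
  have h1 : iterMin x k (Set.Iio n) = iterMin y k (Set.Iio n) :=
    iterMin_congr (fun a ha b hb => h a (le_of_lt ha) b (le_of_lt hb)) k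
  have h2 : LO x (Set.Iic n) k n ↔ LO y (Set.Iic n) k n :=
    LO_congr (fun a ha b hb => h a ha b hb) (Set.mem_Iic.2 le_rfl)
  rw [h1, h2]
  have hle : ∀ w ∈ insert n (iterMin y k (Set.Iio n)), w ≤ n := by
    rintro w (rfl | hw)
    · exact le_rfl
    · exact le_of_lt (Set.mem_Iio.1 (iterMin_subset y k _ hw))
  have h3 : ∀ i, g (enum (insert n (iterMin y k (Set.Iio n))) i)
      (enum (insert n (iterMin y k (Set.Iio n))) (i + 1)) x =
      g (enum (insert n (iterMin y k (Set.Iio n))) i)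
      (enum (insert n (iterMin y k (Set.Iio n))) (i + 1)) y := fun i =>
    hg.congr _ _ _ _ fun a ha b hb => h a (ha.2.trans (enum_le hle _)) b
      (hb.2.trans (enum_le hle _))
  simp only [h3]

section Split

variable {x : ℕ → ℝ} {k n : ℕ}

theorem past_lt_iff {a b : ℕ} (ha : a ≤ n) (hb : b ≤ n) :
    x a < x b ↔ x (min a n) < x (min b n) := by
  rw [min_eq_left ha, min_eq_left hb]

/-- Whether `n` is a local minimum of order `k` splits into a condition on the past and a
condition on the future of `n`. -/
theorem mem_iterMin_univ_iff (hx : Function.Injective x) : n ∈ iterMin x k Set.univ ↔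
    LO (fun m => x (min m n)) (Set.Iic n) k n ∧ RO (fun m => x (n + m) - x n) Set.univ k 0 := by
  have himg : (n + ·) '' (Set.univ : Set ℕ) = Set.Ici n := by
    ext w
    simp only [Set.image_univ, Set.mem_range, Set.mem_Ici]
    exact ⟨fun ⟨m, h⟩ => by omega, fun h => ⟨w - n, by omega⟩⟩
  have h1 : LO x Set.univ k n ↔ LO (fun m => x (min m n)) (Set.Iic n) k n := by
    rw [LO_congr_Iio (S' := Set.Iic n) hx.injOn hx.injOn (Set.mem_univ n) (Set.mem_Iic.2 le_rfl)
      fun w hw => ⟨fun _ => hw.le, fun _ => trivial⟩]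
    exact LO_congr (fun a ha b hb => past_lt_iff ha hb) (Set.mem_Iic.2 le_rfl)
  have h2 : RO x Set.univ k n ↔ RO (fun m => x (n + m) - x n) Set.univ k 0 := by
    rw [RO_congr_Ioi (S' := Set.Ici n) hx.injOn hx.injOn (Set.mem_univ n) (Set.mem_Ici.2 le_rfl)
      fun w hw => ⟨fun _ => hw.le, fun _ => trivial⟩, ← himg]
    exact RO_image (φ := (n + ·)) (fun a _ b _ h => Nat.add_lt_add_left h n)
      (fun a _ b _ => (sub_lt_sub_iff_right _).symm) (Set.mem_univ 0)
  rw [mem_iterMin_iff hx.injOn (Set.mem_univ n), h1, h2]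

theorem iterMin_past (hn : n ∈ iterMin x k Set.univ) :
    iterMin (fun m => x (min m n)) k (Set.Iio n) = iterMin x k Set.univ ∩ Set.Iio n := by
  rw [iterMin_inter_Iio hn, Set.univ_inter]
  exact (iterMin_congr (fun a ha b hb => past_lt_iff (le_of_lt ha) (le_of_lt hb)) k).symm

theorem iterMin_future (hn : n ∈ iterMin x k Set.univ) :
    iterMin x k Set.univ ∩ Set.Ioi n =
      (n + ·) '' iterMin (fun m => x (n + m) - x n) k (Set.Ioi 0) := by
  have himg : (n + ·) '' Set.Ioi 0 = Set.Ioi n := by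
    ext w
    simp only [Set.mem_image, Set.mem_Ioi]
    exact ⟨fun ⟨m, h, h'⟩ => by omega, fun h => ⟨w - n, by omega, by omega⟩⟩
  rw [iterMin_inter_Ioi hn, Set.univ_inter, ← himg]
  exact iterMin_image (φ := (n + ·)) (fun a _ b _ h => Nat.add_lt_add_left h n)
      (fun a _ b _ => (sub_lt_sub_iff_right _).symm) k

/-- The enumeration of the elements up to `n` does not depend on later elements. -/
theorem enum_insert_inter_Iio {S : Set ℕ} (hS : S.Infinite) (hn : n ∈ S) {i : ℕ}
    (hi : i ≤ rankIn S n) : enum (insert n (S ∩ Set.Iio n)) i = enum S i := by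
  have hw := enum_mem hS i
  have hle : enum S i ≤ n := by
    by_contra h
    have := rankIn_lt hn (not_le.1 h)
    rw [rankIn_enum hS] at this
    omega
  have hmem : enum S i ∈ insert n (S ∩ Set.Iio n) := by
    rcases hle.eq_or_lt with h | h
    · exact Or.inl h
    · exact Or.inr ⟨hw, h⟩
  have hr : rankIn (insert n (S ∩ Set.Iio n)) (enum S i) = i := by
    refine Eq.trans ?_ (rankIn_enum hS i)
    rw [rankIn, rankIn]
    congr 1
    ext w
    constructor
    · rintro ⟨rfl | h1, h2⟩
      · exact absurd h2 (not_lt.2 hle)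
      · exact ⟨h1.1, h2⟩
    · rintro ⟨h1, h2⟩
      exact ⟨Or.inr ⟨h1, lt_of_lt_of_le h2 hle⟩, h2⟩
  rw [← enum_rankIn hmem, hr]

variable {g : ℕ → ℕ → (ℕ → ℝ) → ℕ}

theorem minTime_eq_iff (hS : (iterMin x k Set.univ).Infinite) {b : ℕ} : minTime x k b = n ↔
    n ∈ iterMin x k Set.univ ∧ rankIn (iterMin x k Set.univ) n = b := by
  constructor
  · rintro rfl
    exact ⟨enum_mem hS b, rankIn_enum hS b⟩
  · rintro ⟨h1, rfl⟩
    exact enum_rankIn h1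

/-- The past event together with the future event `RO` describes the previous blocks and makes `n`
the `b`-th local minimum. -/
theorem mem_preEvent_iff (hg : IsLocal g) (hx : Function.Injective x)
    (hS : (iterMin x k Set.univ).Infinite) {b : ℕ} {A : ℕ → Set ℕ} :
    ((fun m => x (min m n)) ∈ preEvent g k n b A ∧
      RO (fun m => x (n + m) - x n) Set.univ k 0) ↔
    minTime x k b = n ∧ ∀ i < b, block g k i x ∈ A i := by
  have hmem := mem_iterMin_univ_iff (n := n) (k := k) hx
  have key : n ∈ iterMin x k Set.univ → rankIn (iterMin x k Set.univ) n = b →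
      ∀ i < b, g (enum (insert n (iterMin (fun m => x (min m n)) k (Set.Iio n))) i)
        (enum (insert n (iterMin (fun m => x (min m n)) k (Set.Iio n))) (i + 1))
        (fun m => x (min m n)) = block g k i x := by
    intro hn hb i hi
    rw [iterMin_past hn, enum_insert_inter_Iio hS hn (by omega),
      enum_insert_inter_Iio hS hn (by omega)]
    refine (hg.congr _ _ _ _ fun a ha c hc => ?_).symm
    have hle : enum (iterMin x k Set.univ) (i + 1) ≤ n := by
      rw [← (minTime_eq_iff hS).2 ⟨hn, hb⟩]
      exact (minTime_strictMono hS).monotone hi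
    exact past_lt_iff (ha.2.trans hle) (hc.2.trans hle)
  have hrank : n ∈ iterMin x k Set.univ →
      rankIn (iterMin (fun m => x (min m n)) k (Set.Iio n)) n =
        rankIn (iterMin x k Set.univ) n := by
    intro hn
    rw [iterMin_past hn, rankIn, rankIn, Set.inter_assoc, Set.inter_self]
  rw [minTime_eq_iff hS]
  constructor
  · rintro ⟨⟨h1, h2, h3⟩, h4⟩
    have hn := hmem.2 ⟨h1, h4⟩
    rw [hrank hn] at h2
    exact ⟨⟨hn, h2⟩, fun i hi => key hn h2 i hi ▸ h3 i hi⟩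
  · rintro ⟨⟨hn, hb⟩, h⟩
    have h1 := hmem.1 hn
    exact ⟨⟨h1.1, (hrank hn).trans hb, fun i hi => (key hn hb i hi).symm ▸ h i hi⟩, h1.2⟩

theorem block_eq_nextBlock (hg : IsLocal g) (hS : (iterMin x k Set.univ).Infinite) {b : ℕ}
    (hb : minTime x k b = n) : block g k b x = nextBlock g k fun m => x (n + m) - x n := by
  obtain ⟨hn, hr⟩ := (minTime_eq_iff hS).1 hb
  have hf := iterMin_future hn
  have hne : (iterMin (fun m => x (n + m) - x n) k (Set.Ioi 0)).Nonempty := by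
    obtain ⟨m, hm, hnm⟩ := hS.exists_gt n
    have : m ∈ iterMin x k Set.univ ∩ Set.Ioi n := ⟨hm, hnm⟩
    rw [hf] at this
    exact Set.image_nonempty.1 ⟨m, this⟩
  have h1 := Nat.sInf_mem hne
  have h2 : n + sInf (iterMin (fun m => x (n + m) - x n) k (Set.Ioi 0)) ∈
      iterMin x k Set.univ ∩ Set.Ioi n := by
    rw [hf]
    exact ⟨_, h1, rfl⟩
  have hcons : Consec (iterMin x k Set.univ) n
      (n + sInf (iterMin (fun m => x (n + m) - x n) k (Set.Ioi 0))) := by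
    refine ⟨hn, h2.1, h2.2, fun s hs h => ?_⟩
    have h3 : s ∈ iterMin x k Set.univ ∩ Set.Ioi n := ⟨hs, h.1⟩
    rw [hf] at h3
    obtain ⟨m, hm, rfl⟩ := h3
    have := Nat.sInf_le hm
    have := h.2
    simp only at this
    omega
  have h3 : minTime x k (b + 1) =
      n + sInf (iterMin (fun m => x (n + m) - x n) k (Set.Ioi 0)) :=
    (minTime_eq_iff hS).2 ⟨h2.1, by rw [rankIn_of_consec hcons, hr]⟩
  rw [block, hb, h3, nextBlock]
  have h4 := hg.shift n 0 (sInf (iterMin (fun m => x (n + m) - x n) k (Set.Ioi 0))) x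
  rw [Nat.add_zero] at h4
  rw [h4]
  exact hg.congr _ _ _ _ fun a _ c _ => (sub_lt_sub_iff_right _).symm

end Split

section Renewal

theorem IsSymmWalk.measurable_path {Ω : Type*} [MeasurableSpace Ω] {P : Measure Ω}
    {X : ℕ → Ω → ℝ} (hX : IsSymmWalk P X) : Measurable fun ω n => X n ω :=
  measurable_pi_iff.2 hX.measurable

theorem IsSymmWalk.measurable_block {Ω : Type*} [MeasurableSpace Ω] {P : Measure Ω}
    {X : ℕ → Ω → ℝ} (hX : IsSymmWalk P X) {g : ℕ → ℕ → (ℕ → ℝ) → ℕ} (hg : IsLocal g) (k b : ℕ) :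
    Measurable fun ω => block g k b fun n => X n ω :=
  (hg.measurable_block k b).comp hX.measurable_path

variable {Ω : Type*} [MeasurableSpace Ω] {P : Measure Ω} {X : ℕ → Ω → ℝ}
  {g : ℕ → ℕ → (ℕ → ℝ) → ℕ} {k : ℕ}

/-- Splitting at the `b`-th local minimum of order `k`: the previous blocks are independent of an
event that concerns the next block. -/
theorem IsSymmWalk.measure_blocks (hX : IsSymmWalk P X) (hg : IsLocal g)
    (hS : ∀ᵐ ω ∂P, (iterMin (fun n => X n ω) k Set.univ).Infinite) (b : ℕ) (A : ℕ → Set ℕ)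
    (B : Set ℕ) :
    P {ω | (∀ i < b, block g k i (fun n => X n ω) ∈ A i) ∧ block g k b (fun n => X n ω) ∈ B} =
      (∑' n, P (past X n ⁻¹' preEvent g k n b A)) *
        P.map (future X 0) ({z | RO z Set.univ k 0} ∩ nextBlock g k ⁻¹' B) := by
  have hmeas : MeasurableSet ({z : ℕ → ℝ | RO z Set.univ k 0} ∩ nextBlock g k ⁻¹' B) :=
    (measurableSet_setOfPred.2 (measurable_RO k Set.univ 0)).inter
      (hg.measurable_nextBlock k (MeasurableSet.of_discrete))
  have hterm : ∀ n, P {ω | minTime (fun n => X n ω) k b = n ∧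
      (∀ i < b, block g k i (fun n => X n ω) ∈ A i) ∧ block g k b (fun n => X n ω) ∈ B} =
      P (past X n ⁻¹' preEvent g k n b A) *
        P.map (future X 0) ({z | RO z Set.univ k 0} ∩ nextBlock g k ⁻¹' B) := by
    intro n
    rw [← hX.map_future n, Measure.map_apply (measurable_future hX.measurable n) hmeas,
      ← (hX.indep n).measure_inter_preimage_eq_mul _ _ (hg.measurableSet_preEvent k n b A) hmeas]
    refine measure_congr ?_
    filter_upwards [hX.inj, hS] with ω hx hS
    have h1 := mem_preEvent_iff (n := n) (b := b) (A := A) hg hx hS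
    refine propext ⟨?_, ?_⟩
    · rintro ⟨h2, h3, h4⟩
      have h5 := h1.2 ⟨h2, h3⟩
      rw [block_eq_nextBlock hg hS h2] at h4
      exact ⟨h5.1, h5.2, h4⟩
    · rintro ⟨h2, h3, h4⟩
      have h5 := h1.1 ⟨h2, h3⟩
      refine ⟨h5.1, h5.2, ?_⟩
      rw [block_eq_nextBlock hg hS h5.1]
      exact h4
  have hT : Measurable fun ω => minTime (fun n => X n ω) k b :=
    (measurable_minTime k b).comp hX.measurable_path
  have hE : MeasurableSet {ω | (∀ i < b, block g k i (fun n => X n ω) ∈ A i) ∧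
      block g k b (fun n => X n ω) ∈ B} := by
    have hb : ∀ i, Measurable fun ω => block g k i (fun n => X n ω) := fun i =>
      (hg.measurable_block k i).comp hX.measurable_path
    have h1 : ∀ (i : ℕ) (C : Set ℕ), MeasurableSet {ω | block g k i (fun n => X n ω) ∈ C} :=
      fun i C => hb i (MeasurableSet.of_discrete (s := C))
    exact measurableSet_setOfPred.2 ((Measurable.forall fun i => measurable_const.imp
      (measurableSet_setOfPred.1 (h1 i (A i)))).and (measurableSet_setOfPred.1 (h1 b B)))
  rw [← ENNReal.tsum_mul_right]
  simp only [← hterm]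
  rw [← measure_iUnion]
  · congr 1
    ext ω
    simp only [Set.mem_iUnion, Set.mem_ofPred_eq]
    exact ⟨fun h => ⟨_, rfl, h⟩, fun ⟨_, _, h⟩ => h⟩
  · intro m n hmn
    refine Set.disjoint_left.2 fun ω h1 h2 => hmn (h1.1.symm.trans h2.1)
  · intro n
    exact (hT (measurableSet_singleton n)).inter hE

variable [IsProbabilityMeasure P]

/-- The factors in `IsSymmWalk.measure_blocks` are normalized by the case `b = 0` without
conditions. -/
theorem IsSymmWalk.measure_blocks_succ (hX : IsSymmWalk P X) (hg : IsLocal g)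
    (hS : ∀ᵐ ω ∂P, (iterMin (fun n => X n ω) k Set.univ).Infinite) (b : ℕ) (A : ℕ → Set ℕ)
    (B : Set ℕ) :
    P {ω | (∀ i < b, block g k i (fun n => X n ω) ∈ A i) ∧ block g k b (fun n => X n ω) ∈ B} =
      P {ω | ∀ i < b, block g k i (fun n => X n ω) ∈ A i} *
        P {ω | block g k 0 (fun n => X n ω) ∈ B} := by
  have h := fun b A B => hX.measure_blocks hg hS b A B
  have hF := hX.measurable
  have : IsProbabilityMeasure (P.map (future X 0)) :=
    Measure.isProbabilityMeasure_map (measurable_future hF 0).aemeasurable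
  set c := P.map (future X 0) {z | RO z Set.univ k 0} with hc
  have h0 := h 0 A Set.univ
  have h1 := h 0 A B
  have h2 := h b A Set.univ
  have h3 := h b A B
  simp only [Nat.not_lt_zero, false_imp_iff, implies_true, true_and, Set.mem_univ,
    Set.preimage_univ, Set.inter_univ, Set.ofPred_true, measure_univ, and_true] at h0 h1 h2
  rw [← hc] at h0 h2
  rw [h3, h2, h1]
  calc _ = (∑' n, P (past X n ⁻¹' preEvent g k n b A)) *
        P.map (future X 0) ({z | RO z Set.univ k 0} ∩ nextBlock g k ⁻¹' B) *
        ((∑' n, P (past X n ⁻¹' preEvent g k n 0 A)) * c) := by rw [← h0, mul_one]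
    _ = _ := by ring

theorem IsSymmWalk.measure_block_eq (hX : IsSymmWalk P X) (hg : IsLocal g)
    (hS : ∀ᵐ ω ∂P, (iterMin (fun n => X n ω) k Set.univ).Infinite) (b : ℕ) (B : Set ℕ) :
    P ((fun ω => block g k b fun n => X n ω) ⁻¹' B) =
      P ((fun ω => block g k 0 fun n => X n ω) ⁻¹' B) := by
  have := hX.measure_blocks_succ hg hS b (fun _ => Set.univ) B
  simp only [Set.mem_univ, implies_true, true_and, Set.ofPred_true, measure_univ, one_mul] at this
  exact this

/-- The values of a local functional between consecutive local minima of order `k` are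
independent. -/
theorem IsSymmWalk.iIndepFun_block (hX : IsSymmWalk P X) (hg : IsLocal g)
    (hS : ∀ᵐ ω ∂P, (iterMin (fun n => X n ω) k Set.univ).Infinite) :
    iIndepFun (fun b ω => block g k b fun n => X n ω) P := by
  refine iIndepFun_of_range fun m A _ => ?_
  induction m with
  | zero => simp
  | succ m ih =>
    have h := hX.measure_blocks_succ hg hS m A (A m)
    have h1 : {ω | ∀ i < m, block g k i (fun n => X n ω) ∈ A i} =
        ⋂ i ∈ Finset.range m, (fun ω => block g k i fun n => X n ω) ⁻¹' A i := by
      ext ω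
      simp
    have h2 : {ω | (∀ i < m, block g k i (fun n => X n ω) ∈ A i) ∧
        block g k m (fun n => X n ω) ∈ A m} =
        ⋂ i ∈ Finset.range (m + 1), (fun ω => block g k i fun n => X n ω) ⁻¹' A i := by
      ext ω
      simp only [Set.mem_iInter, Finset.mem_range, Set.mem_preimage, Set.mem_ofPred_eq]
      exact ⟨fun h i hi => by
        rcases Nat.lt_succ_iff_lt_or_eq.1 hi with h' | rfl
        · exact h.1 i h'
        · exact h.2, fun h => ⟨fun i hi => h i (by omega), h m (by omega)⟩⟩
    rw [Finset.prod_range_succ, ← ih, hX.measure_block_eq hg hS m, ← h1, ← h2]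
    exact h

theorem IsSymmWalk.identDistrib_block (hX : IsSymmWalk P X) (hg : IsLocal g)
    (hS : ∀ᵐ ω ∂P, (iterMin (fun n => X n ω) k Set.univ).Infinite) (b : ℕ) :
    IdentDistrib (fun ω => block g k b fun n => X n ω) (fun ω => block g k 0 fun n => X n ω)
      P P where
  aemeasurable_fst := (hX.measurable_block hg k b).aemeasurable
  aemeasurable_snd := (hX.measurable_block hg k 0).aemeasurable
  map_eq := by
    ext B hB
    rw [Measure.map_apply (hX.measurable_block hg k b) hB,
      Measure.map_apply (hX.measurable_block hg k 0) hB]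
    exact hX.measure_block_eq hg hS b B

end Renewal

open Classical in
/-- Whether the first value is smaller than the last one, as a number. -/
noncomputable def isUp (l u : ℕ) (x : ℕ → ℝ) : ℕ := if l < u ∧ x l < x u then 1 else 0

theorem isLocal_isUp : IsLocal isUp where
  congr l u x y h := by
    by_cases hlu : l < u
    · simp only [isUp, h l ⟨le_rfl, hlu.le⟩ u ⟨hlu.le, le_rfl⟩]
    · simp only [isUp, hlu, false_and]
  shift n l u x := by simp only [isUp, add_lt_add_iff_left]

theorem isLocal_basinSide (i j : ℕ) : IsLocal (basinSide i j) where
  congr l u x y h := by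
    have h' : ∀ a ∈ Set.Ioo l u, ∀ b ∈ Set.Ioo l u, (x a < x b ↔ y a < y b) := fun a ha b hb =>
      h a (Set.Ioo_subset_Icc_self ha) b (Set.Ioo_subset_Icc_self hb)
    rw [basinSide, basinSide]
    congr 1
    refine Set.ext fun v => and_congr_right fun hv => ?_
    have hlu : l ≤ u := (hv.1.trans hv.2).le
    have hv' := Set.Ioo_subset_Icc_self hv
    rw [h l ⟨le_rfl, hlu⟩ v hv', h u ⟨hlu, le_rfl⟩ v hv', IsSide, IsSide]
    simp only [RO_congr h' hv, LO_congr h' hv]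
  shift n l u x := by
    rw [basinSide, basinSide]
    refine Eq.trans ?_ (Set.ncard_image_of_injective _ (add_right_injective n))
    congr 1
    have hφ : StrictMonoOn (n + ·) (Set.Ioo l u) := fun a _ b _ h => Nat.add_lt_add_left h n
    have himg : (n + ·) '' Set.Ioo l u = Set.Ioo (n + l) (n + u) := by
      ext w
      simp only [Set.mem_image, Set.mem_Ioo]
      exact ⟨fun ⟨m, h, h'⟩ => by omega, fun h => ⟨w - n, by omega, by omega⟩⟩
    have hside : ∀ v ∈ Set.Ioo l u, (IsSide x (Set.Ioo (n + l) (n + u)) i j (n + v) ↔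
        IsSide (fun k => x (n + k)) (Set.Ioo l u) i j v) := by
      intro v hv
      have h1 : ∀ r, RO x (Set.Ioo (n + l) (n + u)) r (n + v) ↔
          RO (fun k => x (n + k)) (Set.Ioo l u) r v := fun r => by
        rw [← himg]
        exact RO_image hφ (fun _ _ _ _ => Iff.rfl) hv
      have h2 : ∀ r, LO x (Set.Ioo (n + l) (n + u)) r (n + v) ↔
          LO (fun k => x (n + k)) (Set.Ioo l u) r v := fun r => by
        rw [← himg]
        exact LO_image hφ (fun _ _ _ _ => Iff.rfl) hv
      rw [IsSide, IsSide]
      simp only [h1, h2]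
    ext w
    constructor
    · rintro ⟨hw, h⟩
      rw [← himg] at hw
      obtain ⟨v, hv, rfl⟩ := hw
      exact ⟨v, ⟨hv, h.1, h.2.1, (hside v hv).1 h.2.2⟩, rfl⟩
    · rintro ⟨v, ⟨hv, h1, h2, h3⟩, rfl⟩
      exact ⟨himg ▸ ⟨v, hv, rfl⟩, h1, h2, (hside v hv).2 h3⟩

/-! ### Expected numbers of vertices -/

/-- The averages of a convolution converge to the product of the limits. -/
theorem tendsto_convolution_div {u v : ℕ → ℝ} {α β : ℝ} (hu : Tendsto u atTop (𝓝 α))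
    (hv : Tendsto v atTop (𝓝 β)) (hv1 : ∀ n, |v n| ≤ 1) :
    Tendsto (fun N : ℕ => (∑ n ∈ Finset.range N, u n * v (N - 1 - n)) / N) atTop
      (𝓝 (α * β)) := by
  have h1 : Tendsto (fun N : ℕ => (N : ℝ)⁻¹ * ∑ n ∈ Finset.range N, |u n - α|) atTop (𝓝 0) := by
    have : Tendsto (fun n => |u n - α|) atTop (𝓝 0) := by
      simpa using (hu.sub_const α).abs
    exact this.cesaro
  have h2 : Tendsto (fun N : ℕ => (N : ℝ)⁻¹ * ∑ n ∈ Finset.range N, (u n - α) * v (N - 1 - n))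
      atTop (𝓝 0) := by
    refine squeeze_zero_norm (fun N => ?_) h1
    rw [Real.norm_eq_abs, abs_mul, abs_of_nonneg (inv_nonneg.2 (Nat.cast_nonneg N))]
    refine mul_le_mul_of_nonneg_left ?_ (inv_nonneg.2 (Nat.cast_nonneg N))
    refine (Finset.abs_sum_le_sum_abs _ _).trans (Finset.sum_le_sum fun n _ => ?_)
    rw [abs_mul]
    exact mul_le_of_le_one_right (abs_nonneg _) (hv1 _)
  have h3 := h2.add (hv.cesaro.const_mul α)
  rw [zero_add] at h3
  refine h3.congr fun N => ?_
  rw [← Finset.sum_range_reflect v N, div_eq_inv_mul, mul_left_comm α, ← mul_add, Finset.mul_sum,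
    ← Finset.sum_add_distrib]
  congr 1
  exact Finset.sum_congr rfl fun n _ => by ring

theorem RO_Iic_mono (x : ℕ → ℝ) (r v : ℕ) : Monotone fun m => RO x (Set.Iic m) r v := by
  intro m n hmn h
  cases r with
  | zero => trivial
  | succ k =>
    obtain ⟨q, hq, hvq, h'⟩ := h
    have hqm : q ≤ m := Set.mem_Iic.1 (iterMin_subset x k _ hq)
    refine ⟨q, ?_, hvq, fun w _ h1 h2 => h' w (h2.trans hqm) h1 h2⟩
    have h3 : ∀ m, Set.Iic m = Set.Iio (m + 1) := fun m =>
      Set.ext fun w => (Nat.lt_succ_iff (m := w) (n := m)).symm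
    rw [h3] at hq ⊢
    exact iterMin_Iio_mono x k (by omega) hq

section Expectation

variable {Ω : Type*} [MeasurableSpace Ω] {P : Measure Ω} {X : ℕ → Ω → ℝ}

/-- The probability that the right child of a vertex has order at least `r` in the series that
stops `m` steps after the vertex. -/
noncomputable def childProb (P : Measure Ω) (X : ℕ → Ω → ℝ) (r m : ℕ) : ℝ :=
  (P.map (future X 0)).real {z | RO z (Set.Iic m) r 0}

theorem measurableSet_RO (r : ℕ) (S : Set ℕ) (v : ℕ) : MeasurableSet {z | RO z S r v} :=
  measurableSet_setOfPred.2 (measurable_RO r S v)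

/-- The law of the order of the left child is that of the right child, by reversal of time. -/
theorem IsSymmWalk.measure_LO (hX : IsSymmWalk P X) (r n : ℕ) :
    P.real (past X n ⁻¹' {y | LO y (Set.Iic n) r n}) = childProb P X r n := by
  have himg : (fun k => n - k) '' Set.Iic n = Set.Iic n := by
    ext w
    simp only [Set.mem_image, Set.mem_Iic]
    exact ⟨fun ⟨m, h, h'⟩ => by omega, fun h => ⟨n - w, by omega, by omega⟩⟩
  have h0 : Measurable fun ω k => X (n - min k n) ω - X n ω :=
    measurable_pi_iff.2 fun k => (hX.measurable _).sub (hX.measurable n)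
  have h0' : Measurable fun ω k => X (min k n) ω - X 0 ω :=
    measurable_pi_iff.2 fun k => (hX.measurable _).sub (hX.measurable 0)
  have h1 : past X n ⁻¹' {y | LO y (Set.Iic n) r n} =
      (fun ω k => X (n - min k n) ω - X n ω) ⁻¹' {z | RO z (Set.Iic n) r 0} := by
    ext ω
    have hφ : StrictAntiOn (fun k => n - k) (Set.Iic n) := fun a ha b hb h => by
      rw [Set.mem_Iic] at ha hb
      simp only
      omega
    have h2 := LO_image_anti hφ (x := past X n ω) (y := fun k => X (n - min k n) ω - X n ω)
      (fun a ha b hb => by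
        rw [sub_lt_sub_iff_right, min_eq_left ha, min_eq_left hb, past, past,
          min_eq_left (Nat.sub_le n a), min_eq_left (Nat.sub_le n b)]) (r := r) (v := 0)
      (Set.mem_Iic.2 (Nat.zero_le n))
    rw [himg] at h2
    exact h2
  have h3 : (fun ω k => X (min k n) ω - X 0 ω) ⁻¹' {z | RO z (Set.Iic n) r 0} =
      future X 0 ⁻¹' {z | RO z (Set.Iic n) r 0} := by
    ext ω
    exact RO_congr (fun a ha b hb => by
      rw [sub_lt_sub_iff_right, future, future, sub_lt_sub_iff_right, min_eq_left ha,
        min_eq_left hb, zero_add, zero_add]) (Set.mem_Iic.2 (Nat.zero_le n))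
  rw [childProb, measureReal_def, measureReal_def, h1,
    ← Measure.map_apply h0 (measurableSet_RO r _ _), hX.reversal n,
    Measure.map_apply h0' (measurableSet_RO r _ _), h3,
    ← Measure.map_apply (measurable_future hX.measurable 0) (measurableSet_RO r _ _)]

theorem IsSymmWalk.measure_mem_pairSet (hX : IsSymmWalk P X) (r s : ℕ) {N n : ℕ} (hn : n < N) :
    P.real {ω | n ∈ pairSet (fun n => X n ω) N r s} =
      childProb P X r n * childProb P X s (N - 1 - n) := by
  have hLO : MeasurableSet {y : ℕ → ℝ | LO y (Set.Iic n) r n} := by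
    refine measurableSet_setOfPred.2 (measurable_of_order n fun x y h => ?_)
    exact propext (LO_congr h (Set.mem_Iic.2 le_rfl))
  have hRO := measurableSet_RO s (Set.Iic (N - 1 - n)) 0
  have himg : (n + ·) '' Set.Iic (N - 1 - n) = Set.Icc n (N - 1) := by
    ext w
    simp only [Set.mem_image, Set.mem_Iic, Set.mem_Icc]
    exact ⟨fun ⟨m, h, h'⟩ => by omega, fun h => ⟨w - n, by omega, by omega⟩⟩
  have h1 : {ω | n ∈ pairSet (fun n => X n ω) N r s} =ᵐ[P]
      (past X n ⁻¹' {y | LO y (Set.Iic n) r n} ∩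
        future X n ⁻¹' {z | RO z (Set.Iic (N - 1 - n)) s 0} : Set Ω) := by
    filter_upwards [hX.inj] with ω hx
    have h2 : LO (fun n => X n ω) (Set.Iio N) r n ↔ LO (past X n ω) (Set.Iic n) r n := by
      rw [LO_congr_Iio (S' := Set.Iic n) hx.injOn hx.injOn (Set.mem_Iio.2 hn) (Set.mem_Iic.2 le_rfl)
        fun w hw => ⟨fun _ => Set.mem_Iic.2 hw.le, fun _ => Set.mem_Iio.2 (hw.trans hn)⟩]
      exact LO_congr (fun a ha b hb => past_lt_iff (x := fun n => X n ω) ha hb)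
        (Set.mem_Iic.2 le_rfl)
    have h3 : RO (fun n => X n ω) (Set.Iio N) s n ↔
        RO (future X n ω) (Set.Iic (N - 1 - n)) s 0 := by
      rw [RO_congr_Ioi (S' := Set.Icc n (N - 1)) hx.injOn hx.injOn (Set.mem_Iio.2 hn)
        (Set.mem_Icc.2 ⟨le_rfl, by omega⟩)
        fun w hw => ⟨fun h => ⟨hw.le, by rw [Set.mem_Iio] at h; omega⟩,
          fun h => by have := h.2; rw [Set.mem_Iio]; omega⟩, ← himg]
      exact RO_image (φ := (n + ·)) (fun a _ b _ h => Nat.add_lt_add_left h n)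
        (fun a _ b _ => (sub_lt_sub_iff_right _).symm) (Set.mem_Iic.2 (Nat.zero_le _))
    exact propext (⟨fun h => ⟨h2.1 h.2.1, h3.1 h.2.2⟩, fun h => ⟨hn, h2.2 h.1, h3.2 h.2⟩⟩)
  rw [← hX.measure_LO r n, measureReal_def, measureReal_def, measure_congr h1,
    (hX.indep n).measure_inter_preimage_eq_mul _ _ hLO hRO, ENNReal.toReal_mul, childProb,
    measureReal_def, ← hX.map_future n, Measure.map_apply (measurable_future hX.measurable n) hRO]

theorem measurable_mem_pairSet (N r s n : ℕ) :
    Measurable fun x : ℕ → ℝ => n ∈ pairSet x N r s := by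
  by_cases hn : n < N
  · refine measurable_of_order N fun x y h => ?_
    have h' : ∀ a ∈ Set.Iio N, ∀ b ∈ Set.Iio N, (x a < x b ↔ y a < y b) := fun a ha b hb =>
      h a (le_of_lt ha) b (le_of_lt hb)
    exact propext (and_congr Iff.rfl (and_congr (LO_congr h' (Set.mem_Iio.2 hn))
      (RO_congr h' (Set.mem_Iio.2 hn))))
  · have : (fun x : ℕ → ℝ => n ∈ pairSet x N r s) = fun _ => False :=
      funext fun x => eq_false fun h => hn h.1
    rw [this]
    exact measurable_const

theorem ncard_eq_sum_indicator (S : Set ℕ) (N : ℕ) (hS : S ⊆ Set.Iio N) :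
    (S.ncard : ℝ) = ∑ n ∈ Finset.range N, S.indicator (fun _ => (1 : ℝ)) n := by
  classical
  have h1 : S = ((Finset.range N).filter (· ∈ S) : Finset ℕ) := by
    ext w
    simp only [Finset.coe_filter, Finset.mem_range, Set.mem_ofPred_eq]
    exact ⟨fun h => ⟨hS h, h⟩, fun h => h.2⟩
  conv_lhs => rw [h1, Set.ncard_coe_finset, Finset.card_filter]
  push_cast
  exact Finset.sum_congr rfl fun n _ => by simp [Set.indicator_apply]

theorem ncard_pairSet_le (x : ℕ → ℝ) (N r s : ℕ) : (pairSet x N r s).ncard ≤ N := by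
  have := Set.ncard_le_ncard (s := pairSet x N r s) (Set.sep_subset _ _) (Set.finite_Iio N)
  rwa [Set.ncard_Iio_nat] at this

theorem measurable_ncard_pairSet (hX : IsSymmWalk P X) (N r s : ℕ) :
    Measurable fun ω => ((pairSet (fun n => X n ω) N r s).ncard : ℝ) := by
  have : (fun ω => ((pairSet (fun n => X n ω) N r s).ncard : ℝ)) = fun ω =>
      ∑ n ∈ Finset.range N, {ω | n ∈ pairSet (fun n => X n ω) N r s}.indicator
        (fun _ => (1 : ℝ)) ω := by
    ext1 ω
    exact ncard_eq_sum_indicator _ N (Set.sep_subset _ _)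
  rw [this]
  refine Finset.measurable_fun_sum _ fun n _ => measurable_const.indicator ?_
  exact measurableSet_setOfPred.2 ((measurable_mem_pairSet N r s n).comp hX.measurable_path)

variable [IsProbabilityMeasure P]

theorem IsSymmWalk.integral_ncard_pairSet (hX : IsSymmWalk P X) (N r s : ℕ) :
    ∫ ω, ((pairSet (fun n => X n ω) N r s).ncard : ℝ) ∂P =
      ∑ n ∈ Finset.range N, childProb P X r n * childProb P X s (N - 1 - n) := by
  have hm : ∀ n, MeasurableSet {ω | n ∈ pairSet (fun n => X n ω) N r s} := fun n =>
    measurableSet_setOfPred.2 ((measurable_mem_pairSet N r s n).comp hX.measurable_path)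
  have : (fun ω => ((pairSet (fun n => X n ω) N r s).ncard : ℝ)) = fun ω =>
      ∑ n ∈ Finset.range N, {ω | n ∈ pairSet (fun n => X n ω) N r s}.indicator
        (fun _ => (1 : ℝ)) ω := by
    ext1 ω
    exact ncard_eq_sum_indicator _ N (Set.sep_subset _ _)
  rw [this, integral_finsetSum _ fun n _ => (integrable_const (1 : ℝ)).indicator (hm n)]
  refine Finset.sum_congr rfl fun n hn => ?_
  rw [integral_indicator_const _ (hm n), smul_eq_mul, mul_one,
    hX.measure_mem_pairSet r s (Finset.mem_range.1 hn)]

/-- There are numbers `ρ r`, the probabilities that the child of a vertex of the infinite series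
has order at least `r`, such that the expected proportion of the vertices with children of order
at least `r` and `s` converges to `ρ r * ρ s`: the two children are independent. -/
theorem IsSymmWalk.exists_tendsto_integral_pairSet (hX : IsSymmWalk P X) : ∃ ρ : ℕ → ℝ,
    (∀ r, 0 ≤ ρ r) ∧ ∀ r s, Tendsto
      (fun N : ℕ => ∫ ω, ((pairSet (fun n => X n ω) N r s).ncard : ℝ) / N ∂P) atTop
      (𝓝 (ρ r * ρ s)) := by
  have : IsProbabilityMeasure (P.map (future X 0)) :=
    Measure.isProbabilityMeasure_map (measurable_future hX.measurable 0).aemeasurable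
  have h0 : ∀ r m, 0 ≤ childProb P X r m := fun r m => measureReal_nonneg
  have h1 : ∀ r m, childProb P X r m ≤ 1 := fun r m => measureReal_le_one
  have hmono : ∀ r, Monotone (childProb P X r) := fun r m n hmn =>
    measureReal_mono fun z hz => RO_Iic_mono z r 0 hmn hz
  have hlim : ∀ r, Tendsto (childProb P X r) atTop (𝓝 (⨆ m, childProb P X r m)) := fun r =>
    tendsto_atTop_ciSup (hmono r) ⟨1, by rintro _ ⟨m, rfl⟩; exact h1 r m⟩
  refine ⟨fun r => ⨆ m, childProb P X r m, fun r => Real.iSup_nonneg (h0 r), fun r s => ?_⟩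
  refine (tendsto_convolution_div (hlim r) (hlim s) fun n => ?_).congr fun N => ?_
  · rw [abs_of_nonneg (h0 s n)]
    exact h1 s n
  · rw [integral_div, hX.integral_ncard_pairSet]

theorem tendsto_integral_of_ae_tendsto_const {f : ℕ → Ω → ℝ} {c : ℝ} (hf : ∀ n, Measurable (f n))
    (h1 : ∀ n ω, |f n ω| ≤ 1) (h : ∀ᵐ ω ∂P, Tendsto (fun n => f n ω) atTop (𝓝 c)) :
    Tendsto (fun n => ∫ ω, f n ω ∂P) atTop (𝓝 c) := by
  have := tendsto_integral_of_dominated_convergence (μ := P) (F := f) (f := fun _ => c)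
    (fun _ => 1) (fun n => (hf n).aestronglyMeasurable) (integrable_const 1)
    (fun n => Eventually.of_forall fun ω => h1 n ω) h
  simpa using this

/-- If the proportion of the vertices with children of order at least `r` and `s` converges, then
the limit is determined by the expectations. -/
theorem IsSymmWalk.eq_of_tendsto_pairSet (hX : IsSymmWalk P X) {ρ : ℕ → ℝ} {r s : ℕ} {c : ℝ}
    (hρ : Tendsto (fun N : ℕ => ∫ ω, ((pairSet (fun n => X n ω) N r s).ncard : ℝ) / N ∂P) atTop
      (𝓝 (ρ r * ρ s)))
    (h : ∀ᵐ ω ∂P, Tendsto (fun N : ℕ => ((pairSet (fun n => X n ω) N r s).ncard : ℝ) / N) atTop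
      (𝓝 c)) : ρ r * ρ s = c := by
  refine tendsto_nhds_unique hρ (tendsto_integral_of_ae_tendsto_const
    (fun N => (measurable_ncard_pairSet hX N r s).div_const _) (fun N ω => ?_) h)
  rw [abs_of_nonneg (by positivity)]
  exact div_le_one_of_le₀ (Nat.cast_le.2 (ncard_pairSet_le _ N r s)) (Nat.cast_nonneg N)

end Expectation

/-! ### Averages -/

theorem tendsto_div_of_abs_sub_le {f g : ℕ → ℝ} {c C : ℝ}
    (hg : Tendsto (fun N : ℕ => g N / N) atTop (𝓝 c)) (h : ∀ N, |f N - g N| ≤ C) :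
    Tendsto (fun N : ℕ => f N / N) atTop (𝓝 c) := by
  have h1 : Tendsto (fun N : ℕ => (f N - g N) / N) atTop (𝓝 0) := by
    refine squeeze_zero_norm (fun N => ?_) (tendsto_const_div_atTop_nhds_zero_nat C)
    rw [Real.norm_eq_abs, abs_div, Nat.abs_cast]
    exact div_le_div_of_nonneg_right (h N) (Nat.cast_nonneg N)
  have h2 := hg.add h1
  rw [add_zero] at h2
  exact h2.congr fun N => by rw [← add_div, add_sub_cancel]

theorem tendsto_natCast_div_self (c : ℝ) :
    Tendsto (fun N : ℕ => c * (N : ℝ) / N) atTop (𝓝 c) := by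
  refine tendsto_const_nhds.congr' ?_
  filter_upwards [eventually_ne_atTop 0] with N hN
  field_simp

theorem tendsto_sub_div {a : ℕ → ℕ} {c : ℝ}
    (ha : Tendsto (fun N : ℕ => (a N : ℝ) / N) atTop (𝓝 c)) (d : ℕ) :
    Tendsto (fun N : ℕ => ((a N - d : ℕ) : ℝ) / N) atTop (𝓝 c) := by
  refine tendsto_div_of_abs_sub_le (C := d) ha fun N => ?_
  have h1 : ((a N - d : ℕ) : ℝ) ≤ a N := Nat.cast_le.2 (Nat.sub_le _ _)
  have h2 : (a N : ℝ) ≤ ((a N - d : ℕ) : ℝ) + d := by exact_mod_cast (by omega : a N ≤ a N - d + d)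
  rw [abs_le]
  constructor <;> linarith

theorem tendsto_atTop_of_tendsto_div {a : ℕ → ℕ} {c : ℝ} (hc : 0 < c)
    (ha : Tendsto (fun N : ℕ => (a N : ℝ) / N) atTop (𝓝 c)) : Tendsto a atTop atTop := by
  rw [← tendsto_natCast_atTop_iff (R := ℝ)]
  refine (ha.pos_mul_atTop hc tendsto_natCast_atTop_atTop).congr' ?_
  filter_upwards [eventually_ne_atTop 0] with N hN
  field_simp

theorem tendsto_comp_div {S : ℕ → ℝ} {a : ℕ → ℕ} {p c : ℝ} (hc : 0 < c)
    (hS : Tendsto (fun n : ℕ => S n / n) atTop (𝓝 p))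
    (ha : Tendsto (fun N : ℕ => (a N : ℝ) / N) atTop (𝓝 c)) :
    Tendsto (fun N : ℕ => S (a N) / N) atTop (𝓝 (p * c)) := by
  have h1 := tendsto_atTop_of_tendsto_div hc ha
  refine ((hS.comp h1).mul ha).congr' ?_
  filter_upwards [h1.eventually_ne_atTop 0, eventually_ne_atTop 0] with N h2 h3
  simp only [Function.comp]
  field_simp

theorem tendsto_div_of_even_odd {V : ℕ → ℝ} {v : ℝ}
    (he : Tendsto (fun n : ℕ => (∑ m ∈ Finset.range n, V (2 * m)) / n) atTop (𝓝 v))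
    (ho : Tendsto (fun n : ℕ => (∑ m ∈ Finset.range n, V (2 * m + 1)) / n) atTop (𝓝 v)) :
    Tendsto (fun n : ℕ => (∑ m ∈ Finset.range n, V m) / n) atTop (𝓝 v) := by
  have hsplit : ∀ n, ∑ m ∈ Finset.range n, V m = ∑ m ∈ Finset.range ((n + 1) / 2), V (2 * m) +
      ∑ m ∈ Finset.range (n / 2), V (2 * m + 1) := by
    intro n
    induction n with
    | zero => simp
    | succ n ih =>
      rw [Finset.sum_range_succ, ih]
      rcases Nat.even_or_odd' n with ⟨q, rfl | rfl⟩
      · rw [show (2 * q + 1 + 1) / 2 = q + 1 by omega, show (2 * q + 1) / 2 = q by omega,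
          show 2 * q / 2 = q by omega, Finset.sum_range_succ]
        ring
      · rw [show (2 * q + 1 + 1) / 2 = q + 1 by omega, show (2 * q + 1) / 2 = q by omega,
          show (2 * q + 1 + 1 + 1) / 2 = q + 1 by omega,
          Finset.sum_range_succ (fun m => V (2 * m + 1))]
        ring
  have half : ∀ d : ℕ, Tendsto (fun n : ℕ => (((n + d) / 2 : ℕ) : ℝ) / n) atTop (𝓝 (1 / 2)) := by
    intro d
    refine tendsto_div_of_abs_sub_le (C := d + 1) (tendsto_natCast_div_self (1 / 2)) fun n => ?_
    have h1 : (n : ℝ) ≤ 2 * ((n + d) / 2 : ℕ) + 1 := by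
      exact_mod_cast (by omega : n ≤ 2 * ((n + d) / 2) + 1)
    have h2 : 2 * (((n + d) / 2 : ℕ) : ℝ) ≤ n + d := by
      exact_mod_cast (by omega : 2 * ((n + d) / 2) ≤ n + d)
    have h3 : (0 : ℝ) ≤ d := Nat.cast_nonneg d
    rw [abs_le]
    constructor <;> linarith
  have h := (tendsto_comp_div one_half_pos he (half 1)).add
    (tendsto_comp_div one_half_pos ho (half 0))
  rw [show v * (1 / 2) + v * (1 / 2) = v by ring] at h
  refine h.congr fun n => ?_
  rw [← add_div, hsplit n]
  rfl

/-! ### Independent signs -/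

section Signs

variable {Ω : Type*} [MeasurableSpace Ω] {P : Measure Ω} [IsProbabilityMeasure P] {U : ℕ → Ω → ℕ}

theorem integrable_of_le_one {Y : Ω → ℝ} (hm : Measurable Y) (h : ∀ ω, |Y ω| ≤ 1) :
    Integrable Y P :=
  Integrable.of_bound hm.aestronglyMeasurable 1 (Eventually.of_forall h)

theorem tendsto_average_signs (hm : ∀ b, Measurable (U b)) (hi : iIndepFun U P)
    (hid : ∀ b, IdentDistrib (U b) (U 0) P P) (h01 : ∀ b ω, U b ω ≤ 1) :
    ∀ᵐ ω ∂P, Tendsto (fun n : ℕ => (∑ b ∈ Finset.range n, (U b ω : ℝ)) / n) atTop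
      (𝓝 (∫ ω, (U 0 ω : ℝ) ∂P)) := by
  have hc : Measurable (fun n : ℕ => (n : ℝ)) := measurable_of_countable _
  refine strong_law_ae_real (fun b ω => (U b ω : ℝ)) ?_ ?_ ?_
  · refine integrable_of_le_one (hc.comp (hm 0)) fun ω => ?_
    rw [Nat.abs_cast]
    exact_mod_cast h01 0 ω
  · exact fun a b hab => (hi.indepFun hab).comp hc hc
  · exact fun b => (hid b).comp hc

/-- The frequency of a change from `0` to `1` in a sequence of independent signs. The even and the
odd positions give two sequences of independent terms. -/
theorem tendsto_average_sign_changes (hm : ∀ b, Measurable (U b)) (hi : iIndepFun U P)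
    (hid : ∀ b, IdentDistrib (U b) (U 0) P P) (h01 : ∀ b ω, U b ω ≤ 1) :
    ∀ᵐ ω ∂P, Tendsto (fun n : ℕ =>
      (∑ b ∈ Finset.range n, (1 - (U b ω : ℝ)) * U (b + 1) ω) / n) atTop
      (𝓝 ((1 - ∫ ω, (U 0 ω : ℝ) ∂P) * ∫ ω, (U 0 ω : ℝ) ∂P)) := by
  let f : ℕ × ℕ → ℝ := fun q => (1 - (q.1 : ℝ)) * q.2
  have hf : Measurable f := measurable_of_countable _
  have hc : Measurable (fun n : ℕ => (n : ℝ)) := measurable_of_countable _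
  have hc' : Measurable (fun n : ℕ => 1 - (n : ℝ)) := measurable_of_countable _
  let V : ℕ → Ω → ℝ := fun b ω => f (U b ω, U (b + 1) ω)
  have hVm : ∀ b, Measurable (V b) := fun b => hf.comp ((hm b).prodMk (hm (b + 1)))
  have hVint : ∀ b, Integrable (V b) P := fun b => by
    refine integrable_of_le_one (hVm b) fun ω => ?_
    have h1 : (U b ω : ℝ) ≤ 1 := by exact_mod_cast h01 b ω
    have h2 : (U (b + 1) ω : ℝ) ≤ 1 := by exact_mod_cast h01 (b + 1) ω
    have h3 : (0 : ℝ) ≤ U b ω := Nat.cast_nonneg _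
    have h4 : (0 : ℝ) ≤ U (b + 1) ω := Nat.cast_nonneg _
    simp only [V, f]
    rw [abs_of_nonneg (mul_nonneg (by linarith) h4)]
    exact mul_le_one₀ (by linarith) h4 h2
  have hVid : ∀ a b, IdentDistrib (V a) (V b) P P := fun a b =>
    (((hid a).trans (hid b).symm).prodMk ((hid (a + 1)).trans (hid (b + 1)).symm)
      (hi.indepFun (Nat.succ_ne_self a).symm) (hi.indepFun (Nat.succ_ne_self b).symm)).comp hf
  have hVmean : ∀ b, ∫ ω, V b ω ∂P =
      (1 - ∫ ω, (U 0 ω : ℝ) ∂P) * ∫ ω, (U 0 ω : ℝ) ∂P := by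
    intro b
    have h1 : IndepFun (fun ω => 1 - (U b ω : ℝ)) (fun ω => (U (b + 1) ω : ℝ)) P :=
      (hi.indepFun (Nat.succ_ne_self b).symm).comp hc' hc
    have h2 : ∀ b, ∫ ω, (U b ω : ℝ) ∂P = ∫ ω, (U 0 ω : ℝ) ∂P := fun b =>
      ((hid b).comp hc).integral_eq
    have h3 : Integrable (fun ω => (U b ω : ℝ)) P := by
      refine integrable_of_le_one (hc.comp (hm b)) fun ω => ?_
      rw [Nat.abs_cast]
      exact_mod_cast h01 b ω
    have h4 := h1.integral_fun_mul_eq_mul_integral (hc'.comp (hm b)).aestronglyMeasurable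
      (hc.comp (hm (b + 1))).aestronglyMeasurable
    rw [integral_sub (integrable_const _) h3, integral_const, probReal_univ, one_smul,
      h2, h2 (b + 1)] at h4
    exact h4
  have hlln : ∀ d, ∀ᵐ ω ∂P, Tendsto (fun n : ℕ =>
      (∑ m ∈ Finset.range n, V (2 * m + d) ω) / n) atTop
      (𝓝 ((1 - ∫ ω, (U 0 ω : ℝ) ∂P) * ∫ ω, (U 0 ω : ℝ) ∂P)) := by
    intro d
    rw [← hVmean (2 * 0 + d)]
    refine strong_law_ae_real (fun m => V (2 * m + d)) (hVint _) (fun a b hab => ?_)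
      fun m => hVid _ _
    exact (hi.indepFun_prodMk_prodMk hm (2 * a + d) (2 * a + d + 1) (2 * b + d) (2 * b + d + 1)
      (by omega) (by omega) (by omega) (by omega)).comp hf hf
  filter_upwards [hlln 0, hlln 1] with ω h0 h1
  exact tendsto_div_of_even_odd (V := fun b => V b ω) h0 h1

end Signs

/-! ### The numbers of local minima of order `r` -/

section Counts

variable {x : ℕ → ℝ} {r : ℕ}

theorem infinite_of_tendsto_minRank {c : ℝ} (hc : 0 < c)
    (h : Tendsto (fun N : ℕ => (minRank x r N : ℝ) / N) atTop (𝓝 c)) :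
    (iterMin x r Set.univ).Infinite := by
  intro hfin
  have h1 := tendsto_atTop_of_tendsto_div hc h
  obtain ⟨N, hN⟩ := (h1.eventually_gt_atTop (iterMin x r Set.univ).ncard).exists
  exact absurd (Set.ncard_le_ncard Set.inter_subset_left hfin) (not_le.2 hN)

theorem isUp_le (l u : ℕ) (x : ℕ → ℝ) : isUp l u x ≤ 1 := by
  unfold isUp
  split_ifs <;> omega

theorem block_isUp (hS : (iterMin x r Set.univ).Infinite) (b : ℕ) : (block isUp r b x : ℝ) =
    {b | x (minTime x r b) < x (minTime x r (b + 1))}.indicator (fun _ => (1 : ℝ)) b := by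
  classical
  have := minTime_strictMono hS b.lt_succ_self
  rw [block, isUp, Set.indicator_apply]
  simp only [this, true_and, Set.mem_ofPred_eq]
  split_ifs <;> simp

theorem one_sub_block_isUp (hx : Function.Injective x) (hS : (iterMin x r Set.univ).Infinite)
    (b : ℕ) : 1 - (block isUp r b x : ℝ) =
    {b | x (minTime x r (b + 1)) < x (minTime x r b)}.indicator (fun _ => (1 : ℝ)) b := by
  classical
  have hne : x (minTime x r b) ≠ x (minTime x r (b + 1)) := fun h =>
    (minTime_strictMono hS b.lt_succ_self).ne (hx h)
  rw [block_isUp hS, Set.indicator_apply, Set.indicator_apply]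
  simp only [Set.mem_ofPred_eq]
  rcases lt_or_gt_of_ne hne with h | h
  · rw [if_pos h, if_neg (lt_asymm h), sub_self]
  · rw [if_neg (lt_asymm h), if_pos h, sub_zero]

theorem ncard_sep_Iio (A : Set ℕ) (n : ℕ) : ((Set.Iio n ∩ A).ncard : ℝ) =
    ∑ b ∈ Finset.range n, A.indicator (fun _ => (1 : ℝ)) b := by
  rw [ncard_eq_sum_indicator _ n Set.inter_subset_left]
  refine Finset.sum_congr rfl fun b hb => ?_
  have h : b ∈ Set.Iio n ∩ A ↔ b ∈ A := and_iff_right (Set.mem_Iio.2 (Finset.mem_range.1 hb))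
  classical
  simp only [Set.indicator_apply, h]

theorem ncard_pairSet_up (hx : Function.Injective x) (hS : (iterMin x r Set.univ).Infinite)
    (N : ℕ) : ((pairSet x N r (r + 1)).ncard : ℝ) =
      ∑ b ∈ Finset.range (minCount x r N - 1), (block isUp r b x : ℝ) := by
  rw [ncard_pairSet_succ_right hx hS]
  refine (ncard_sep_Iio {b | x (minTime x r b) < x (minTime x r (b + 1))} _).trans ?_
  exact Finset.sum_congr rfl fun b _ => (block_isUp hS b).symm

theorem ncard_pairSet_down (hx : Function.Injective x) (hS : (iterMin x r Set.univ).Infinite)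
    (N : ℕ) : ((pairSet x N (r + 1) r).ncard : ℝ) =
      ((minCount x r N - 1 : ℕ) : ℝ) -
        ∑ b ∈ Finset.range (minCount x r N - 1), (block isUp r b x : ℝ) := by
  rw [ncard_pairSet_succ_left hx hS]
  refine (ncard_sep_Iio {b | x (minTime x r (b + 1)) < x (minTime x r b)} _).trans ?_
  rw [← Finset.sum_congr rfl fun b _ => one_sub_block_isUp hx hS b, Finset.sum_sub_distrib]
  simp

theorem valleys_eq_sum (hx : Function.Injective x) (hS : (iterMin x r Set.univ).Infinite)
    (n : ℕ) : (valleys (x ∘ minTime x r) n : ℝ) =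
      ∑ b ∈ Finset.range n, (1 - (block isUp r b x : ℝ)) * block isUp r (b + 1) x := by
  refine (ncard_sep_Iio ({b | x (minTime x r (b + 1)) < x (minTime x r b)} ∩
    {b | x (minTime x r (b + 1)) < x (minTime x r (b + 1 + 1))}) n).trans ?_
  refine Finset.sum_congr rfl fun b _ => ?_
  rw [one_sub_block_isUp hx hS, block_isUp hS]
  classical
  simp only [Set.indicator_apply, Set.mem_inter_iff, Set.mem_ofPred_eq, ite_and, ite_mul, one_mul,
    zero_mul]

end Counts

section Horton

variable {Ω : Type*} [MeasurableSpace Ω] {P : Measure Ω} {X : ℕ → Ω → ℝ}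

/-- The strong Horton law for the numbers of local minima of order `r`, of the initial parts of
the series and of the infinite series. -/
def HortonLaw (P : Measure Ω) (X : ℕ → Ω → ℝ) (r : ℕ) : Prop :=
  ∀ᵐ ω ∂P, Tendsto (fun N : ℕ => (minCount (fun n => X n ω) r N : ℝ) / N) atTop
      (𝓝 ((1 / 4) ^ r)) ∧
    Tendsto (fun N : ℕ => (minRank (fun n => X n ω) r N : ℝ) / N) atTop (𝓝 ((1 / 4) ^ r))

theorem hortonLaw_zero : HortonLaw P X 0 := by
  have h1 : ∀ (x : ℕ → ℝ) (N : ℕ), minCount x 0 N = N := fun x N => Set.ncard_Iio_nat N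
  have h2 : ∀ (x : ℕ → ℝ) (N : ℕ), minRank x 0 N = N := fun x N => by
    rw [minRank, rankIn, iterMin, Set.univ_inter, Set.ncard_Iio_nat]
  have h3 : Tendsto (fun N : ℕ => (N : ℝ) / N) atTop (𝓝 ((1 / 4) ^ 0)) := by
    simpa using tendsto_natCast_div_self 1
  refine Eventually.of_forall fun ω => ?_
  simp only [h1, h2]
  exact ⟨h3, h3⟩

theorem HortonLaw.infinite {r : ℕ} (h : HortonLaw P X r) :
    ∀ᵐ ω ∂P, (iterMin (fun n => X n ω) r Set.univ).Infinite := by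
  filter_upwards [h] with ω hω
  exact infinite_of_tendsto_minRank (by positivity) hω.2

variable [IsProbabilityMeasure P]

/-- The signs of the increments of the series of local minima of order `r` are symmetric. They
need not be compared pathwise: the numbers of vertices with children of orders at least `(r, r + 1)`
and `(r + 1, r)` have the same expected growth. -/
theorem IsSymmWalk.integral_isUp (hX : IsSymmWalk P X) {r : ℕ} (h : HortonLaw P X r) :
    ∫ ω, (block isUp r 0 (fun n => X n ω) : ℝ) ∂P = 1 / 2 := by
  obtain ⟨ρ, -, hρ⟩ := hX.exists_tendsto_integral_pairSet
  have hS := h.infinite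
  have hlim := tendsto_average_signs (U := fun b ω => block isUp r b fun n => X n ω)
    (hX.measurable_block isLocal_isUp r) (hX.iIndepFun_block isLocal_isUp hS)
    (hX.identDistrib_block isLocal_isUp hS) (fun b ω => isUp_le _ _ _)
  have hc : (0 : ℝ) < (1 / 4) ^ r := by positivity
  have hup : ρ r * ρ (r + 1) =
      (∫ ω, (block isUp r 0 (fun n => X n ω) : ℝ) ∂P) * (1 / 4) ^ r := by
    refine hX.eq_of_tendsto_pairSet (hρ r (r + 1)) ?_
    filter_upwards [hX.inj, hS, h, hlim] with ω hx hS h hlim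
    simp only [ncard_pairSet_up hx hS]
    exact tendsto_comp_div
      (S := fun m => ∑ b ∈ Finset.range m, (block isUp r b (fun n => X n ω) : ℝ))
      (a := fun N => minCount (fun n => X n ω) r N - 1) hc hlim (tendsto_sub_div h.1 1)
  have hdown : ρ (r + 1) * ρ r = (1 / 4) ^ r -
      (∫ ω, (block isUp r 0 (fun n => X n ω) : ℝ) ∂P) * (1 / 4) ^ r := by
    refine hX.eq_of_tendsto_pairSet (hρ (r + 1) r) ?_
    filter_upwards [hX.inj, hS, h, hlim] with ω hx hS h hlim
    simp only [ncard_pairSet_down hx hS, sub_div]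
    exact (tendsto_sub_div h.1 1).sub (tendsto_comp_div
      (S := fun m => ∑ b ∈ Finset.range m, (block isUp r b (fun n => X n ω) : ℝ))
      (a := fun N => minCount (fun n => X n ω) r N - 1) hc hlim (tendsto_sub_div h.1 1))
  rw [mul_comm, hup] at hdown
  have : (2 * (∫ ω, (block isUp r 0 (fun n => X n ω) : ℝ) ∂P) - 1) * (1 / 4) ^ r = 0 := by
    linarith
  rcases mul_eq_zero.1 this with h1 | h1
  · linarith
  · exact absurd h1 hc.ne'

/-- The local minima of order `r + 1` are the changes from a negative to a positive increment in
the series of the local minima of order `r`, and these have the frequency `1 / 4`. -/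
theorem IsSymmWalk.hortonLaw_succ (hX : IsSymmWalk P X) {r : ℕ} (h : HortonLaw P X r) :
    HortonLaw P X (r + 1) := by
  have hS := h.infinite
  have hlim := tendsto_average_sign_changes (U := fun b ω => block isUp r b fun n => X n ω)
    (hX.measurable_block isLocal_isUp r) (hX.iIndepFun_block isLocal_isUp hS)
    (hX.identDistrib_block isLocal_isUp hS) (fun b ω => isUp_le _ _ _)
  have hc : (0 : ℝ) < (1 / 4) ^ r := by positivity
  have hval : (1 - ∫ ω, (block isUp r 0 (fun n => X n ω) : ℝ) ∂P) *
      (∫ ω, (block isUp r 0 (fun n => X n ω) : ℝ) ∂P) * (1 / 4) ^ r = (1 / 4) ^ (r + 1) := by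
    rw [hX.integral_isUp h, pow_succ]
    ring
  rw [HortonLaw, ← hval]
  filter_upwards [hX.inj, hS, h, hlim] with ω hx hS h hlim
  simp only [minCount_succ hS, minRank_succ hS, valleys_eq_sum hx hS]
  have key := fun a => tendsto_comp_div (S := fun m => ∑ b ∈ Finset.range m,
    (1 - (block isUp r b (fun n => X n ω) : ℝ)) * block isUp r (b + 1) (fun n => X n ω))
    (a := a) hc hlim
  exact ⟨key _ (tendsto_sub_div h.1 2), key _ (tendsto_sub_div h.2 1)⟩

theorem IsSymmWalk.hortonLaw (hX : IsSymmWalk P X) (r : ℕ) : HortonLaw P X r := by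
  induction r with
  | zero => exact hortonLaw_zero
  | succ r ih => exact hX.hortonLaw_succ ih

/-- Asymptotically, the child orders of a vertex are at least `r` and `s` with probability
`2 ^ (-r) * 2 ^ (-s)`. -/
theorem IsSymmWalk.tendsto_integral_pairSet (hX : IsSymmWalk P X) (r s : ℕ) : Tendsto
    (fun N : ℕ => ∫ ω, ((pairSet (fun n => X n ω) N r s).ncard : ℝ) / N ∂P) atTop
      (𝓝 ((1 / 2) ^ r * (1 / 2) ^ s)) := by
  obtain ⟨ρ, h0, hρ⟩ := hX.exists_tendsto_integral_pairSet
  have h1 : ∀ r, ρ r = (1 / 2) ^ r := by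
    intro r
    have h2 : ρ r * ρ r = (1 / 4) ^ r := by
      refine hX.eq_of_tendsto_pairSet (hρ r r) ?_
      filter_upwards [hX.inj, hX.hortonLaw r] with ω hx h
      simp only [pairSet_self hx]
      exact h.1
    refine (mul_self_inj (h0 r) (by positivity)).1 ?_
    rw [h2, ← mul_pow]
    norm_num
  rw [← h1, ← h1]
  exact hρ r s

end Horton

/-! ### The numbers of side branches -/

section SideCounts

variable {x : ℕ → ℝ}

theorem tendsto_minTime_div {j : ℕ} (h : Tendsto (fun N : ℕ => (minRank x j N : ℝ) / N) atTop
    (𝓝 ((1 / 4) ^ j))) : Tendsto (fun n : ℕ => (minTime x j n : ℝ) / n) atTop (𝓝 (4 ^ j)) := by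
  have hS := infinite_of_tendsto_minRank (by positivity) h
  have h1 := (h.comp (minTime_strictMono hS).tendsto_atTop).inv₀ (by positivity)
  have h2 : ((1 / 4 : ℝ) ^ j)⁻¹ = 4 ^ j := by rw [one_div, inv_pow, inv_inv]
  rw [h2] at h1
  refine h1.congr fun n => ?_
  have h3 : minRank x j (minTime x j n) = n := rankIn_enum hS n
  simp only [Function.comp, h3, inv_div]

/-- The side vertices of type `(i, j)` are counted by the vertices with lower bounds for the orders
of their children, by inclusion and exclusion. -/
theorem ncard_isSide_eq (x : ℕ → ℝ) {i j : ℕ} (hij : i < j) (N : ℕ) :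
    ({v ∈ Set.Iio N | IsSide x (Set.Iio N) i j v}.ncard : ℝ) =
      ((pairSet x N i j).ncard - (pairSet x N (i + 1) j).ncard - (pairSet x N i (j + 1)).ncard +
        (pairSet x N (i + 1) (j + 1)).ncard) +
      ((pairSet x N j i).ncard - (pairSet x N (j + 1) i).ncard - (pairSet x N j (i + 1)).ncard +
        (pairSet x N (j + 1) (i + 1)).ncard) := by
  classical
  have hp : ∀ r s, ((pairSet x N r s).ncard : ℝ) = ∑ v ∈ Finset.range N,
      (if LO x (Set.Iio N) r v then (1 : ℝ) else 0) * (if RO x (Set.Iio N) s v then 1 else 0) := by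
    intro r s
    rw [ncard_eq_sum_indicator (pairSet x N r s) N (Set.sep_subset _ _)]
    refine Finset.sum_congr rfl fun v hv => ?_
    have hv : v ∈ Set.Iio N := Set.mem_Iio.2 (Finset.mem_range.1 hv)
    simp only [Set.indicator_apply, pairSet, Set.mem_ofPred_eq, hv, true_and, ite_and, ite_mul,
      one_mul, zero_mul]
  rw [ncard_eq_sum_indicator _ N (Set.sep_subset _ _)]
  simp only [hp, ← Finset.sum_sub_distrib, ← Finset.sum_add_distrib]
  refine Finset.sum_congr rfl fun v hv => ?_
  have hv : v ∈ Set.Iio N := Set.mem_Iio.2 (Finset.mem_range.1 hv)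
  have hmem : v ∈ {v ∈ Set.Iio N | IsSide x (Set.Iio N) i j v} ↔ IsSide x (Set.Iio N) i j v :=
    and_iff_right hv
  rw [Set.indicator_apply, if_congr hmem rfl rfl]
  unfold IsSide
  clear hp hmem
  have hl1 : LO x (Set.Iio N) (i + 1) v → LO x (Set.Iio N) i v := LO_mono (Nat.le_succ i)
  have hl2 : LO x (Set.Iio N) j v → LO x (Set.Iio N) (i + 1) v := LO_mono hij
  have hl3 : LO x (Set.Iio N) (j + 1) v → LO x (Set.Iio N) j v := LO_mono (Nat.le_succ j)
  have hr1 : RO x (Set.Iio N) (i + 1) v → RO x (Set.Iio N) i v := RO_mono (Nat.le_succ i)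
  have hr2 : RO x (Set.Iio N) j v → RO x (Set.Iio N) (i + 1) v := RO_mono hij
  have hr3 : RO x (Set.Iio N) (j + 1) v → RO x (Set.Iio N) j v := RO_mono (Nat.le_succ j)
  generalize LO x (Set.Iio N) i v = a1 at *
  generalize LO x (Set.Iio N) (i + 1) v = a2 at *
  generalize LO x (Set.Iio N) j v = a3 at *
  generalize LO x (Set.Iio N) (j + 1) v = a4 at *
  generalize RO x (Set.Iio N) i v = b1 at *
  generalize RO x (Set.Iio N) (i + 1) v = b2 at *
  generalize RO x (Set.Iio N) j v = b3 at *
  generalize RO x (Set.Iio N) (j + 1) v = b4 at *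
  by_cases h4 : a4
  · obtain ⟨h3, h2, h1⟩ : a3 ∧ a2 ∧ a1 := by tauto
    simp [h1, h2, h3, h4]
  by_cases h3 : a3
  · obtain ⟨h2, h1⟩ : a2 ∧ a1 := by tauto
    by_cases h5 : b2
    · have := hr1 h5
      simp [*]
    · have h6 : ¬ b3 := fun h => h5 (hr2 h)
      have h7 : ¬ b4 := fun h => h6 (hr3 h)
      by_cases h8 : b1 <;> simp [*]
  · by_cases h2 : a2
    · have h1 := hl1 h2
      simp [h1, h2, h3, h4]
    · by_cases h1 : a1
      · by_cases h5 : b4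
        · have := hr3 h5
          simp [*]
        · by_cases h6 : b3 <;> simp [*]
      · simp [h1, h2, h3, h4]

/-- The side vertices before the first and after the last local minimum of order `j` are negligible:
the time of the last one is asymptotically `N`. -/
theorem tendsto_ncard_isSide {i j : ℕ} {m : ℝ} (hx : Function.Injective x) (hij : i < j)
    (hc : Tendsto (fun N : ℕ => (minCount x j N : ℝ) / N) atTop (𝓝 ((1 / 4) ^ j)))
    (hr : Tendsto (fun N : ℕ => (minRank x j N : ℝ) / N) atTop (𝓝 ((1 / 4) ^ j)))
    (hm : Tendsto (fun n : ℕ => (∑ b ∈ Finset.range n, (block (basinSide i j) j b x : ℝ)) / n)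
      atTop (𝓝 m)) :
    Tendsto (fun N : ℕ => ({v ∈ Set.Iio N | IsSide x (Set.Iio N) i j v}.ncard : ℝ) / N) atTop
      (𝓝 (m * (1 / 4) ^ j)) := by
  have hpos : (0 : ℝ) < (1 / 4) ^ j := by positivity
  have hS := infinite_of_tendsto_minRank hpos hr
  have hc1 := tendsto_sub_div hc 1
  have hlow := tendsto_comp_div (S := fun n => ∑ b ∈ Finset.range n,
    (block (basinSide i j) j b x : ℝ)) (a := fun N => minCount x j N - 1) hpos hm hc1
  have htime : Tendsto (fun N : ℕ => (minTime x j (minCount x j N - 1) : ℝ) / N) atTop (𝓝 1) := by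
    have := tendsto_comp_div (S := fun n => (minTime x j n : ℝ))
      (a := fun N => minCount x j N - 1) hpos (tendsto_minTime_div hr) hc1
    rwa [← mul_pow, show (4 : ℝ) * (1 / 4) = 1 by norm_num, one_pow] at this
  have hN : Tendsto (fun N : ℕ => (N : ℝ) / N) atTop (𝓝 1) := by
    simpa using tendsto_natCast_div_self 1
  have hup := ((tendsto_const_div_atTop_nhds_zero_nat (minTime x j 0 : ℝ)).add hlow).add
    (hN.sub htime)
  rw [zero_add, sub_self, add_zero] at hup
  have hev : ∀ᶠ N in atTop, 1 ≤ minCount x j N :=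
    (tendsto_atTop_of_tendsto_div hpos hc).eventually_ge_atTop 1
  refine tendsto_of_tendsto_of_tendsto_of_le_of_le' hlow hup ?_ ?_
  · filter_upwards [hev] with N h1
    have h := (ncard_isSide_bounds hx hij hS (c := minCount x j N - 1) (N := N) (by omega)).1
    refine div_le_div_of_nonneg_right ?_ (Nat.cast_nonneg N)
    exact_mod_cast h
  · filter_upwards [hev] with N h1
    have h := (ncard_isSide_bounds hx hij hS (c := minCount x j N - 1) (N := N) (by omega)).2
    have hlt : minTime x j (minCount x j N - 1) ≤ N := by
      have : minTime x j (minCount x j N - 1) ∈ iterMin x j (Set.Iio N) := by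
        rw [iterMin_Iio_eq_image hS]
        exact ⟨_, by rw [Set.mem_Iio]; omega, rfl⟩
      exact le_of_lt (Set.mem_Iio.1 (iterMin_subset x j _ this))
    rw [← sub_div, ← add_div, ← add_div]
    refine div_le_div_of_nonneg_right ?_ (Nat.cast_nonneg N)
    rw [← Nat.cast_sub hlt]
    exact_mod_cast h

end SideCounts

section Tokunaga

variable {Ω : Type*} [MeasurableSpace Ω] {P : Measure Ω} [IsProbabilityMeasure P]
  {X : ℕ → Ω → ℝ}

/-- The expected number of side branches of a complete branch is finite: the numbers of side
branches of the first `n` complete branches sum up to at most the length of the series, which is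
asymptotically `4 ^ j * n`. -/
theorem IsSymmWalk.integrable_basinSide (hX : IsSymmWalk P X) (i j : ℕ) :
    Integrable (fun ω => (block (basinSide i j) j 0 (fun n => X n ω) : ℝ)) P := by
  have hS := (hX.hortonLaw j).infinite
  have hloc := isLocal_basinSide i j
  have hmeas := hX.measurable_block hloc j
  have hind := hX.iIndepFun_block hloc hS
  have hid := hX.identDistrib_block hloc hS
  have hf : ∀ K : ℕ, Measurable (fun n : ℕ => ((min n K : ℕ) : ℝ)) := fun K =>
    measurable_of_countable _
  have hint : ∀ K : ℕ, Integrable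
      (fun ω => ((min (block (basinSide i j) j 0 (fun n => X n ω)) K : ℕ) : ℝ)) P := fun K =>
    Integrable.of_bound ((hf K).comp (hmeas 0)).aestronglyMeasurable K
      (Eventually.of_forall fun ω => by
        rw [Real.norm_eq_abs, Nat.abs_cast]
        exact Nat.cast_le.2 (min_le_right _ _))
  have hbound : ∀ K : ℕ,
      ∫ ω, ((min (block (basinSide i j) j 0 (fun n => X n ω)) K : ℕ) : ℝ) ∂P ≤ 4 ^ j := by
    intro K
    have hlln := strong_law_ae_real (μ := P)
      (fun b ω => ((min (block (basinSide i j) j b (fun n => X n ω)) K : ℕ) : ℝ)) (hint K)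
      (fun a b hab => (hind.indepFun hab).comp (hf K) (hf K)) (fun b => (hid b).comp (hf K))
    -- the bound on the expectation is read off from a single path
    obtain ⟨ω, h1, h2, h3⟩ := (hlln.and ((hX.hortonLaw j).and hS)).exists
    refine le_of_tendsto_of_tendsto' h1 (tendsto_minTime_div h2.2) fun n => ?_
    refine div_le_div_of_nonneg_right ?_ (Nat.cast_nonneg n)
    refine le_trans ?_ (Nat.cast_le.2 (sum_basinSide_le (i := i) h3 n))
    rw [Nat.cast_sum]
    exact Finset.sum_le_sum fun b _ => Nat.cast_le.2 (min_le_left _ _)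
  refine ⟨((measurable_of_countable (fun n : ℕ => (n : ℝ))).comp (hmeas 0)).aestronglyMeasurable,
    ?_⟩
  rw [hasFiniteIntegral_iff_ofReal (Eventually.of_forall fun ω => Nat.cast_nonneg _)]
  refine lt_of_le_of_lt ?_ (ENNReal.ofReal_lt_top (r := 4 ^ j))
  have hlim : ∀ ω, Tendsto (fun K : ℕ => ENNReal.ofReal
      ((min (block (basinSide i j) j 0 (fun n => X n ω)) K : ℕ) : ℝ)) atTop
      (𝓝 (ENNReal.ofReal (block (basinSide i j) j 0 (fun n => X n ω) : ℝ))) := fun ω => by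
    refine tendsto_const_nhds.congr' ?_
    filter_upwards [eventually_ge_atTop (block (basinSide i j) j 0 (fun n => X n ω))] with K hK
    rw [min_eq_left hK]
  calc ∫⁻ ω, ENNReal.ofReal (block (basinSide i j) j 0 (fun n => X n ω) : ℝ) ∂P
      = ∫⁻ ω, liminf (fun K : ℕ => ENNReal.ofReal
          ((min (block (basinSide i j) j 0 (fun n => X n ω)) K : ℕ) : ℝ)) atTop ∂P :=
        lintegral_congr fun ω => (hlim ω).liminf_eq.symm
    _ ≤ liminf (fun K : ℕ => ∫⁻ ω, ENNReal.ofReal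
          ((min (block (basinSide i j) j 0 (fun n => X n ω)) K : ℕ) : ℝ) ∂P) atTop :=
        lintegral_liminf_le fun K => ((hf K).comp (hmeas 0)).ennreal_ofReal
    _ ≤ liminf (fun _ : ℕ => ENNReal.ofReal (4 ^ j)) atTop := by
        refine liminf_le_liminf (Eventually.of_forall fun K => ?_)
        rw [← ofReal_integral_eq_lintegral_ofReal (hint K)
          (Eventually.of_forall fun ω => Nat.cast_nonneg _)]
        exact ENNReal.ofReal_le_ofReal (hbound K)
    _ = ENNReal.ofReal (4 ^ j) := liminf_const _

theorem IsSymmWalk.ae_tendsto_ncard_isSide (hX : IsSymmWalk P X) {i j : ℕ} (hij : i < j) :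
    ∀ᵐ ω ∂P, Tendsto (fun N : ℕ =>
      ({v ∈ Set.Iio N | IsSide (fun n => X n ω) (Set.Iio N) i j v}.ncard : ℝ) / N) atTop
      (𝓝 ((∫ ω, (block (basinSide i j) j 0 (fun n => X n ω) : ℝ) ∂P) * (1 / 4) ^ j)) := by
  have hS := (hX.hortonLaw j).infinite
  have hloc := isLocal_basinSide i j
  have hc : Measurable (fun n : ℕ => (n : ℝ)) := measurable_of_countable _
  have hlln := strong_law_ae_real (μ := P)
    (fun b ω => (block (basinSide i j) j b (fun n => X n ω) : ℝ)) (hX.integrable_basinSide i j)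
    (fun a b hab => ((hX.iIndepFun_block hloc hS).indepFun hab).comp hc hc)
    (fun b => (hX.identDistrib_block hloc hS b).comp hc)
  filter_upwards [hX.inj, hX.hortonLaw j, hlln] with ω hx h hlln
  exact tendsto_ncard_isSide hx hij h.1 h.2 hlln

/-- The expected number of side branches, by comparing the almost sure limit of the proportion of
side vertices with the limit of its expectations. -/
theorem IsSymmWalk.integral_basinSide (hX : IsSymmWalk P X) (i k : ℕ) (hk : 1 ≤ k) :
    ∫ ω, (block (basinSide i (i + k)) (i + k) 0 (fun n => X n ω) : ℝ) ∂P = 2 ^ (k - 1) := by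
  have hij : i < i + k := by omega
  generalize hj : i + k = j at hij
  have hp := hX.tendsto_integral_pairSet
  have hi : ∀ r s N, Integrable
      (fun ω => ((pairSet (fun n => X n ω) N r s).ncard : ℝ) / N) P := fun r s N => by
    refine integrable_of_le_one ((measurable_ncard_pairSet hX N r s).div_const _) fun ω => ?_
    rw [abs_of_nonneg (by positivity)]
    exact div_le_one_of_le₀ (Nat.cast_le.2 (ncard_pairSet_le _ N r s)) (Nat.cast_nonneg N)
  have h1 := ((((hp i j).sub (hp (i + 1) j)).sub (hp i (j + 1))).add (hp (i + 1) (j + 1))).add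
    ((((hp j i).sub (hp (j + 1) i)).sub (hp j (i + 1))).add (hp (j + 1) (i + 1)))
  have h2 : Tendsto (fun N : ℕ => ∫ ω,
      ({v ∈ Set.Iio N | IsSide (fun n => X n ω) (Set.Iio N) i j v}.ncard : ℝ) / N ∂P) atTop
      (𝓝 ((1 / 2) ^ (i + j + 1))) := by
    convert h1.congr fun N => ?_ using 2
    · ring
    · simp only [ncard_isSide_eq _ hij, add_div, sub_div]
      rw [integral_add, integral_add, integral_sub, integral_sub, integral_add, integral_sub,
        integral_sub]
      all_goals
        repeat' first
          | exact hi _ _ _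
          | refine Integrable.sub ?_ ?_
          | refine Integrable.add ?_ ?_
  have hmeas : ∀ N : ℕ, Measurable fun ω =>
      ({v ∈ Set.Iio N | IsSide (fun n => X n ω) (Set.Iio N) i j v}.ncard : ℝ) / N := fun N => by
    have hm := fun r s => measurable_ncard_pairSet hX N r s
    simp only [ncard_isSide_eq _ hij]
    exact (((((hm _ _).sub (hm _ _)).sub (hm _ _)).add (hm _ _)).add
      ((((hm _ _).sub (hm _ _)).sub (hm _ _)).add (hm _ _))).div_const _
  have h3 := tendsto_integral_of_ae_tendsto_const hmeas (fun N ω => by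
    rw [abs_of_nonneg (by positivity)]
    have := Set.ncard_le_ncard (s := {v ∈ Set.Iio N | IsSide (fun n => X n ω) (Set.Iio N) i j v})
      (Set.sep_subset _ _) (Set.finite_Iio N)
    rw [Set.ncard_Iio_nat] at this
    exact div_le_one_of_le₀ (Nat.cast_le.2 this) (Nat.cast_nonneg N))
    (hX.ae_tendsto_ncard_isSide hij)
  have h4 := tendsto_nhds_unique h3 h2
  have h5 : (1 / 2 : ℝ) ^ (i + j + 1) = 2 ^ (k - 1) * (1 / 4) ^ j := by
    rw [show (1 / 4 : ℝ) = 1 / 2 * (1 / 2) by norm_num, mul_pow, ← pow_add,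
      show j + j = (k - 1) + (i + j + 1) by omega, pow_add _ (k - 1), ← mul_assoc, ← mul_pow]
    norm_num
  rw [h5] at h4
  exact mul_right_cancel₀ (by positivity) h4

end Tokunaga

/-! ### The level-set trees of a symmetric chain -/

section Tree

variable {x : ℕ → ℝ} {r : ℕ}

theorem tendsto_minCount_atTop (h : Tendsto (fun N : ℕ => (minCount x r N : ℝ) / N) atTop
    (𝓝 ((1 / 4) ^ r))) : Tendsto (minCount x r) atTop atTop :=
  tendsto_atTop_of_tendsto_div (by positivity) h

theorem eventually_lt_order (hx : Function.Injective x)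
    (h : Tendsto (fun N : ℕ => (minCount x r N : ℝ) / N) atTop (𝓝 ((1 / 4) ^ r))) :
    ∀ᶠ N in atTop, r < (seriesTree x N).order := by
  filter_upwards [(tendsto_minCount_atTop h).eventually_ge_atTop 1, eventually_ge_atTop 1] with
    N h1 h2
  rw [lt_order_seriesTree_iff hx h2]
  exact Set.nonempty_of_ncard_ne_zero (by rw [minCount] at h1; omega)

theorem tendsto_numBranches_div (hx : Function.Injective x) (hr : 1 ≤ r)
    (h : Tendsto (fun N : ℕ => (minCount x r N : ℝ) / N) atTop (𝓝 ((1 / 4) ^ r))) :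
    Tendsto (fun N : ℕ => ((seriesTree x N).numBranches r : ℝ) / N) atTop (𝓝 ((1 / 4) ^ r)) := by
  have h1 : Tendsto (fun N : ℕ => ((minCount x r N : ℝ) + 1) / N) atTop (𝓝 ((1 / 4) ^ r)) :=
    tendsto_div_of_abs_sub_le (C := 1) h fun N => by simp
  refine h1.congr' ?_
  filter_upwards [eventually_lt_order hx h, eventually_ge_atTop 1] with N h2 h3
  rw [numBranches_seriesTree hx hr h3, if_pos h2.le, minCount]
  push_cast
  rfl

theorem tendsto_tokunagaIndex (hx : Function.Injective x) {i j : ℕ} {m : ℝ} (hi : 1 ≤ i)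
    (hij : i < j) (h : Tendsto (fun N : ℕ => (minCount x j N : ℝ) / N) atTop (𝓝 ((1 / 4) ^ j)))
    (hm : Tendsto (fun N : ℕ => ({v ∈ Set.Iio N | IsSide x (Set.Iio N) i j v}.ncard : ℝ) / N) atTop
      (𝓝 (m * (1 / 4) ^ j))) :
    Tendsto (fun N : ℕ => (seriesTree x N).tokunagaIndex i j) atTop (𝓝 m) := by
  have hpos : (0 : ℝ) < (1 / 4) ^ j := by positivity
  have h1 := hm.div (tendsto_numBranches_div hx (hi.trans hij.le) h) hpos.ne'
  rw [mul_div_cancel_right₀ _ hpos.ne'] at h1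
  refine h1.congr' ?_
  filter_upwards [eventually_ge_atTop 1] with N hN
  have hN' : (N : ℝ) ≠ 0 := by positivity
  simp only [Pi.div_apply]
  rw [MarkedTree.tokunagaIndex, numSide_seriesTree hx hi hij hN, div_div_div_cancel_right₀ hN']

end Tree

theorem theorem1 {Ω : Type*} [MeasurableSpace Ω] (P : Measure Ω) [IsProbabilityMeasure P]
    (κ : Kernel ℝ ℝ) [IsMarkovKernel κ] (hhom : IsHomogeneousKernel κ)
    (hsymm : IsSymmetricJump κ) (hatom : ∀ y : ℝ, κ 0 {y} = 0)
    (X : ℕ → Ω → ℝ) (hX : IsMarkovChain P κ X) :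
    -- strong Horton law
    (∀ r : ℕ, 1 ≤ r → ∀ᵐ ω ∂P, Tendsto
      (fun N : ℕ => ((seriesTree (fun n => X n ω) N).numBranches r : ℝ) /
        ((N : ℝ) * ((4 : ℝ) ^ r)⁻¹)) atTop (𝓝 1)) ∧
    -- Tokunaga self-similarity with parameters `(a, c) = (1, 2)`
    (∀ i k : ℕ, 1 ≤ i → 1 ≤ k → ∃ τ : ℕ → Ω → ℕ,
      (∀ b, Measurable (τ b)) ∧
      (∀ᵐ ω ∂P, ∀ (N b : ℕ) (s : MarkedTree),
        (completeBranches (fun n => X n ω) N (i + k))[b]? = some s →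
          s.sideCount i = τ b ω) ∧
      (∀ᵐ ω ∂P, Tendsto (fun N : ℕ => (completeBranches (fun n => X n ω) N (i + k)).length)
        atTop atTop) ∧
      iIndepFun τ P ∧
      (∀ b, IdentDistrib (τ b) (τ 0) P P) ∧
      (∀ b, Integrable (fun ω => (τ b ω : ℝ)) P ∧
        ∫ ω, (τ b ω : ℝ) ∂P = 1 * (2 : ℝ) ^ (k - 1))) ∧
    -- the order of the tree tends to infinity
    (∀ᵐ ω ∂P, Tendsto (fun N : ℕ => (seriesTree (fun n => X n ω) N).order) atTop atTop) ∧
    -- convergence of the Tokunaga indices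
    (∀ i k : ℕ, 1 ≤ i → 1 ≤ k → ∀ᵐ ω ∂P, Tendsto
      (fun N : ℕ => (seriesTree (fun n => X n ω) N).tokunagaIndex i (i + k))
      atTop (𝓝 ((2 : ℝ) ^ (k - 1)))) := by
  have hW := hX.isSymmWalk hhom hsymm hatom
  refine ⟨fun r hr => ?_, fun i k hi hk => ?_, ?_, fun i k hi hk => ?_⟩
  · filter_upwards [hW.inj, hW.hortonLaw r] with ω hx h
    have hpos : ((1 : ℝ) / 4) ^ r ≠ 0 := by positivity
    have h1 := (tendsto_numBranches_div hx hr h.1).div_const ((1 / 4) ^ r)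
    rw [div_self hpos] at h1
    refine h1.congr fun N => ?_
    rw [div_div, one_div, inv_pow]
  · have hS := (hW.hortonLaw (i + k)).infinite
    have hloc := isLocal_basinSide i (i + k)
    refine ⟨fun b ω => block (basinSide i (i + k)) (i + k) b fun n => X n ω,
      hW.measurable_block hloc (i + k), ?_, ?_, hW.iIndepFun_block hloc hS,
      hW.identDistrib_block hloc hS, fun b => ?_⟩
    · filter_upwards [hW.inj, hS] with ω hx hS N b s h
      exact sideCount_completeBranches_eq hx hi (by omega) hS h
    · filter_upwards [hW.inj, hW.hortonLaw (i + k)] with ω hx h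
      refine ((tendsto_sub_atTop_nat 1).comp (tendsto_minCount_atTop h.1)).congr' ?_
      filter_upwards [eventually_ge_atTop 1] with N hN
      exact (length_completeBranches hx (by omega) hN).symm
    · have hid := (hW.identDistrib_block hloc hS b).comp
        (measurable_of_countable (fun n : ℕ => (n : ℝ)))
      refine ⟨hid.integrable_iff.2 (hW.integrable_basinSide i (i + k)), ?_⟩
      rw [one_mul, ← hW.integral_basinSide i k hk]
      exact hid.integral_eq
  · have h := ae_all_iff.2 hW.hortonLaw
    filter_upwards [hW.inj, h] with ω hx h
    refine tendsto_atTop.2 fun r => ?_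
    filter_upwards [eventually_lt_order hx (h r).1] with N hN using hN.le
  · filter_upwards [hW.inj, hW.hortonLaw (i + k), hW.ae_tendsto_ncard_isSide (i := i)
      (j := i + k) (by omega)] with ω hx h hm
    rw [hW.integral_basinSide i k hk] at hm
    exact tendsto_tokunagaIndex hx hi (by omega) h.1 hm
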